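/- Let $\alpha_1,\alpha_2,\alpha_3,\beta$ be the $4\times4$ Dirac matrices in the standard representation, $\beta=\begin{pmatrix}I_2&0\\0&-I_2\end{pmatrix}$, $\alpha_j=\begin{pmatrix}0&\sigma_j\\\sigma_j&0\end{pmatrix}$ with the Pauli matrices $\sigma_j$. For $\sigma\in\mathbb R$ put $\|\Psi\|_\sigma=\|(1+|x|)^\sigma\Psi\|_{L^2(\mathbb R^3;\mathbb C^4)}$, and let $L^2_\sigma$ be the space of measurable $\Psi:\mathbb R^3\to\mathbb C^4$ with $\|\Psi\|_\sigma<\infty$. Let $m\in\mathbb R$ and $v\in\mathbb R^3$ with $|v|<1$. Then the free Dirac equation in the frame moving with velocity $v$, $$\dot\Psi(x,t)=[-\alpha\cdot\nabla-i\beta m+v\cdot\nabla]\Psi(x,t),\qquad x\in\mathbb R^3,\ t\in\mathbb R,$$ has a propagator $W_v(t)$, $t\in\mathbb R$: bounded linear operators on $L^2(\mathbb R^3;\mathbb C^4)$ such that, for every $\Phi\in L^2(\mathbb R^3;\mathbb C^4)$, $t\mapsto W_v(t)\Phi$ is the unique solution in $C(\mathbb R;L^2(\mathbb R^3;\mathbb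 C^4))$, in the sense of distributions, with value $\Phi$ at $t=0$. Moreover, for every $\nu>3/2$ there is a constant $C=C_\nu(v,m)>0$ such that for all $\Phi\in L^2_\nu$ $$\|W_v(t)\Phi\|_{-\nu}\le\frac{C\,\|\Phi\|_\nu}{(1+|t|)^{3/2}},\qquad t\ge0.$$ -/

import Mathlib

open MeasureTheory
open scoped ENNReal

noncomputable section

/-- Physical space `ℝ³` with the Euclidean norm. -/
abbrev Space3 : Type := EuclideanSpace ℝ (Fin 3)

/-- The spinor space `ℂ⁴` with the Hermitian norm. -/
abbrev Spinor : Type := EuclideanSpace ℂ (Fin 4)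

/-- The Hilbert space `L²(ℝ³) ⊗ ℂ⁴` of (classes of) square integrable spinor fields. -/
abbrev SpinorL2 : Type := Lp Spinor 2 (volume : Measure Space3)

/-- The Dirac matrix `β = diag(1, 1, -1, -1)` in the standard representation. -/
def diracBeta : Matrix (Fin 4) (Fin 4) ℂ :=
  !![1, 0, 0, 0;
     0, 1, 0, 0;
     0, 0, -1, 0;
     0, 0, 0, -1]

/-- The Dirac matrices `α₁, α₂, α₃` in the standard representation: the off-diagonal `2 × 2` blocks
of `α_j` are the Pauli matrix `σ_j`, the diagonal blocks vanish. -/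
def diracAlpha : Fin 3 → Matrix (Fin 4) (Fin 4) ℂ :=
  ![!![0, 0, 0, 1;
       0, 0, 1, 0;
       0, 1, 0, 0;
       1, 0, 0, 0],
    !![0, 0, 0, -Complex.I;
       0, 0, Complex.I, 0;
       0, -Complex.I, 0, 0;
       Complex.I, 0, 0, 0],
    !![0, 0, 1, 0;
       0, 0, 0, -1;
       1, 0, 0, 0;
       0, -1, 0, 0]]

/-- A complex `4 × 4` matrix acting on spinors. -/
def spinorAct (A : Matrix (Fin 4) (Fin 4) ℂ) (s : Spinor) : Spinor :=
  WithLp.toLp 2 (A.mulVec (WithLp.ofLp s))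

/-- The partial derivative `∂_j φ` of a scalar test function. -/
def partialD (j : Fin 3) (φ : SchwartzMap Space3 ℂ) (x : Space3) : ℂ :=
  fderiv ℝ φ x (EuclideanSpace.single j 1)

/-- The value of the distribution `Ψ` on the test function `φ`, i.e. `∫ φ(x) Ψ(x) dx ∈ ℂ⁴`. -/
def distPair (Ψ : SpinorL2) (φ : SchwartzMap Space3 ℂ) : Spinor :=
  ∫ x, φ x • Ψ x

/-- The value of the distributional derivative `∂_j Ψ` on `φ`, i.e. `-∫ ∂_jφ(x) Ψ(x) dx`. -/
def distDerivPair (j : Fin 3) (Ψ : SpinorL2) (φ : SchwartzMap Space3 ℂ) : Spinor :=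
  -∫ x, partialD j φ x • Ψ x

/-- The value on `φ` of the distribution `[-α·∇ - iβm + v·∇] Ψ`. -/
def movingDiracPair (m : ℝ) (v : Space3) (Ψ : SpinorL2) (φ : SchwartzMap Space3 ℂ) : Spinor :=
  -(∑ j, spinorAct (diracAlpha j) (distDerivPair j Ψ φ))
    - (Complex.I * (m : ℂ)) • spinorAct diracBeta (distPair Ψ φ)
    + ∑ j, (v j : ℂ) • distDerivPair j Ψ φ

/-- `Ψ ∈ C(ℝ, L²)` solves `∂ₜΨ = [-α·∇ - iβm + v·∇] Ψ` in the sense of distributions: for every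
test function `φ` the function `t ↦ ⟨Ψ(t), φ⟩` is differentiable, with derivative the value on `φ`
of the right hand side. -/
structure IsMovingDiracSolution (m : ℝ) (v : Space3) (Ψ : ℝ → SpinorL2) : Prop where
  continuous : Continuous Ψ
  equation : ∀ (φ : SchwartzMap Space3 ℂ) (t : ℝ),
    HasDerivAt (fun s : ℝ => distPair (Ψ s) φ) (movingDiracPair m v (Ψ t) φ) t

/-- `W` is the dynamical group (propagator) of `∂ₜΨ = [-α·∇ - iβm + v·∇] Ψ`: for every initial
state `Φ ∈ L²` the function `t ↦ W(t)Φ` is the unique solution in `C(ℝ, L²)` that equals `Φ` at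
time `0`. -/
def IsMovingDiracPropagator (m : ℝ) (v : Space3) (W : ℝ → SpinorL2 →L[ℂ] SpinorL2) : Prop :=
  ∀ Φ : SpinorL2,
    (IsMovingDiracSolution m v (fun t => W t Φ) ∧ W 0 Φ = Φ) ∧
    ∀ Ψ : ℝ → SpinorL2, IsMovingDiracSolution m v Ψ → Ψ 0 = Φ → ∀ t, Ψ t = W t Φ

/-- The weighted (Agmon) norm `‖Ψ‖_σ = ‖(1 + |x|)^σ Ψ‖_{L²}`, with value `∞` when `Ψ` does not
belong to the weighted space `L²_σ`. -/
def agmonNorm (σ : ℝ) (Ψ : Space3 → Spinor) : ℝ≥0∞ :=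
  eLpNorm (fun x => (1 + ‖x‖) ^ σ • Ψ x) 2 volume

end

/-!
With the convention `𝓕 f (k) = ∫ e^{-2πi k·x} f(x) dx` the generator `-α·∇ - iβm + v·∇` becomes
multiplication by `M(k) = N(k) + 2πi v·k`, where `N(k) = -2πi α·k - iβm` is skew-adjoint and
`N(k)² = -ω(k)²` with `ω(k) = √(4π²|k|² + m²)`. Hence the propagator is the Fourier multiplier
`e^{2πi t v·k} (cos(tω) + ω⁻¹ sin(tω) N(k))` (`diracPropagator`), which is bounded by `2`
uniformly in `t`.

*Uniqueness.* If `D` is the difference of two solutions and `E(t) = ∫₀ᵗ D`, the equation integrated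
in time says `D = M E` on the Fourier side, almost everywhere. So `E` is differentiable in `L²` and
`d/dt ‖E‖² = 2 Re ⟪E, M E⟫ = 0`, whence `E = 0` and `D = E' = 0`
(`IsMovingDiracSolution.eq_zero`). Passing to `E` avoids any regularity assumption on `D`.

*Decay.* Only `t ≥ 1` matters. Put `δ = 1 - |v|`. The parts of the initial state and of the
solution outside the ball `|x| ≤ δt/4` gain a factor of order `t^{-ν} ≤ t^{-3/2}` from the weights.
What is left is a pairing `⟪g, W(t) f⟫` of states supported in that ball. There the integral kernel
of `W(t)` is only evaluated at points `z = x - y + t v` with `|z| ≤ (1 - δ/2) t`, strictly inside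
the light cone, where it is `O(t^{-3/2})`
(`exists_norm_kernel_le`, `exists_norm_inner_diracPropagator_le`). As `ν > 3/2`, the weighted space
embeds into `L¹`, so this bound suffices (`exists_agmonNorm_diracPropagator_le`).

*The kernel.* It is a combination of the integrals `∫ e^{2πi k·z} e^{-τω(k)} dk`, and of those with
an additional `1/ω` or `k_j/ω`, at `τ = ε ± it`, the damping `ε > 0` being removed at the end. For
real `τ > 0`, subordination of `e^{-τω}` to the heat semigroup `e^{-sω²}` and Gaussian integration
in `k` express them by the integrals `∫ s^{-n} e^{-m²s - w/(4s)} ds/s` with `w = τ² + |z|²`. These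
are Macdonald functions of `|m| √w` (powers of `w` if `m = 0`), so the identity continues
analytically to `Re τ > 0` (`exists_heatIntegral_continuation`). The bound `|K_n(q)| ≤ C |q|^{-1/2}`
away from `q = 0`, uniform up to the imaginary axis, comes from one integration by parts in `∫ cosh(nξ) e^{-q cosh ξ} dξ`
over the whole line (`norm_integral_mul_cexp_neg_cosh_le`). Inside the cone `|w|` is bounded below
by a multiple of `t²`, so that the resulting `|w|^{-3/4}` and `t |w|^{-5/4}` are `O(t^{-3/2})`.
-/

open Filter Topology

/-! ### Holomorphy of Laplace integrals -/

theorem differentiableOn_integral_mul_cexp_neg {X : Type*} [MeasurableSpace X] {μ : Measure X}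
    {φ : X → ℝ} {g : X → ℂ} (hφ : ∀ x, 0 ≤ φ x) (hφm : AEStronglyMeasurable φ μ)
    (hg : AEStronglyMeasurable g μ)
    (hint : ∀ a : ℝ, 0 < a → Integrable (fun x => ‖g x‖ * Real.exp (-(a * φ x))) μ) :
    DifferentiableOn ℂ (fun τ : ℂ => ∫ x, g x * Complex.exp (-(τ * φ x)) ∂μ)
      {τ : ℂ | 0 < τ.re} := by
  intro τ₀ hτ₀
  have ha : 0 < τ₀.re := hτ₀
  have hm : ∀ τ : ℂ, AEStronglyMeasurable (fun x => g x * Complex.exp (-(τ * φ x))) μ := fun τ =>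
    hg.mul (Complex.continuous_exp.comp_aestronglyMeasurable
      ((Complex.continuous_ofReal.comp_aestronglyMeasurable hφm).const_mul τ).neg)
  have hnorm : ∀ (τ : ℂ) x, ‖Complex.exp (-(τ * φ x))‖ = Real.exp (-(τ.re * φ x)) := by
    intro τ x; rw [Complex.norm_exp]; simp
  have key := hasDerivAt_integral_of_dominated_loc_of_deriv_le (μ := μ) (𝕜 := ℂ)
    (F := fun (τ : ℂ) x => g x * Complex.exp (-(τ * φ x)))
    (F' := fun (τ : ℂ) x => g x * (Complex.exp (-(τ * φ x)) * (-(φ x))))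
    (x₀ := τ₀) (s := Metric.ball τ₀ (τ₀.re / 2))
    (bound := fun x => (4 / τ₀.re) * (‖g x‖ * Real.exp (-(τ₀.re / 4 * φ x))))
    (Metric.ball_mem_nhds _ (by positivity)) (Eventually.of_forall hm)
    ?_ ?_ ?_ ?_ ?_
  · exact key.2.differentiableAt.differentiableWithinAt
  · refine (hint τ₀.re ha).mono' (hm τ₀) (Eventually.of_forall fun x => ?_)
    rw [norm_mul, hnorm]
  · exact hg.mul ((Complex.continuous_exp.comp_aestronglyMeasurable
      ((Complex.continuous_ofReal.comp_aestronglyMeasurable hφm).const_mul τ₀).neg).mul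
      (Complex.continuous_ofReal.comp_aestronglyMeasurable hφm).neg)
  · refine Eventually.of_forall fun x τ hτ => ?_
    rw [norm_mul, norm_mul, hnorm, norm_neg, Complex.norm_real, Real.norm_of_nonneg (hφ x)]
    have hre : τ₀.re / 2 ≤ τ.re := by
      have h1 : ‖τ - τ₀‖ < τ₀.re / 2 := by simpa [dist_eq_norm] using hτ
      have h2 := (Complex.abs_re_le_norm (τ - τ₀)).trans h1.le
      rw [Complex.sub_re, abs_le] at h2
      linarith
    have h3 : Real.exp (-(τ.re * φ x)) ≤ Real.exp (-(τ₀.re / 4 * φ x)) *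
        Real.exp (-(τ₀.re / 4 * φ x)) := by
      rw [← Real.exp_add]
      exact Real.exp_le_exp.2 (by nlinarith [hφ x])
    have h4 : φ x * Real.exp (-(τ₀.re / 4 * φ x)) ≤ 4 / τ₀.re := by
      rw [Real.exp_neg, ← div_eq_mul_inv, div_le_iff₀ (Real.exp_pos _)]
      have h5 : τ₀.re / 4 * φ x ≤ Real.exp (τ₀.re / 4 * φ x) := by
        have := Real.add_one_le_exp (τ₀.re / 4 * φ x); linarith
      calc φ x = 4 / τ₀.re * (τ₀.re / 4 * φ x) := by field_simp
        _ ≤ _ := by gcongr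
    calc ‖g x‖ * (Real.exp (-(τ.re * φ x)) * φ x)
        ≤ ‖g x‖ * ((Real.exp (-(τ₀.re / 4 * φ x)) * Real.exp (-(τ₀.re / 4 * φ x))) * φ x) := by
          have := hφ x
          gcongr
      _ = (φ x * Real.exp (-(τ₀.re / 4 * φ x))) * (‖g x‖ * Real.exp (-(τ₀.re / 4 * φ x))) := by
          ring
      _ ≤ _ := by gcongr
  · exact (hint _ (by positivity)).const_mul _
  · refine Eventually.of_forall fun x τ _ => ?_
    have h1 : HasDerivAt (fun τ : ℂ => -(τ * (φ x : ℂ))) (-(φ x : ℂ)) τ := by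
      exact (hasDerivAt_mul_const (φ x : ℂ)).neg
    exact (h1.cexp).const_mul (g x)

/-! ### Macdonald integrals -/

theorem integrable_deriv_of_nonneg {g g' : ℝ → ℝ} {a b : ℝ} (hd : ∀ x, HasDerivAt g (g' x) x)
    (hg' : ∀ x, 0 ≤ g' x) (hB : Tendsto g atBot (𝓝 a)) (hT : Tendsto g atTop (𝓝 b)) :
    Integrable g' := by
  rw [← integrableOn_univ, ← Set.Iic_union_Ioi (a := (0 : ℝ))]
  refine IntegrableOn.union ?_
    (integrableOn_Ioi_deriv_of_nonneg' (fun x _ => hd x) (fun x _ => hg' x) hT)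
  have h1 : IntegrableOn (fun x => g' (-x)) (Set.Ioi 0) :=
    integrableOn_Ioi_deriv_of_nonneg' (g := fun x => -g (-x))
      (fun x _ => by
        have h := ((hd (-x)).comp x (hasDerivAt_neg x)).neg
        rw [mul_neg_one, neg_neg] at h
        exact h)
      (fun x _ => hg' _) (hB.comp tendsto_neg_atTop_atBot).neg
  rw [integrableOn_Iic_iff_integrableOn_Iio]
  have h2 := ((Measure.measurePreserving_neg (volume : Measure ℝ)).integrableOn_comp_preimage
    (MeasurableEquiv.neg ℝ).measurableEmbedding).2 h1
  simpa [Function.comp_def] using h2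

theorem abs_sinh_le_cosh (ξ : ℝ) : |Real.sinh ξ| ≤ Real.cosh ξ := by
  rw [← Real.cosh_abs, Real.abs_sinh]
  exact (Real.sinh_lt_cosh _).le

theorem hasDerivAt_arctan_mul_sinh (c ξ : ℝ) :
    HasDerivAt (fun ξ => Real.arctan (c * Real.sinh ξ))
      (c * (Real.cosh ξ / (1 + c ^ 2 * Real.sinh ξ ^ 2))) ξ := by
  have := ((Real.hasDerivAt_sinh ξ).const_mul c).arctan
  convert this using 1
  rw [mul_pow]; ring

theorem tendsto_sinh_atTop : Tendsto Real.sinh atTop atTop :=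
  Real.sinhOrderIso.tendsto_atTop

theorem tendsto_sinh_atBot : Tendsto Real.sinh atBot atBot :=
  Real.sinhOrderIso.tendsto_atBot

/-- The total mass of the weight `cosh ξ / (1 + Q sinh² ξ)`, which is a derivative of `arctan`. -/
theorem integrable_cosh_div_one_add_sq {Q : ℝ} (hQ : 0 < Q) :
    Integrable (fun ξ : ℝ => Real.cosh ξ / (1 + Q * Real.sinh ξ ^ 2)) ∧
    ∫ ξ : ℝ, Real.cosh ξ / (1 + Q * Real.sinh ξ ^ 2) = Real.pi / √Q := by
  have hc : 0 < √Q := Real.sqrt_pos.2 hQ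
  have hd : ∀ ξ, HasDerivAt (fun ξ => Real.arctan (√Q * Real.sinh ξ))
      (√Q * (Real.cosh ξ / (1 + Q * Real.sinh ξ ^ 2))) ξ := by
    intro ξ
    have := hasDerivAt_arctan_mul_sinh (√Q) ξ
    rwa [Real.sq_sqrt hQ.le] at this
  have hT : Tendsto (fun ξ => Real.arctan (√Q * Real.sinh ξ)) atTop (𝓝 (Real.pi / 2)) :=
    (tendsto_nhds_of_tendsto_nhdsWithin Real.tendsto_arctan_atTop).comp
      (tendsto_sinh_atTop.const_mul_atTop hc)
  have hB : Tendsto (fun ξ => Real.arctan (√Q * Real.sinh ξ)) atBot (𝓝 (-(Real.pi / 2))) :=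
    (tendsto_nhds_of_tendsto_nhdsWithin Real.tendsto_arctan_atBot).comp
      (tendsto_sinh_atBot.const_mul_atBot hc)
  have hnn : ∀ ξ, 0 ≤ Real.cosh ξ / (1 + Q * Real.sinh ξ ^ 2) := fun ξ =>
    div_nonneg (Real.cosh_pos ξ).le (by positivity)
  have hI : Integrable (fun ξ => √Q * (Real.cosh ξ / (1 + Q * Real.sinh ξ ^ 2))) :=
    integrable_deriv_of_nonneg hd (fun ξ => mul_nonneg hc.le (hnn ξ)) hB hT
  refine ⟨?_, ?_⟩
  · have := hI.const_mul (√Q)⁻¹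
    refine this.congr (Eventually.of_forall fun ξ => ?_)
    simp only
    rw [inv_mul_cancel_left₀ hc.ne']
  · have := integral_of_hasDerivAt_of_tendsto hd hI hB hT
    rw [integral_const_mul] at this
    rw [eq_div_iff hc.ne', mul_comm, this]; ring

theorem integrable_cosh_pow_mul_exp {a : ℝ} (ha : 0 < a) (k : ℕ) :
    Integrable (fun ξ : ℝ => Real.cosh ξ ^ k * Real.exp (-(a * Real.cosh ξ))) := by
  have h1 := (integrable_cosh_div_one_add_sq one_pos).1.const_mul
    ((Nat.factorial (k + 1) : ℝ) / a ^ (k + 1))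
  refine h1.mono' (by fun_prop) (Eventually.of_forall fun ξ => ?_)
  have hc : 0 < Real.cosh ξ := Real.cosh_pos ξ
  have h2 : (1 : ℝ) + 1 * Real.sinh ξ ^ 2 = Real.cosh ξ ^ 2 := by
    rw [Real.cosh_sq]; ring
  rw [h2, Real.norm_of_nonneg (by positivity), Real.exp_neg]
  have h3 := Real.pow_div_factorial_le_exp (a * Real.cosh ξ) (by positivity) (k + 1)
  rw [div_le_iff₀ (by positivity)] at h3
  have h4 : Real.cosh ξ / Real.cosh ξ ^ 2 = (Real.cosh ξ)⁻¹ := by field_simp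
  rw [h4, ← div_eq_mul_inv, ← div_eq_mul_inv, div_div, div_le_div_iff₀ (Real.exp_pos _)
    (by positivity)]
  calc Real.cosh ξ ^ k * (a ^ (k + 1) * Real.cosh ξ) = (a * Real.cosh ξ) ^ (k + 1) := by ring
    _ ≤ _ := h3
    _ = _ := by ring

theorem integrable_mul_cexp_neg_cosh {f : ℝ → ℝ} (hf : Continuous f) {K : ℝ} {k : ℕ}
    (hK : ∀ ξ, |f ξ| ≤ K * Real.cosh ξ ^ k) {q : ℂ} (hq : 0 < q.re) :
    Integrable (fun ξ : ℝ => (f ξ : ℂ) * Complex.exp (-(q * Real.cosh ξ))) := by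
  refine ((integrable_cosh_pow_mul_exp hq k).const_mul K).mono'
    (by fun_prop) (Eventually.of_forall fun ξ => ?_)
  rw [norm_mul, Complex.norm_real, Complex.norm_exp, Real.norm_eq_abs, ← mul_assoc]
  have : (-(q * Real.cosh ξ)).re = -(q.re * Real.cosh ξ) := by simp [-Complex.ofReal_cosh]
  rw [this]
  exact mul_le_mul_of_nonneg_right (hK ξ) (Real.exp_pos _).le

/-- Integration by parts against `e^{-q cosh ξ}`. -/
theorem integral_sinh_mul_mul_cexp_neg_cosh {B B' : ℝ → ℝ} (hB : ∀ ξ, HasDerivAt B (B' ξ) ξ)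
    (hB'c : Continuous B') {K : ℝ} {k : ℕ} (hK : ∀ ξ, |B ξ| ≤ K * Real.cosh ξ ^ k)
    (hK' : ∀ ξ, |B' ξ| ≤ K * Real.cosh ξ ^ k) {q : ℂ} (hq : 0 < q.re) :
    ∫ ξ : ℝ, ((Real.sinh ξ * B ξ : ℝ) : ℂ) * Complex.exp (-(q * Real.cosh ξ)) =
      q⁻¹ * ∫ ξ : ℝ, (B' ξ : ℂ) * Complex.exp (-(q * Real.cosh ξ)) := by
  have hq0 : q ≠ 0 := by rintro rfl; simp at hq
  have hBc : Continuous B := continuous_iff_continuousAt.2 fun ξ => (hB ξ).continuousAt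
  have hI1 : Integrable (fun ξ : ℝ => ((Real.sinh ξ * B ξ : ℝ) : ℂ) *
      Complex.exp (-(q * Real.cosh ξ))) := by
    refine integrable_mul_cexp_neg_cosh (K := K) (k := k + 1) (by fun_prop) (fun ξ => ?_) hq
    rw [abs_mul]
    calc |Real.sinh ξ| * |B ξ| ≤ Real.cosh ξ * (K * Real.cosh ξ ^ k) :=
          mul_le_mul (abs_sinh_le_cosh ξ) (hK ξ) (abs_nonneg _) (Real.cosh_pos ξ).le
      _ = _ := by ring
  have hv : ∀ ξ : ℝ, HasDerivAt (fun ξ : ℝ => Complex.exp (-(q * Real.cosh ξ)))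
      (Complex.exp (-(q * Real.cosh ξ)) * (-(q * Real.sinh ξ))) ξ := fun ξ =>
    ((Real.hasDerivAt_cosh ξ).ofReal_comp.const_mul q).neg.cexp
  have := integral_mul_deriv_eq_deriv_mul_of_integrable (u := fun ξ => (B ξ : ℂ))
    (v := fun ξ : ℝ => Complex.exp (-(q * Real.cosh ξ)))
    (u' := fun ξ => (B' ξ : ℂ)) (v' := fun ξ => Complex.exp (-(q * Real.cosh ξ)) *
      (-(q * Real.sinh ξ)))
    (fun ξ _ => (hB ξ).ofReal_comp) (fun ξ _ => hv ξ) ?_ ?_ ?_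
  · rw [eq_inv_mul_iff_mul_eq₀ hq0, ← integral_const_mul, ← neg_inj, ← this, ← integral_neg]
    refine integral_congr_ae (Eventually.of_forall fun ξ => ?_)
    simp only
    push_cast; ring
  · refine (hI1.const_mul (-q)).congr (Eventually.of_forall fun ξ => ?_)
    simp only [Pi.mul_apply]
    push_cast; ring
  · exact integrable_mul_cexp_neg_cosh hB'c hK' hq
  · exact integrable_mul_cexp_neg_cosh hBc hK hq

/-- A van der Corput estimate on the whole line: an amplitude is split as `A + ‖q‖ sinh ξ B`, and the
part with the factor `sinh ξ`, which vanishes at the critical point `ξ = 0` of the phase, is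
integrated by parts. The bound does not degenerate as `q` approaches the imaginary axis. -/
theorem norm_integral_mul_cexp_neg_cosh_le {A B B' : ℝ → ℝ} (hA : Continuous A)
    (hB : ∀ ξ, HasDerivAt B (B' ξ) ξ)
    (hB'c : Continuous B') {K L M : ℝ} {k : ℕ} {q : ℂ} (hq : 0 < q.re)
    (hK : ∀ ξ, |B ξ| ≤ K * Real.cosh ξ ^ k)
    (hAL : ∀ ξ, |A ξ| ≤ L * (Real.cosh ξ / (1 + ‖q‖ * Real.sinh ξ ^ 2)))
    (hBM : ∀ ξ, |B' ξ| ≤ M * (Real.cosh ξ / (1 + ‖q‖ * Real.sinh ξ ^ 2))) :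
    ‖∫ ξ : ℝ, ((A ξ + ‖q‖ * Real.sinh ξ * B ξ : ℝ) : ℂ) * Complex.exp (-(q * Real.cosh ξ))‖ ≤
      (L + M) * (Real.pi / √‖q‖) := by
  have hq0 : 0 < ‖q‖ := norm_pos_iff.2 (by rintro rfl; simp at hq)
  have hBc : Continuous B := continuous_iff_continuousAt.2 fun ξ => (hB ξ).continuousAt
  have hL : 0 ≤ L := by have := (abs_nonneg _).trans (hAL 0); simpa using this
  have hM : 0 ≤ M := by have := (abs_nonneg _).trans (hBM 0); simpa using this
  have hWle : ∀ ξ, Real.cosh ξ / (1 + ‖q‖ * Real.sinh ξ ^ 2) ≤ Real.cosh ξ ^ 1 := fun ξ => by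
    rw [pow_one]
    refine div_le_self (Real.cosh_pos ξ).le ?_
    have : 0 ≤ ‖q‖ * Real.sinh ξ ^ 2 := by positivity
    linarith
  obtain ⟨hWi, hWv⟩ := integrable_cosh_div_one_add_sq hq0
  have hest : ∀ (F : ℝ → ℝ) (N : ℝ), (∀ ξ, |F ξ| ≤ N *
      (Real.cosh ξ / (1 + ‖q‖ * Real.sinh ξ ^ 2))) →
      ‖∫ ξ : ℝ, (F ξ : ℂ) * Complex.exp (-(q * Real.cosh ξ))‖ ≤ N * (Real.pi / √‖q‖) := by
    intro F N hF
    rw [← hWv, ← integral_const_mul]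
    refine norm_integral_le_of_norm_le (hWi.const_mul N) (Eventually.of_forall fun ξ => ?_)
    rw [norm_mul, Complex.norm_real, Complex.norm_exp, Real.norm_eq_abs]
    have h1 : (-(q * Real.cosh ξ)).re = -(q.re * Real.cosh ξ) := by simp [-Complex.ofReal_cosh]
    rw [h1]
    have h2 : Real.exp (-(q.re * Real.cosh ξ)) ≤ 1 :=
      Real.exp_le_one_iff.2 (neg_nonpos.2 (mul_nonneg hq.le (Real.cosh_pos ξ).le))
    calc _ ≤ |F ξ| * 1 := by gcongr
      _ ≤ _ := by rw [mul_one]; exact hF ξ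
  have hIA : Integrable (fun ξ : ℝ => (A ξ : ℂ) * Complex.exp (-(q * Real.cosh ξ))) :=
    integrable_mul_cexp_neg_cosh hA (K := L) (k := 1)
      (fun ξ => (hAL ξ).trans (mul_le_mul_of_nonneg_left (hWle ξ) hL)) hq
  have hIB : Integrable (fun ξ : ℝ => ((Real.sinh ξ * B ξ : ℝ) : ℂ) *
      Complex.exp (-(q * Real.cosh ξ))) := by
    refine integrable_mul_cexp_neg_cosh (K := K) (k := k + 1) (by fun_prop) (fun ξ => ?_) hq
    rw [abs_mul]
    calc |Real.sinh ξ| * |B ξ| ≤ Real.cosh ξ * (K * Real.cosh ξ ^ k) :=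
          mul_le_mul (abs_sinh_le_cosh ξ) (hK ξ) (abs_nonneg _) (Real.cosh_pos ξ).le
      _ = _ := by ring
  have hKp : 0 ≤ K := by have := (abs_nonneg _).trans (hK 0); simpa using this
  have hparts := integral_sinh_mul_mul_cexp_neg_cosh hB hB'c (K := K + M) (k := k + 1)
    (fun ξ => (hK ξ).trans ?_) (fun ξ => (hBM ξ).trans ?_) hq
  · have hsplit : ∫ ξ : ℝ, ((A ξ + ‖q‖ * Real.sinh ξ * B ξ : ℝ) : ℂ) *
        Complex.exp (-(q * Real.cosh ξ)) =
        (∫ ξ : ℝ, (A ξ : ℂ) * Complex.exp (-(q * Real.cosh ξ))) +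
        ‖q‖ * (q⁻¹ * ∫ ξ : ℝ, (B' ξ : ℂ) * Complex.exp (-(q * Real.cosh ξ))) := by
      rw [← hparts, ← integral_const_mul, ← integral_add hIA (hIB.const_mul _)]
      refine integral_congr_ae (Eventually.of_forall fun ξ => ?_)
      simp only
      push_cast; ring
    rw [hsplit, add_mul]
    refine (norm_add_le _ _).trans (add_le_add (hest A L hAL) ?_)
    rw [norm_mul, norm_mul, norm_inv, Complex.norm_real, norm_norm,
      mul_inv_cancel_left₀ hq0.ne']
    exact hest B' M hBM
  · have h1 := Real.one_le_cosh ξ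
    have : Real.cosh ξ ^ k ≤ Real.cosh ξ ^ (k + 1) := pow_le_pow_right₀ h1 (Nat.le_succ k)
    exact mul_le_mul (by linarith) this (by positivity) (by positivity)
  · have h1 := Real.one_le_cosh ξ
    have : Real.cosh ξ ^ 1 ≤ Real.cosh ξ ^ (k + 1) := pow_le_pow_right₀ h1 (by omega)
    exact mul_le_mul (by linarith) ((hWle ξ).trans this)
      (div_nonneg (Real.cosh_pos ξ).le (by positivity)) (by positivity)

/-- The integral `∫ cosh(n ξ) e^{-q cosh ξ} dξ = 2 Kₙ(q)`. -/
noncomputable def macdonald (n : ℕ) (q : ℂ) : ℂ :=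
  ∫ ξ : ℝ, (Real.cosh (n * ξ) : ℂ) * Complex.exp (-(q * Real.cosh ξ))

/-- The amplitude `1` is split with the partition
`1 = (1 + ‖q‖ sinh² ξ) / (1 + ‖q‖ sinh² ξ)`. -/
theorem norm_macdonald_zero_le {q : ℂ} (hq : 0 < q.re) :
    ‖macdonald 0 q‖ ≤ 2 * (Real.pi / √‖q‖) := by
  have hq0 : 0 < ‖q‖ := norm_pos_iff.2 (by rintro rfl; simp at hq)
  have hD : ∀ ξ : ℝ, 0 < 1 + ‖q‖ * Real.sinh ξ ^ 2 := fun ξ => by positivity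
  have := norm_integral_mul_cexp_neg_cosh_le (q := q) (L := 1) (M := 1) (K := 1) (k := 1)
    (A := fun ξ => 1 / (1 + ‖q‖ * Real.sinh ξ ^ 2))
    (B := fun ξ => Real.sinh ξ / (1 + ‖q‖ * Real.sinh ξ ^ 2))
    (B' := fun ξ => Real.cosh ξ * (1 - ‖q‖ * Real.sinh ξ ^ 2) / (1 + ‖q‖ * Real.sinh ξ ^ 2) ^ 2)
    (by
      refine Continuous.div (by fun_prop) (by fun_prop) fun ξ => (hD ξ).ne') ?_
    (by
      refine Continuous.div (by fun_prop) (by fun_prop) fun ξ => (pow_pos (hD ξ) 2).ne')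
    hq ?_ ?_ ?_
  · convert this using 2
    · rw [macdonald]
      refine integral_congr_ae (Eventually.of_forall fun ξ => ?_)
      simp only
      congr 2
      have := (hD ξ).ne'
      simp only [CharP.cast_eq_zero, zero_mul, Real.cosh_zero]
      field_simp
    · norm_num
  · intro ξ
    have h1 := (Real.hasDerivAt_sinh ξ).div
      ((((Real.hasDerivAt_sinh ξ).pow 2).const_mul ‖q‖).const_add 1) (hD ξ).ne'
    refine h1.congr_deriv ?_
    congr 1
    simp; ring
  · intro ξ
    rw [abs_div, abs_of_pos (hD ξ), one_mul, pow_one]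
    refine (div_le_self (abs_nonneg _) ?_).trans ?_
    · have : 0 ≤ ‖q‖ * Real.sinh ξ ^ 2 := by positivity
      linarith
    · exact abs_sinh_le_cosh ξ
  · intro ξ
    rw [abs_div, abs_of_pos (hD ξ), one_mul, abs_one]
    gcongr
    exact Real.one_le_cosh ξ
  · intro ξ
    have hx : 0 ≤ ‖q‖ * Real.sinh ξ ^ 2 := by positivity
    rw [abs_div, abs_mul, abs_of_pos (Real.cosh_pos _), abs_of_pos (pow_pos (hD ξ) 2), one_mul,
      div_le_div_iff₀ (pow_pos (hD ξ) 2) (hD ξ)]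
    have h2 : |1 - ‖q‖ * Real.sinh ξ ^ 2| ≤ 1 + ‖q‖ * Real.sinh ξ ^ 2 := by
      rw [abs_le]; constructor <;> linarith
    have hc := Real.cosh_pos ξ
    have hD' := (hD ξ).le
    calc _ ≤ Real.cosh ξ * (1 + ‖q‖ * Real.sinh ξ ^ 2) * (1 + ‖q‖ * Real.sinh ξ ^ 2) := by
          gcongr
      _ = _ := by ring

theorem norm_macdonald_one_le {q : ℂ} (hq : 0 < q.re) :
    ‖macdonald 1 q‖ ≤ (2 + 2 / ‖q‖) * (Real.pi / √‖q‖) := by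
  have hq0 : 0 < ‖q‖ := norm_pos_iff.2 (by rintro rfl; simp at hq)
  have hD : ∀ ξ : ℝ, 0 < 1 + ‖q‖ * Real.sinh ξ ^ 2 := fun ξ => by positivity
  have := norm_integral_mul_cexp_neg_cosh_le (q := q) (L := 1) (M := 1 + 2 / ‖q‖) (K := 1) (k := 2)
    (A := fun ξ => Real.cosh ξ / (1 + ‖q‖ * Real.sinh ξ ^ 2))
    (B := fun ξ => Real.sinh ξ * Real.cosh ξ / (1 + ‖q‖ * Real.sinh ξ ^ 2))
    (B' := fun ξ => (1 + 2 * Real.sinh ξ ^ 2 - ‖q‖ * Real.sinh ξ ^ 2) /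
      (1 + ‖q‖ * Real.sinh ξ ^ 2) ^ 2)
    (by
      refine Continuous.div (by fun_prop) (by fun_prop) fun ξ => (hD ξ).ne') ?_
    (by
      refine Continuous.div (by fun_prop) (by fun_prop) fun ξ => (pow_pos (hD ξ) 2).ne')
    hq ?_ ?_ ?_
  · convert this using 2
    · rw [macdonald]
      refine integral_congr_ae (Eventually.of_forall fun ξ => ?_)
      simp only
      congr 2
      have := (hD ξ).ne'
      simp only [Nat.cast_one, one_mul]
      field_simp
    · ring
  · intro ξ
    have h1 := ((Real.hasDerivAt_sinh ξ).mul (Real.hasDerivAt_cosh ξ)).div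
      ((((Real.hasDerivAt_sinh ξ).pow 2).const_mul ‖q‖).const_add 1) (hD ξ).ne'
    refine h1.congr_deriv ?_
    congr 1
    have := Real.cosh_sq ξ
    simp only [Pi.mul_apply, Pi.pow_apply]
    push_cast
    linear_combination (1 + ‖q‖ * Real.sinh ξ ^ 2 - 2 * ‖q‖ * Real.sinh ξ ^ 2) * this
  · intro ξ
    rw [abs_div, abs_of_pos (hD ξ), one_mul]
    refine (div_le_self (abs_nonneg _) ?_).trans ?_
    · have : 0 ≤ ‖q‖ * Real.sinh ξ ^ 2 := by positivity
      linarith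
    · rw [abs_mul, abs_of_pos (Real.cosh_pos _), pow_two]
      refine mul_le_mul_of_nonneg_right ?_ (Real.cosh_pos ξ).le
      exact abs_sinh_le_cosh ξ
  · intro ξ
    rw [abs_div, abs_of_pos (hD ξ), one_mul, abs_of_pos (Real.cosh_pos _)]
  · intro ξ
    have hx : 0 ≤ ‖q‖ * Real.sinh ξ ^ 2 := by positivity
    have hs : 0 ≤ Real.sinh ξ ^ 2 := by positivity
    have hc := Real.one_le_cosh ξ
    have h2 : |1 + 2 * Real.sinh ξ ^ 2 - ‖q‖ * Real.sinh ξ ^ 2| ≤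
        (1 + 2 / ‖q‖) * (1 + ‖q‖ * Real.sinh ξ ^ 2) := by
      have h3 : (1 + 2 / ‖q‖) * (1 + ‖q‖ * Real.sinh ξ ^ 2) =
        1 + ‖q‖ * Real.sinh ξ ^ 2 + 2 / ‖q‖ + 2 * Real.sinh ξ ^ 2 := by field_simp; ring
      have h4 : 0 < 2 / ‖q‖ := by positivity
      rw [h3, abs_le]; constructor <;> linarith
    rw [abs_div, abs_of_pos (pow_pos (hD ξ) 2), ← mul_div_assoc,
      div_le_div_iff₀ (pow_pos (hD ξ) 2) (hD ξ)]
    calc _ ≤ ((1 + 2 / ‖q‖) * (1 + ‖q‖ * Real.sinh ξ ^ 2)) * (1 + ‖q‖ * Real.sinh ξ ^ 2) := by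
          have := (hD ξ).le
          gcongr
      _ = ((1 + 2 / ‖q‖) * 1) * (1 + ‖q‖ * Real.sinh ξ ^ 2) ^ 2 := by ring
      _ ≤ _ := by gcongr

/-- The recurrence `K₂ = K₀ + 2 K₁ / q`. -/
theorem macdonald_two_eq {q : ℂ} (hq : 0 < q.re) :
    macdonald 2 q = macdonald 0 q + 2 * (q⁻¹ * macdonald 1 q) := by
  have hp := integral_sinh_mul_mul_cexp_neg_cosh (B := Real.sinh) (B' := Real.cosh)
    Real.hasDerivAt_sinh Real.continuous_cosh (K := 1) (k := 1)
    (fun ξ => by rw [one_mul, pow_one]; exact abs_sinh_le_cosh ξ)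
    (fun ξ => by rw [abs_of_pos (Real.cosh_pos _), one_mul, pow_one]) hq
  have h1 : macdonald 1 q = ∫ ξ : ℝ, (Real.cosh ξ : ℂ) * Complex.exp (-(q * Real.cosh ξ)) := by
    simp [macdonald]
  have h0 : Integrable (fun ξ : ℝ => ((Real.cosh ((0 : ℕ) * ξ) : ℝ) : ℂ) *
      Complex.exp (-(q * Real.cosh ξ))) :=
    integrable_mul_cexp_neg_cosh (by fun_prop) (K := 1) (k := 0) (fun ξ => by simp) hq
  have h2 : Integrable (fun ξ : ℝ => ((Real.sinh ξ * Real.sinh ξ : ℝ) : ℂ) *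
      Complex.exp (-(q * Real.cosh ξ))) :=
    integrable_mul_cexp_neg_cosh (by fun_prop) (K := 1) (k := 2) (fun ξ => by
      have := Real.cosh_sq ξ
      rw [abs_of_nonneg (mul_self_nonneg _)]; nlinarith) hq
  rw [h1, ← hp, macdonald, macdonald, ← integral_const_mul, ← integral_add h0 (h2.const_mul 2)]
  refine integral_congr_ae (Eventually.of_forall fun ξ => ?_)
  have h3 : Real.cosh (2 * ξ) = 1 + 2 * (Real.sinh ξ * Real.sinh ξ) := by
    rw [Real.cosh_two_mul, Real.cosh_sq]; ring
  simp only [Nat.cast_ofNat, h3, CharP.cast_eq_zero, zero_mul, Real.cosh_zero]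
  push_cast; ring

theorem norm_macdonald_two_le {q : ℂ} (hq : 0 < q.re) :
    ‖macdonald 2 q‖ ≤ (2 + 2 / ‖q‖ * (2 + 2 / ‖q‖)) * (Real.pi / √‖q‖) := by
  rw [macdonald_two_eq hq, add_mul]
  refine (norm_add_le _ _).trans (add_le_add (norm_macdonald_zero_le hq) ?_)
  rw [norm_mul, norm_mul, norm_inv, Complex.norm_ofNat, ← mul_assoc, mul_assoc (2 / ‖q‖),
    ← div_eq_mul_inv]
  exact mul_le_mul_of_nonneg_left (norm_macdonald_one_le hq) (by positivity)

theorem cosh_nat_mul_le (n : ℕ) (ξ : ℝ) : Real.cosh (n * ξ) ≤ 2 ^ n * Real.cosh ξ ^ n := by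
  have h : ∀ x : ℝ, Real.exp x ≤ 2 * Real.cosh x := fun x => by
    rw [Real.cosh_eq]; have := Real.exp_pos (-x); linarith
  have h1 : Real.exp (n * ξ) ≤ (2 * Real.cosh ξ) ^ n := by
    rw [Real.exp_nat_mul]; exact pow_le_pow_left₀ (Real.exp_pos _).le (h ξ) n
  have h2 : Real.exp (-(n * ξ)) ≤ (2 * Real.cosh ξ) ^ n := by
    rw [← mul_neg, Real.exp_nat_mul, ← Real.cosh_neg]
    exact pow_le_pow_left₀ (Real.exp_pos _).le (h _) n
  rw [Real.cosh_eq, ← mul_pow]; linarith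

theorem differentiableOn_macdonald (n : ℕ) :
    DifferentiableOn ℂ (macdonald n) {q : ℂ | 0 < q.re} := by
  refine differentiableOn_integral_mul_cexp_neg (φ := Real.cosh)
    (g := fun ξ => (Real.cosh (n * ξ) : ℂ)) (fun ξ => (Real.cosh_pos ξ).le)
    (by fun_prop) (by fun_prop) fun a ha => ?_
  refine ((integrable_cosh_pow_mul_exp ha n).const_mul (2 ^ n)).mono' (by fun_prop)
    (Eventually.of_forall fun ξ => ?_)
  rw [Complex.norm_real, norm_mul, norm_norm, Real.norm_eq_abs, abs_of_pos (Real.cosh_pos _),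
    Real.norm_of_nonneg (Real.exp_pos _).le, ← mul_assoc]
  exact mul_le_mul_of_nonneg_right (cosh_nat_mul_le n ξ) (Real.exp_pos _).le

/-! ### Subordination to the heat semigroup -/

/-- The Macdonald integral of order `1/2` is elementary: the odd part of `e^{ξ/2}` drops out, and
`y = sinh(ξ/2)` turns the even part into a Gaussian integral. -/
theorem integral_exp_half_mul_exp_neg_cosh {A : ℝ} (hA : 0 < A) :
    Integrable (fun ξ : ℝ => Real.exp (ξ / 2) * Real.exp (-(A * Real.cosh ξ))) ∧
    ∫ ξ : ℝ, Real.exp (ξ / 2) * Real.exp (-(A * Real.cosh ξ)) =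
      √(2 * Real.pi / A) * Real.exp (-A) := by
  have hI : ∀ s : ℝ, |s| ≤ 1 → Integrable
      (fun ξ : ℝ => Real.exp (s * ξ) * Real.exp (-(A * Real.cosh ξ))) := by
    intro s hs
    refine ((integrable_cosh_pow_mul_exp hA 1).const_mul 2).mono' (by fun_prop)
      (Eventually.of_forall fun ξ => ?_)
    rw [Real.norm_of_nonneg (by positivity), ← mul_assoc]
    refine mul_le_mul_of_nonneg_right ?_ (Real.exp_pos _).le
    have h1 : s * ξ ≤ |ξ| := by
      calc s * ξ ≤ |s * ξ| := le_abs_self _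
        _ = |s| * |ξ| := abs_mul _ _
        _ ≤ 1 * |ξ| := by gcongr
        _ = _ := one_mul _
    have h2 : Real.exp |ξ| ≤ 2 * Real.cosh ξ := by
      rw [← Real.cosh_abs, Real.cosh_eq]; have := Real.exp_pos (-|ξ|); linarith
    rw [pow_one]
    exact (Real.exp_le_exp.2 h1).trans h2
  have hI1 := hI (1 / 2) (by norm_num [abs_le])
  have hI2 := hI (-1 / 2) (by norm_num [abs_le])
  have e1 : ∀ ξ : ℝ, 1 / 2 * ξ = ξ / 2 := fun ξ => by ring
  have e2 : ∀ ξ : ℝ, -1 / 2 * ξ = -(ξ / 2) := fun ξ => by ring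
  simp only [e1] at hI1
  simp only [e2] at hI2
  refine ⟨hI1, ?_⟩
  -- the reflection `ξ ↦ -ξ` replaces `e^{ξ/2}` by `cosh(ξ/2)`
  have hsymm : ∫ ξ : ℝ, Real.exp (-(ξ / 2)) * Real.exp (-(A * Real.cosh ξ)) =
      ∫ ξ : ℝ, Real.exp (ξ / 2) * Real.exp (-(A * Real.cosh ξ)) := by
    rw [← integral_neg_eq_self]
    refine integral_congr_ae (Eventually.of_forall fun ξ => ?_)
    simp only [Real.cosh_neg, neg_div, neg_neg]
  have hsum : ∫ ξ : ℝ, Real.exp (ξ / 2) * Real.exp (-(A * Real.cosh ξ)) =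
      ∫ ξ : ℝ, Real.cosh (ξ / 2) * Real.exp (-(A * Real.cosh ξ)) := by
    have h := integral_add hI1 hI2
    rw [hsymm] at h
    have h' : ∫ ξ : ℝ, Real.exp (ξ / 2) * Real.exp (-(A * Real.cosh ξ)) +
        Real.exp (-(ξ / 2)) * Real.exp (-(A * Real.cosh ξ)) =
        2 * ∫ ξ : ℝ, Real.cosh (ξ / 2) * Real.exp (-(A * Real.cosh ξ)) := by
      rw [← integral_const_mul]
      refine integral_congr_ae (Eventually.of_forall fun ξ => ?_)
      simp only [Real.cosh_eq (ξ / 2)]; ring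
    linarith
  -- the substitution `y = sinh (ξ / 2)`, with `cosh ξ = 1 + 2 y²`
  have hd : ∀ ξ ∈ Set.univ, HasDerivWithinAt (fun ξ : ℝ => Real.sinh (ξ / 2))
      (Real.cosh (ξ / 2) * (1 / 2)) Set.univ ξ := fun ξ _ => by
    have := ((hasDerivAt_id ξ).div_const 2).sinh
    exact this.hasDerivWithinAt
  have hinj : Set.InjOn (fun ξ : ℝ => Real.sinh (ξ / 2)) Set.univ := fun x _ y _ h => by
    have := Real.sinh_injective h; linarith
  have himg : (fun ξ : ℝ => Real.sinh (ξ / 2)) '' Set.univ = Set.univ := by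
    rw [Set.image_univ, Set.range_eq_univ]
    intro y
    obtain ⟨x, hx⟩ := Real.sinh_surjective y
    exact ⟨2 * x, by simpa using hx⟩
  have hcv := integral_image_eq_integral_abs_deriv_smul MeasurableSet.univ hd hinj
    (fun y : ℝ => Real.exp (-A) * Real.exp (-(2 * A) * y ^ 2))
  rw [himg] at hcv
  simp only [Measure.restrict_univ] at hcv
  rw [integral_const_mul, integral_gaussian] at hcv
  rw [hsum]
  have h2 : ∫ ξ : ℝ, Real.cosh (ξ / 2) * Real.exp (-(A * Real.cosh ξ)) =
      2 * (Real.exp (-A) * √(Real.pi / (2 * A))) := by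
    rw [hcv, ← integral_const_mul]
    refine integral_congr_ae (Eventually.of_forall fun ξ => ?_)
    have h3 : Real.cosh ξ = 1 + 2 * Real.sinh (ξ / 2) ^ 2 := by
      conv_lhs => rw [show ξ = 2 * (ξ / 2) by ring]
      rw [Real.cosh_two_mul, Real.cosh_sq]; ring
    simp only [smul_eq_mul]
    rw [abs_of_pos (by have := Real.cosh_pos (ξ / 2); positivity), ← Real.exp_add, h3]
    ring_nf
  rw [h2]
  have h4 : √(2 * Real.pi / A) = 2 * √(Real.pi / (2 * A)) := by
    rw [show 2 * Real.pi / A = 2 ^ 2 * (Real.pi / (2 * A)) by field_simp,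
      Real.sqrt_mul (by norm_num), Real.sqrt_sq (by norm_num)]
  rw [h4]; ring

/-- Translating `ξ` by `log √(b / a)` balances the two exponentials. -/
theorem mul_exp_add_mul_exp_neg_shift {a b : ℝ} (ha : 0 < a) (hb : 0 < b) (η : ℝ) :
    a * Real.exp (η + Real.log √(b / a)) + b * Real.exp (-(η + Real.log √(b / a))) =
      2 * √(a * b) * Real.cosh η := by
  have h : 0 < √(b / a) := Real.sqrt_pos.2 (by positivity)
  have h1 : a * √(b / a) = √(a * b) := by
    rw [← Real.sqrt_sq ha.le, ← Real.sqrt_mul (by positivity), Real.sqrt_sq ha.le]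
    congr 1; field_simp
  have h2 : b * (√(b / a))⁻¹ = √(a * b) := by
    rw [← Real.sqrt_inv, ← Real.sqrt_sq hb.le, ← Real.sqrt_mul (by positivity), Real.sqrt_sq hb.le]
    congr 1; field_simp
  rw [neg_add, Real.exp_add, Real.exp_add, Real.exp_neg (Real.log _), Real.exp_log h,
    Real.cosh_eq]
  linear_combination Real.exp η * h1 + Real.exp (-η) * h2

theorem integral_exp_mul_exp_neg_shift {a b : ℝ} (ha : 0 < a) (hb : 0 < b) (r : ℝ) :
    ∫ ξ : ℝ, Real.exp (r * ξ) * Real.exp (-(a * Real.exp ξ + b * Real.exp (-ξ))) =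
      √(b / a) ^ r *
        ∫ η : ℝ, Real.exp (r * η) * Real.exp (-(2 * √(a * b) * Real.cosh η)) := by
  have h : 0 < √(b / a) := Real.sqrt_pos.2 (by positivity)
  rw [← integral_add_right_eq_self _ (Real.log √(b / a)), ← integral_const_mul]
  refine integral_congr_ae (Eventually.of_forall fun η => ?_)
  simp only
  rw [mul_exp_add_mul_exp_neg_shift ha hb, mul_add, Real.exp_add, Real.rpow_def_of_pos h,
    mul_comm r (Real.log _)]
  ring

theorem integrable_exp_mul_exp_neg_shift {a b : ℝ} (ha : 0 < a) (hb : 0 < b) (r : ℝ)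
    (h : Integrable fun η : ℝ => Real.exp (r * η) * Real.exp (-(2 * √(a * b) * Real.cosh η))) :
    Integrable fun ξ : ℝ => Real.exp (r * ξ) *
      Real.exp (-(a * Real.exp ξ + b * Real.exp (-ξ))) := by
  have h1 := (h.const_mul (√(b / a) ^ r)).comp_add_right (-Real.log √(b / a))
  have hpos : 0 < √(b / a) := Real.sqrt_pos.2 (by positivity)
  refine h1.congr (Eventually.of_forall fun ξ => ?_)
  simp only
  rw [← mul_exp_add_mul_exp_neg_shift ha hb, neg_add_cancel_right, ← mul_assoc,
    Real.rpow_def_of_pos hpos, ← Real.exp_add]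
  ring_nf

/-- Subordination of `e^{-τω} / ω` to the heat semigroup `e^{-sω²}`, where `s = e^ξ`. -/
theorem integral_exp_half_mul_exp_heat {ω τ : ℝ} (hω : 0 < ω) (hτ : 0 < τ) :
    Integrable (fun ξ : ℝ => Real.exp (1 / 2 * ξ) *
      Real.exp (-(ω ^ 2 * Real.exp ξ + τ ^ 2 / 4 * Real.exp (-ξ)))) ∧
    ∫ ξ : ℝ, Real.exp (1 / 2 * ξ) *
      Real.exp (-(ω ^ 2 * Real.exp ξ + τ ^ 2 / 4 * Real.exp (-ξ))) =
      √Real.pi * (Real.exp (-(τ * ω)) / ω) := by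
  have ha : 0 < ω ^ 2 := by positivity
  have hb : 0 < τ ^ 2 / 4 := by positivity
  have h1 : 2 * √(ω ^ 2 * (τ ^ 2 / 4)) = τ * ω := by
    rw [show ω ^ 2 * (τ ^ 2 / 4) = (τ * ω / 2) ^ 2 by ring, Real.sqrt_sq (by positivity)]; ring
  obtain ⟨hI, hV⟩ := integral_exp_half_mul_exp_neg_cosh (A := τ * ω) (by positivity)
  have e : ∀ ξ : ℝ, Real.exp (ξ / 2) = Real.exp (1 / 2 * ξ) := fun ξ => by ring_nf
  simp only [e] at hI hV
  refine ⟨integrable_exp_mul_exp_neg_shift ha hb _ (by rwa [h1]), ?_⟩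
  rw [integral_exp_mul_exp_neg_shift ha hb, h1, hV, ← Real.sqrt_eq_rpow,
    show τ ^ 2 / 4 / ω ^ 2 = (τ / (2 * ω)) ^ 2 by field_simp; norm_num,
    Real.sqrt_sq (by positivity), ← mul_assoc, ← Real.sqrt_mul (by positivity),
    show τ / (2 * ω) * (2 * Real.pi / (τ * ω)) = Real.pi / ω ^ 2 by field_simp,
    Real.sqrt_div' _ (by positivity), Real.sqrt_sq hω.le]
  ring

/-- Subordination of `e^{-τω}` to the heat semigroup `e^{-sω²}`, where `s = e^ξ`. -/
theorem integral_exp_neg_half_mul_exp_heat {ω τ : ℝ} (hω : 0 < ω) (hτ : 0 < τ) :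
    Integrable (fun ξ : ℝ => Real.exp (-1 / 2 * ξ) *
      Real.exp (-(ω ^ 2 * Real.exp ξ + τ ^ 2 / 4 * Real.exp (-ξ)))) ∧
    ∫ ξ : ℝ, Real.exp (-1 / 2 * ξ) *
      Real.exp (-(ω ^ 2 * Real.exp ξ + τ ^ 2 / 4 * Real.exp (-ξ))) =
      2 * √Real.pi / τ * Real.exp (-(τ * ω)) := by
  -- the reflection `ξ ↦ -ξ` exchanges `ω` and `τ / 2`
  obtain ⟨hI, hV⟩ := integral_exp_half_mul_exp_heat (ω := τ / 2) (τ := 2 * ω)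
    (by positivity) (by positivity)
  have e : ∀ ξ : ℝ, Real.exp (1 / 2 * -ξ) *
      Real.exp (-((τ / 2) ^ 2 * Real.exp (-ξ) + (2 * ω) ^ 2 / 4 * Real.exp (- -ξ))) =
      Real.exp (-1 / 2 * ξ) * Real.exp (-(ω ^ 2 * Real.exp ξ + τ ^ 2 / 4 * Real.exp (-ξ))) := by
    intro ξ
    rw [neg_neg]; ring_nf
  refine ⟨hI.comp_neg.congr (Eventually.of_forall e), ?_⟩
  rw [← integral_neg_eq_self] at hV
  simp only [e] at hV
  rw [hV]
  field_simp

/-- The massive heat integrals are Macdonald functions. -/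
theorem integral_exp_neg_nat_mul_exp_heat {μ w : ℝ} (hμ : 0 < μ) (hw : 0 < w) (n : ℕ) :
    ((∫ ξ : ℝ, Real.exp (-n * ξ) *
      Real.exp (-(μ ^ 2 * Real.exp ξ + w / 4 * Real.exp (-ξ))) : ℝ) : ℂ) =
      (2 * μ / √w : ℝ) ^ n * macdonald n ((μ * √w : ℝ) : ℂ) := by
  have ha : 0 < μ ^ 2 := by positivity
  have hb : 0 < w / 4 := by positivity
  have hsw : 0 < √w := Real.sqrt_pos.2 hw
  have h1 : 2 * √(μ ^ 2 * (w / 4)) = μ * √w := by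
    rw [show μ ^ 2 * (w / 4) = (μ / 2) ^ 2 * w by ring, Real.sqrt_mul (by positivity),
      Real.sqrt_sq (by positivity)]; ring
  have h2 : √(w / 4 / μ ^ 2) ^ (-n : ℝ) = (2 * μ / √w) ^ n := by
    rw [show w / 4 / μ ^ 2 = (√w / (2 * μ)) ^ 2 by
      rw [div_pow, Real.sq_sqrt hw.le]; field_simp; norm_num,
      Real.sqrt_sq (by positivity), Real.rpow_neg (by positivity), Real.rpow_natCast,
      ← inv_pow, inv_div]
  have hI : ∀ s : ℝ, |s| = 1 → Integrable (fun ξ : ℝ => Real.exp (s * (n * ξ)) *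
      Real.exp (-(μ * √w * Real.cosh ξ))) := by
    intro s hs
    refine ((integrable_cosh_pow_mul_exp (a := μ * √w) (by positivity) n).const_mul
      (2 * 2 ^ n)).mono' (by fun_prop) (Eventually.of_forall fun ξ => ?_)
    rw [Real.norm_of_nonneg (by positivity), ← mul_assoc (2 * 2 ^ n : ℝ), mul_assoc 2]
    refine mul_le_mul_of_nonneg_right ?_ (Real.exp_pos _).le
    refine le_trans ?_ (mul_le_mul_of_nonneg_left (cosh_nat_mul_le n ξ) zero_le_two)
    have : Real.cosh (n * ξ) = Real.cosh (s * (n * ξ)) := by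
      rw [← Real.cosh_abs, ← Real.cosh_abs (s * _), abs_mul s, hs, one_mul]
    rw [this, Real.cosh_eq]
    have := Real.exp_pos (-(s * (n * ξ))); linarith
  have hI1 := hI 1 (by simp)
  have hI2 := hI (-1) (by simp)
  simp only [one_mul] at hI1
  simp only [neg_mul, one_mul] at hI2
  have hsymm : ∫ ξ : ℝ, Real.exp (n * ξ) * Real.exp (-(μ * √w * Real.cosh ξ)) =
      ∫ ξ : ℝ, Real.exp (-(n * ξ)) * Real.exp (-(μ * √w * Real.cosh ξ)) := by
    rw [← integral_neg_eq_self]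
    refine integral_congr_ae (Eventually.of_forall fun ξ => ?_)
    simp only [Real.cosh_neg, mul_neg]
  have h3 : ∫ ξ : ℝ, Real.exp (-(n * ξ)) * Real.exp (-(μ * √w * Real.cosh ξ)) =
      ∫ ξ : ℝ, Real.cosh (n * ξ) * Real.exp (-(μ * √w * Real.cosh ξ)) := by
    have h := integral_add hI1 hI2
    rw [hsymm] at h
    have h' : ∫ ξ : ℝ, Real.exp (n * ξ) * Real.exp (-(μ * √w * Real.cosh ξ)) +
        Real.exp (-(n * ξ)) * Real.exp (-(μ * √w * Real.cosh ξ)) =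
        2 * ∫ ξ : ℝ, Real.cosh (n * ξ) * Real.exp (-(μ * √w * Real.cosh ξ)) := by
      rw [← integral_const_mul]
      refine integral_congr_ae (Eventually.of_forall fun ξ => ?_)
      simp only [Real.cosh_eq (n * ξ)]; ring
    linarith
  rw [integral_exp_mul_exp_neg_shift ha hb, h1, h2]
  simp only [neg_mul]
  rw [h3]
  push_cast
  congr 1
  rw [macdonald, ← integral_complex_ofReal]
  refine integral_congr_ae (Eventually.of_forall fun ξ => ?_)
  simp only
  push_cast
  rfl

/-- The massless heat integral of order `2`; the integrand has the elementary primitive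
`b⁻² (b e^{-ξ} + 1) e^{-b e^{-ξ}}`. -/
theorem integral_exp_neg_two_mul_exp_heat_massless {b : ℝ} (hb : 0 < b) :
    ∫ ξ : ℝ, Real.exp (-2 * ξ) * Real.exp (-(b * Real.exp (-ξ))) = 1 / b ^ 2 := by
  have hd : ∀ ξ : ℝ, HasDerivAt (fun ξ : ℝ => (b * Real.exp (-ξ) + 1) / b ^ 2 *
      Real.exp (-(b * Real.exp (-ξ))))
      (Real.exp (-2 * ξ) * Real.exp (-(b * Real.exp (-ξ)))) ξ := by
    intro ξ
    have h1 : HasDerivAt (fun ξ : ℝ => b * Real.exp (-ξ)) (b * (Real.exp (-ξ) * (-1))) ξ :=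
      ((hasDerivAt_id ξ).neg.exp).const_mul b
    have h2 := ((h1.add_const 1).div_const (b ^ 2)).mul h1.neg.exp
    refine h2.congr_deriv ?_
    rw [show -2 * ξ = -ξ + -ξ by ring, Real.exp_add]
    field_simp
    simp only [Pi.neg_apply]
    ring
  have hu : Tendsto (fun ξ : ℝ => b * Real.exp (-ξ)) atTop (𝓝 0) := by
    simpa using (Real.tendsto_exp_neg_atTop_nhds_zero).const_mul b
  have hT : Tendsto (fun ξ : ℝ => (b * Real.exp (-ξ) + 1) / b ^ 2 *
      Real.exp (-(b * Real.exp (-ξ)))) atTop (𝓝 (1 / b ^ 2)) := by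
    have : Tendsto (fun u : ℝ => (u + 1) / b ^ 2 * Real.exp (-u)) (𝓝 0)
        (𝓝 ((0 + 1) / b ^ 2 * Real.exp (-0))) := by
      have hc : Continuous (fun u : ℝ => (u + 1) / b ^ 2 * Real.exp (-u)) := by fun_prop
      exact hc.tendsto 0
    simpa [Function.comp_def] using this.comp hu
  have hv : Tendsto (fun ξ : ℝ => b * Real.exp (-ξ)) atBot atTop :=
    (Real.tendsto_exp_atTop.comp tendsto_neg_atBot_atTop).const_mul_atTop hb
  have hB : Tendsto (fun ξ : ℝ => (b * Real.exp (-ξ) + 1) / b ^ 2 *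
      Real.exp (-(b * Real.exp (-ξ)))) atBot (𝓝 0) := by
    have h0 := Real.tendsto_pow_mul_exp_neg_atTop_nhds_zero 0
    have h1 := Real.tendsto_pow_mul_exp_neg_atTop_nhds_zero 1
    have h2 := ((h1.add h0).div_const (b ^ 2)).comp hv
    simp only [add_zero, zero_div] at h2
    refine h2.congr fun ξ => ?_
    simp only [Function.comp_apply, pow_one, pow_zero]
    ring
  have hI : Integrable (fun ξ : ℝ => Real.exp (-2 * ξ) * Real.exp (-(b * Real.exp (-ξ)))) :=
    integrable_deriv_of_nonneg hd (fun ξ => by positivity) hB hT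
  rw [integral_of_hasDerivAt_of_tendsto hd hI hB hT, sub_zero]

/-! ### Analytic continuation of the heat integrals -/

/-- The identity theorem in the right half plane. -/
theorem eqOn_re_pos_of_eq_ofReal {f g : ℂ → ℂ} (hf : DifferentiableOn ℂ f {τ : ℂ | 0 < τ.re})
    (hg : DifferentiableOn ℂ g {τ : ℂ | 0 < τ.re}) (h : ∀ τ : ℝ, 0 < τ → f τ = g τ) :
    Set.EqOn f g {τ : ℂ | 0 < τ.re} := by
  have hU : IsOpen {τ : ℂ | 0 < τ.re} := isOpen_lt continuous_const Complex.continuous_re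
  have hc : IsPreconnected {τ : ℂ | 0 < τ.re} := (convex_halfSpace_re_gt 0).isPreconnected
  refine (hf.analyticOnNhd hU).eqOn_of_preconnected_of_frequently_eq (hg.analyticOnNhd hU) hc
    (z₀ := 1) (by simp) ?_
  have hT : Tendsto (fun x : ℝ => (x : ℂ)) (𝓝[≠] 1) (𝓝[≠] 1) := by
    refine tendsto_nhdsWithin_iff.2 ⟨?_, ?_⟩
    · have := (Complex.continuous_ofReal.tendsto 1).mono_left
        (nhdsWithin_le_nhds (s := ({1}ᶜ : Set ℝ)))
      simpa using this
    · filter_upwards [self_mem_nhdsWithin] with x hx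
      simpa using hx
  refine hT.frequently (Eventually.frequently ?_)
  filter_upwards [nhdsWithin_le_nhds (lt_mem_nhds one_pos)] with x hx using h x hx

/-- For `τ` in the right half plane `τ² + |z|²` avoids the cut of the principal square root. -/
theorem sq_add_ofReal_mem_slitPlane {τ : ℂ} (hτ : 0 < τ.re) {y : ℝ} (hy : 0 ≤ y) :
    τ ^ 2 + y ∈ Complex.slitPlane := by
  rw [Complex.mem_slitPlane_iff]
  have hre : (τ ^ 2 + y).re = τ.re ^ 2 - τ.im ^ 2 + y := by simp [pow_two]
  have him : (τ ^ 2 + y).im = 2 * (τ.re * τ.im) := by simp [pow_two]; ring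
  rcases eq_or_ne τ.im 0 with h | h
  · left; rw [hre, h]; have := pow_pos hτ 2; linarith
  · right; rw [him]; exact mul_ne_zero two_ne_zero (mul_ne_zero hτ.ne' h)

theorem re_cpow_half_pos {w : ℂ} (hw : w ∈ Complex.slitPlane) : 0 < (w ^ (1 / 2 : ℂ)).re := by
  have hw0 : w ≠ 0 := Complex.slitPlane_ne_zero hw
  rw [Complex.cpow_def_of_ne_zero hw0, Complex.exp_re]
  have him : (Complex.log w * (1 / 2)).im = w.arg / 2 := by
    rw [show Complex.log w * (1 / 2) = Complex.log w / (2 : ℝ) by push_cast; ring,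
      Complex.div_ofReal_im, Complex.log_im]
  rw [him]
  refine mul_pos (Real.exp_pos _) (Real.cos_pos_of_mem_Ioo ⟨?_, ?_⟩)
  · have := Complex.neg_pi_lt_arg w; linarith
  · have := lt_of_le_of_ne (Complex.arg_le_pi w) (Complex.slitPlane_arg_ne_pi hw); linarith

/-- The heat integral `∫ s^{-n} e^{-m² s - w/(4s)} ds/s`, in the variable `ξ = log s`. -/
noncomputable def heatIntegral (m : ℝ) (n : ℕ) (w : ℝ) : ℝ :=
  ∫ ξ : ℝ, Real.exp (-n * ξ) * Real.exp (-(m ^ 2 * Real.exp ξ + w / 4 * Real.exp (-ξ)))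

/-- The heat integral continues analytically to the slit plane, as
`(2|m| / √w)ⁿ · 2 Kₙ(|m| √w)` if `m ≠ 0` and as `16 / w²` if `m = 0` and `n = 2`; the continuation is
`O(|w|^{-n/2 - 1/4})` away from `0`. The case `m = 0`, `n = 1` is not needed, since
the kernel of `ω⁻¹ sin(tω)` with this integral enters the propagator with the factor `m`. -/
theorem exists_heatIntegral_continuation {m : ℝ} {n : ℕ} (h : (n = 1 ∧ m ≠ 0) ∨ n = 2) {c : ℝ}
    (hc : 0 < c) :
    ∃ H : ℂ → ℂ, DifferentiableOn ℂ H Complex.slitPlane ∧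
      (∀ w : ℝ, 0 < w → H w = heatIntegral m n w) ∧
      ∃ C : ℝ, 0 ≤ C ∧ ∀ w ∈ Complex.slitPlane, c ≤ ‖w‖ →
        ‖H w‖ ≤ C * (√‖w‖ ^ n * √√‖w‖)⁻¹ := by
  rcases eq_or_ne m 0 with rfl | hm
  · -- massless case: `H w = 16 / w ^ 2`
    obtain rfl : n = 2 := by tauto
    refine ⟨fun w => 16 / w ^ 2, ?_, fun w hw => ?_, 16 / √√c ^ 3, by positivity, ?_⟩
    · exact (differentiableOn_const _).div (differentiableOn_pow 2) fun w hw =>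
        pow_ne_zero 2 (Complex.slitPlane_ne_zero hw)
    · have := integral_exp_neg_two_mul_exp_heat_massless (b := w / 4) (by positivity)
      simp only [heatIntegral, Nat.cast_ofNat, ne_eq, OfNat.ofNat_ne_zero, not_false_eq_true,
        zero_pow, zero_mul, zero_add]
      rw [this]; push_cast; field_simp; norm_num
    · intro w hw hcw
      have hw0 : 0 < ‖w‖ := hc.trans_le hcw
      have h1 : √√c ≤ √√‖w‖ := Real.sqrt_le_sqrt (Real.sqrt_le_sqrt hcw)
      have h2 : 0 < √√c := by positivity
      have h3 : √‖w‖ = √√‖w‖ ^ 2 := (Real.sq_sqrt (by positivity)).symm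
      have h4 : 0 < √√‖w‖ := by positivity
      have h5 : ‖w‖ ^ 2 = √√‖w‖ ^ 3 * (√‖w‖ ^ 2 * √√‖w‖) := by
        rw [show ‖w‖ ^ 2 = (√‖w‖ ^ 2) * (√‖w‖ ^ 2) by rw [Real.sq_sqrt hw0.le]; ring]
        generalize √‖w‖ = x at *
        rw [show √x ^ 3 * (x ^ 2 * √x) = (√x ^ 2) ^ 2 * x ^ 2 by ring, ← h3]
      rw [norm_div, norm_pow, Complex.norm_ofNat, h5, ← div_eq_mul_inv, div_div]
      gcongr
  · have hμ : 0 < |m| := abs_pos.2 hm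
    set p : ℂ → ℂ := fun w => w ^ (1 / 2 : ℂ) with hp
    have hpre : ∀ w ∈ Complex.slitPlane, 0 < (p w).re := fun w hw => re_cpow_half_pos hw
    have hpd : DifferentiableOn ℂ p Complex.slitPlane := fun w hw =>
      (differentiableAt_id.cpow_const hw).differentiableWithinAt
    have hpn : ∀ w, w ≠ 0 → ‖p w‖ = √‖w‖ := fun w hw => by
      rw [hp]; simp only
      rw [show (1 / 2 : ℂ) = ((1 / 2 : ℝ) : ℂ) by push_cast; rfl,
        Complex.norm_cpow_real, Real.sqrt_eq_rpow]
    have hq : ∀ w ∈ Complex.slitPlane, 0 < (|m| * p w).re := fun w hw => by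
      simpa using mul_pos hμ (hpre w hw)
    have hKbound : ∃ C : ℝ, 0 ≤ C ∧ ∀ q : ℂ, 0 < q.re → |m| * √c ≤ ‖q‖ →
        ‖macdonald n q‖ ≤ C * (√‖q‖)⁻¹ := by
      have hb : 0 < |m| * √c := by positivity
      rcases h with ⟨rfl, -⟩ | rfl
      · refine ⟨(2 + 2 / (|m| * √c)) * Real.pi, by positivity, fun q hq hcq => ?_⟩
        refine (norm_macdonald_one_le hq).trans ?_
        rw [mul_assoc, div_eq_mul_inv Real.pi]
        gcongr
      · refine ⟨(2 + 2 / (|m| * √c) * (2 + 2 / (|m| * √c))) * Real.pi, by positivity,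
          fun q hq hcq => ?_⟩
        refine (norm_macdonald_two_le hq).trans ?_
        rw [mul_assoc, div_eq_mul_inv Real.pi]
        gcongr
    obtain ⟨C, hC0, hC⟩ := hKbound
    refine ⟨fun w => (2 * |m| / p w) ^ n * macdonald n (|m| * p w), ?_, fun w hw => ?_,
      (2 * |m|) ^ n * (C * (√|m|)⁻¹), by positivity, fun w hw hcw => ?_⟩
    · refine DifferentiableOn.mul (DifferentiableOn.pow (DifferentiableOn.div
        (differentiableOn_const _) hpd fun w hw h0 => ?_) n)
        ((differentiableOn_macdonald n).comp (hpd.const_mul _) fun w hw => hq w hw)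
      have := hpre w hw
      rw [h0] at this; simp at this
    · have h1 := integral_exp_neg_nat_mul_exp_heat hμ hw n
      have h2 : p w = (√w : ℝ) := by
        rw [hp]; simp only
        rw [Real.sqrt_eq_rpow, Complex.ofReal_cpow hw.le]; push_cast; rfl
      rw [sq_abs] at h1
      simp only
      rw [heatIntegral, h1, h2]
      push_cast; rfl
    · have hw0 : 0 < ‖w‖ := hc.trans_le hcw
      have hnq : ‖(|m| * p w : ℂ)‖ = |m| * √‖w‖ := by
        rw [norm_mul, hpn w (norm_pos_iff.1 hw0), Complex.norm_real, Real.norm_eq_abs, abs_abs]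
      have h1 := hC _ (hq w hw) (by rw [hnq]; gcongr)
      rw [hnq, Real.sqrt_mul hμ.le] at h1
      rw [norm_mul, norm_pow, norm_div, hpn w (norm_pos_iff.1 hw0), norm_mul, Complex.norm_ofNat,
        Complex.norm_real, Real.norm_eq_abs, abs_abs, div_pow]
      calc _ ≤ (2 * |m|) ^ n / √‖w‖ ^ n * (C * (√|m| * √√‖w‖)⁻¹) := by gcongr
        _ = _ := by rw [mul_inv, mul_inv]; ring

/-! ### Gaussian integrals -/

/-- The plane wave `e^{2πi k·z}`. -/
noncomputable def planeWave (z k : Space3) : ℂ :=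
  Complex.exp (((2 * Real.pi * inner ℝ k z : ℝ) : ℂ) * Complex.I)

theorem norm_planeWave (z k : Space3) : ‖planeWave z k‖ = 1 := Complex.norm_exp_ofReal_mul_I _

@[fun_prop]
theorem continuous_planeWave (z : Space3) : Continuous (planeWave z) := by
  unfold planeWave; fun_prop

theorem integral_planeWave_mul_gaussian {s : ℝ} (hs : 0 < s) (z : Space3) :
    Integrable (fun k => planeWave z k * (Real.exp (-((2 * Real.pi * ‖k‖) ^ 2 * s)) : ℝ)) ∧
    ∫ k, planeWave z k * (Real.exp (-((2 * Real.pi * ‖k‖) ^ 2 * s)) : ℝ) =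
      ((4 * Real.pi * s) ^ (-(3 / 2) : ℝ) * Real.exp (-(‖z‖ ^ 2 / 4 * s⁻¹)) : ℝ) := by
  have hb : 0 < (((4 * Real.pi ^ 2 * s : ℝ) : ℂ)).re := by
    rw [Complex.ofReal_re]; positivity
  have e : ∀ k : Space3, planeWave z k * (Real.exp (-((2 * Real.pi * ‖k‖) ^ 2 * s)) : ℝ) =
      Complex.exp (-((4 * Real.pi ^ 2 * s : ℝ) : ℂ) * ‖k‖ ^ 2 +
        (2 * Real.pi * Complex.I) * (inner ℝ z k : ℝ)) := by
    intro k
    rw [planeWave, Complex.ofReal_exp, ← Complex.exp_add, real_inner_comm]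
    congr 1; push_cast; ring
  simp only [e]
  refine ⟨GaussianFourier.integrable_cexp_neg_mul_sq_norm_add hb _ z, ?_⟩
  rw [GaussianFourier.integral_cexp_neg_mul_sq_norm_add hb]
  have hπ := Real.pi_pos
  rw [finrank_euclideanSpace, Fintype.card_fin]
  push_cast
  congr 1
  · rw [Real.rpow_neg (by positivity), ← Real.inv_rpow (by positivity),
      Complex.ofReal_cpow (by positivity)]
    push_cast
    congr 1
    field_simp
  · congr 1
    have : (Real.pi : ℂ) ≠ 0 := by exact_mod_cast hπ.ne'
    have hs' : (s : ℂ) ≠ 0 := by exact_mod_cast hs.ne'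
    field_simp
    rw [Complex.I_sq]; ring

theorem norm_mul_exp_neg_sq_le {b : ℝ} (hb : 0 < b) (x : ℝ) :
    |x| * Real.exp (-(b * x ^ 2)) ≤ (1 + 2 / b) * Real.exp (-(b / 2 * x ^ 2)) := by
  have h1 : |x| ≤ (1 + 2 / b) * Real.exp (b / 2 * x ^ 2) := by
    have h2 := Real.add_one_le_exp (b / 2 * x ^ 2)
    have h3 : |x| ≤ 1 + x ^ 2 := by
      have := sq_abs x; nlinarith [sq_nonneg (|x| - 1), abs_nonneg x]
    calc |x| ≤ 1 + x ^ 2 := h3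
      _ ≤ (1 + 2 / b) * (b / 2 * x ^ 2 + 1) := by
        have : (1 + 2 / b) * (b / 2 * x ^ 2 + 1) = 1 + x ^ 2 + (b / 2 * x ^ 2 + 2 / b) := by
          field_simp; ring
        have h4 : 0 ≤ b / 2 * x ^ 2 + 2 / b := by positivity
        linarith
      _ ≤ _ := by gcongr
  have h2 : Real.exp (-(b * x ^ 2)) = Real.exp (-(b / 2 * x ^ 2)) * Real.exp (-(b / 2 * x ^ 2)) := by
    rw [← Real.exp_add]; ring_nf
  calc |x| * Real.exp (-(b * x ^ 2)) ≤ ((1 + 2 / b) * Real.exp (b / 2 * x ^ 2)) *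
        (Real.exp (-(b / 2 * x ^ 2)) * Real.exp (-(b / 2 * x ^ 2))) := by
        rw [h2]; gcongr
    _ = (1 + 2 / b) * Real.exp (-(b / 2 * x ^ 2)) *
        (Real.exp (b / 2 * x ^ 2) * Real.exp (-(b / 2 * x ^ 2))) := by ring
    _ = _ := by rw [← Real.exp_add, add_neg_cancel, Real.exp_zero, mul_one]

/-- The first moment of the Gaussian wave, from the vanishing of the integral of its derivative in
direction `e_j`. -/
theorem integral_coord_mul_planeWave_mul_gaussian {s : ℝ} (hs : 0 < s) (z : Space3) (j : Fin 3) :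
    ∫ k, (k j * planeWave z k) * (Real.exp (-((2 * Real.pi * ‖k‖) ^ 2 * s)) : ℝ) =
      (Complex.I * (z j / (4 * Real.pi * s) : ℝ)) *
      ((4 * Real.pi * s) ^ (-(3 / 2) : ℝ) * Real.exp (-(‖z‖ ^ 2 / 4 * s⁻¹)) : ℝ) := by
  have hπ := Real.pi_pos
  obtain ⟨hI, hV⟩ := integral_planeWave_mul_gaussian hs z
  obtain ⟨hI', -⟩ := integral_planeWave_mul_gaussian (half_pos hs) z
  have hIk : Integrable (fun k : Space3 =>
      (k j * planeWave z k) * (Real.exp (-((2 * Real.pi * ‖k‖) ^ 2 * s)) : ℝ)) := by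
    refine (hI'.norm.const_mul (1 + 2 / ((2 * Real.pi) ^ 2 * s))).mono'
      (by fun_prop) (Eventually.of_forall fun k => ?_)
    have h1 := norm_mul_exp_neg_sq_le (b := (2 * Real.pi) ^ 2 * s) (by positivity) ‖k‖
    rw [norm_mul, norm_mul, norm_mul, norm_planeWave, Complex.norm_real, Complex.norm_real,
      Complex.norm_real, Real.norm_of_nonneg (Real.exp_pos _).le,
      Real.norm_of_nonneg (Real.exp_pos _).le, mul_one, one_mul]
    have h2 : ‖k j‖ ≤ |‖k‖| := by rw [abs_norm]; exact PiLp.norm_apply_le k j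
    calc _ ≤ |‖k‖| * Real.exp (-((2 * Real.pi * ‖k‖) ^ 2 * s)) := by gcongr
      _ = |‖k‖| * Real.exp (-((2 * Real.pi) ^ 2 * s * ‖k‖ ^ 2)) := by ring_nf
      _ ≤ _ := h1
      _ = _ := by ring_nf
  -- integrate the derivative of the Gaussian wave in direction `e_j`
  have hd : ∀ k : Space3, HasLineDerivAt ℝ
      (fun k => planeWave z k * (Real.exp (-((2 * Real.pi * ‖k‖) ^ 2 * s)) : ℝ))
      (((2 * Real.pi * z j : ℝ) * Complex.I) *
          (planeWave z k * (Real.exp (-((2 * Real.pi * ‖k‖) ^ 2 * s)) : ℝ)) -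
        (8 * Real.pi ^ 2 * s : ℝ) *
          ((k j * planeWave z k) * (Real.exp (-((2 * Real.pi * ‖k‖) ^ 2 * s)) : ℝ)))
      k (EuclideanSpace.single j 1) := by
    intro k
    have hin : HasDerivAt (fun t : ℝ => 2 * Real.pi *
        inner ℝ (k + t • EuclideanSpace.single j (1 : ℝ)) z) (2 * Real.pi * z j) 0 := by
      have : (fun t : ℝ => 2 * Real.pi * inner ℝ (k + t • EuclideanSpace.single j (1 : ℝ)) z) =
          fun t : ℝ => 2 * Real.pi * (inner ℝ k z + t * z j) := by
        funext t
        rw [inner_add_left, inner_smul_left, EuclideanSpace.inner_single_left]; simp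
      rw [this]
      simpa using (((hasDerivAt_id (0 : ℝ)).mul_const (z j)).const_add (inner ℝ k z)).const_mul
        (2 * Real.pi)
    have hsq : HasDerivAt (fun t : ℝ =>
        -((2 * Real.pi * ‖k + t • EuclideanSpace.single j (1 : ℝ)‖) ^ 2 * s))
        (-(8 * Real.pi ^ 2 * s * k j)) 0 := by
      have : (fun t : ℝ => -((2 * Real.pi * ‖k + t • EuclideanSpace.single j (1 : ℝ)‖) ^ 2 * s)) =
          fun t : ℝ => -((2 * Real.pi) ^ 2 * s * (‖k‖ ^ 2 + 2 * (t * k j) + t ^ 2)) := by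
        funext t
        rw [mul_pow, norm_add_sq_real, norm_smul, inner_smul_right,
          EuclideanSpace.inner_single_right]
        simp; ring
      rw [this]
      have h := ((((((hasDerivAt_id (0 : ℝ)).mul_const (k j)).const_mul 2).const_add
        (‖k‖ ^ 2)).add ((hasDerivAt_id (0 : ℝ)).pow 2)).const_mul ((2 * Real.pi) ^ 2 * s)).neg
      refine h.congr_deriv ?_
      simp; ring
    have h1 := ((hin.ofReal_comp.mul_const Complex.I).cexp).mul (hsq.exp.ofReal_comp)
    refine HasDerivAt.congr_deriv h1 ?_
    simp only [zero_smul, add_zero]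
    rw [planeWave]
    push_cast
    ring
  have hIg' := (hI.const_mul (((2 * Real.pi * z j : ℝ) : ℂ) * Complex.I)).sub
    (hIk.const_mul (8 * Real.pi ^ 2 * s : ℝ))
  have h0 := integral_bilinear_hasLineDerivAt_right_eq_neg_left_of_integrable (μ := volume)
    (f := fun _ : Space3 => (1 : ℂ)) (f' := fun _ => 0) (B := ContinuousLinearMap.mul ℝ ℂ)
    (by simp) (hIg'.congr (Eventually.of_forall fun k => by simp)) (by simpa using hI)
    (fun k _ => hasDerivAt_const _ _) (fun k _ => hd k)
  simp only [ContinuousLinearMap.mul_apply', one_mul, zero_mul, integral_zero, neg_zero] at h0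
  rw [integral_sub (hI.const_mul _) (hIk.const_mul _), integral_const_mul, integral_const_mul,
    sub_eq_zero, hV] at h0
  have hc : ((8 * Real.pi ^ 2 * s : ℝ) : ℂ) ≠ 0 := by
    exact_mod_cast (by positivity : (8 * Real.pi ^ 2 * s : ℝ) ≠ 0)
  refine mul_left_cancel₀ hc ?_
  rw [← h0, ← mul_assoc]
  congr 1
  rw [mul_left_comm, ← Complex.ofReal_mul, mul_comm]
  congr 2
  field_simp
  ring

/-! ### The relativistic energy -/

/-- The relativistic energy `ω(k) = √(4π²|k|² + m²)` at the frequency `k`, the momentum being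
`2πk`. -/
noncomputable def energy (m : ℝ) (k : Space3) : ℝ := √((2 * Real.pi * ‖k‖) ^ 2 + m ^ 2)

theorem energy_nonneg (m : ℝ) (k : Space3) : 0 ≤ energy m k := Real.sqrt_nonneg _

theorem energy_sq (m : ℝ) (k : Space3) : energy m k ^ 2 = (2 * Real.pi * ‖k‖) ^ 2 + m ^ 2 :=
  Real.sq_sqrt (by positivity)

theorem two_pi_norm_le_energy (m : ℝ) (k : Space3) : 2 * Real.pi * ‖k‖ ≤ energy m k :=
  Real.le_sqrt_of_sq_le (by nlinarith [sq_nonneg m])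

theorem abs_mass_le_energy (m : ℝ) (k : Space3) : |m| ≤ energy m k :=
  Real.le_sqrt_of_sq_le (by rw [sq_abs]; nlinarith [sq_nonneg (2 * Real.pi * ‖k‖)])

theorem energy_pos_ae (m : ℝ) : ∀ᵐ k : Space3, 0 < energy m k := by
  have : ∀ᵐ k : Space3, k ≠ 0 := by
    rw [ae_iff]; simp
  filter_upwards [this] with k hk
  refine lt_of_lt_of_le ?_ (two_pi_norm_le_energy m k)
  have := norm_pos_iff.2 hk
  positivity

@[fun_prop]
theorem continuous_energy (m : ℝ) : Continuous (energy m) := by unfold energy; fun_prop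

theorem integrable_exp_neg_energy (m : ℝ) {a : ℝ} (ha : 0 < a) :
    Integrable (fun k : Space3 => Real.exp (-(a * energy m k))) := by
  have hb : 0 < a * (2 * Real.pi) := by positivity
  set b := a * (2 * Real.pi) with hbdef
  have h1 := (integrable_one_add_norm (E := Space3) (μ := volume) (r := 4)
    (by rw [finrank_euclideanSpace, Fintype.card_fin]; norm_num)).const_mul
    (24 * Real.exp b / b ^ 4)
  refine h1.mono' (by fun_prop) (Eventually.of_forall fun k => ?_)
  rw [Real.norm_of_nonneg (Real.exp_pos _).le]
  have h2 : 0 < 1 + ‖k‖ := by positivity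
  have h3 := Real.pow_div_factorial_le_exp (b * (1 + ‖k‖)) (by positivity) 4
  have h4 : Real.exp (-(a * energy m k)) ≤ Real.exp (-(b * ‖k‖)) := by
    refine Real.exp_le_exp.2 (neg_le_neg ?_)
    rw [hbdef, mul_assoc]
    exact mul_le_mul_of_nonneg_left (two_pi_norm_le_energy m k) ha.le
  refine h4.trans ?_
  rw [Real.rpow_neg h2.le, show (4 : ℝ) = (4 : ℕ) by norm_num, Real.rpow_natCast,
    ← div_eq_mul_inv, Real.exp_neg, inv_eq_one_div, div_div,
    div_le_div_iff₀ (Real.exp_pos _) (by positivity)]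
  rw [mul_add, mul_one, Real.exp_add, div_le_iff₀ (by positivity)] at h3
  have h5 : ((Nat.factorial 4 : ℕ) : ℝ) = 24 := by norm_num [Nat.factorial]
  rw [h5] at h3
  calc 1 * (b ^ 4 * (1 + ‖k‖) ^ (4 : ℕ)) = (b + b * ‖k‖) ^ 4 := by ring
    _ ≤ _ := h3
    _ = _ := by ring

/-! ### Relativistic kernels -/

/-- Fubini for subordinated integrals: if the Gaussian integrals of `P` are known, then integrating
`P` against a superposition of heat semigroups `e^{-sω²}`, `s = e^ξ`, gives a heat integral. -/
theorem integral_subordinate {P : Space3 → ℂ} {m τ r ρ : ℝ} {z : Space3} {D : ℂ}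
    (hP : AEStronglyMeasurable P)
    (hint : ∀ᵐ k, Integrable (fun ξ : ℝ => Real.exp (r * ξ) *
      Real.exp (-(energy m k ^ 2 * Real.exp ξ + τ ^ 2 / 4 * Real.exp (-ξ)))))
    (hPI : Integrable (fun k => ‖P k‖ * ∫ ξ : ℝ, Real.exp (r * ξ) *
      Real.exp (-(energy m k ^ 2 * Real.exp ξ + τ ^ 2 / 4 * Real.exp (-ξ)))))
    (hG : ∀ ξ : ℝ, ∫ k, P k * (Real.exp (-((2 * Real.pi * ‖k‖) ^ 2 * Real.exp ξ)) : ℝ) =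
      D * (Real.exp (-(ρ * ξ)) * Real.exp (-(‖z‖ ^ 2 / 4 * Real.exp (-ξ))) : ℝ)) :
    ∫ k, P k * ((∫ ξ : ℝ, Real.exp (r * ξ) *
      Real.exp (-(energy m k ^ 2 * Real.exp ξ + τ ^ 2 / 4 * Real.exp (-ξ))) : ℝ) : ℂ) =
    D * ((∫ ξ : ℝ, Real.exp ((r - ρ) * ξ) *
      Real.exp (-(m ^ 2 * Real.exp ξ + (τ ^ 2 + ‖z‖ ^ 2) / 4 * Real.exp (-ξ))) : ℝ) : ℂ) := by
  have hF : AEStronglyMeasurable (Function.uncurry fun (k : Space3) (ξ : ℝ) =>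
      P k * ((Real.exp (r * ξ) *
      Real.exp (-(energy m k ^ 2 * Real.exp ξ + τ ^ 2 / 4 * Real.exp (-ξ))) : ℝ) : ℂ))
      ((volume : Measure Space3).prod (volume : Measure ℝ)) := by
    refine hP.comp_fst.mul (Continuous.aestronglyMeasurable ?_)
    refine Complex.continuous_ofReal.comp ?_
    fun_prop
  have hprod : Integrable (Function.uncurry fun (k : Space3) (ξ : ℝ) =>
      P k * ((Real.exp (r * ξ) *
      Real.exp (-(energy m k ^ 2 * Real.exp ξ + τ ^ 2 / 4 * Real.exp (-ξ))) : ℝ) : ℂ))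
      ((volume : Measure Space3).prod (volume : Measure ℝ)) := by
    rw [integrable_prod_iff hF]
    refine ⟨?_, ?_⟩
    · filter_upwards [hint] with k hk
      exact hk.ofReal.const_mul (P k)
    · refine hPI.congr (Eventually.of_forall fun k => ?_)
      simp only [Function.uncurry]
      rw [← integral_const_mul]
      refine integral_congr_ae (Eventually.of_forall fun ξ => ?_)
      simp only
      rw [norm_mul, Complex.norm_real, Real.norm_of_nonneg (by positivity)]
  have hswap := integral_integral_swap hprod
  have e1 : ∀ k, ∫ ξ : ℝ, P k * ((Real.exp (r * ξ) *
      Real.exp (-(energy m k ^ 2 * Real.exp ξ + τ ^ 2 / 4 * Real.exp (-ξ))) : ℝ) : ℂ) =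
      P k * ((∫ ξ : ℝ, Real.exp (r * ξ) *
      Real.exp (-(energy m k ^ 2 * Real.exp ξ + τ ^ 2 / 4 * Real.exp (-ξ))) : ℝ) : ℂ) := fun k => by
    rw [integral_const_mul, integral_complex_ofReal]
  simp only [e1] at hswap
  rw [hswap, ← integral_complex_ofReal, ← integral_const_mul]
  refine integral_congr_ae (Eventually.of_forall fun ξ => ?_)
  simp only
  have e2 : ∀ k, P k * ((Real.exp (r * ξ) *
      Real.exp (-(energy m k ^ 2 * Real.exp ξ + τ ^ 2 / 4 * Real.exp (-ξ))) : ℝ) : ℂ) =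
      ((Real.exp (r * ξ) * Real.exp (-(m ^ 2 * Real.exp ξ + τ ^ 2 / 4 * Real.exp (-ξ))) : ℝ) : ℂ) *
      (P k * (Real.exp (-((2 * Real.pi * ‖k‖) ^ 2 * Real.exp ξ)) : ℝ)) := fun k => by
    rw [mul_left_comm, ← Complex.ofReal_mul, energy_sq, ← Real.exp_add, ← Real.exp_add,
      ← Real.exp_add]
    congr 3; ring
  simp only [e2]
  rw [integral_const_mul, hG, mul_left_comm, ← Complex.ofReal_mul]
  congr 2
  rw [← Real.exp_add, ← Real.exp_add, ← Real.exp_add, ← Real.exp_add]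
  congr 1; ring

/-- The kernel `∫ e^{2πi k·z} e^{-τω(k)} dk` of `e^{-τω}`. At `τ = ε ± it` it gives the kernel of the
damped `cos(tω)`. -/
noncomputable def kernelCos (m : ℝ) (z : Space3) (τ : ℂ) : ℂ :=
  ∫ k, planeWave z k * Complex.exp (-(τ * energy m k))

/-- The kernel `∫ e^{2πi k·z} ω(k)⁻¹ e^{-τω(k)} dk` of `ω⁻¹ e^{-τω}`. At `τ = ε ± it` it gives the
kernel of the damped `ω⁻¹ sin(tω)`. -/
noncomputable def kernelSin (m : ℝ) (z : Space3) (τ : ℂ) : ℂ :=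
  ∫ k, (planeWave z k / energy m k) * Complex.exp (-(τ * energy m k))

/-- The kernel `∫ e^{2πi k·z} k_j ω(k)⁻¹ e^{-τω(k)} dk`, up to the factor `2πi` the derivative `∂_j`
of `kernelSin` in `z`. -/
noncomputable def kernelGrad (m : ℝ) (j : Fin 3) (z : Space3) (τ : ℂ) : ℂ :=
  ∫ k, (k j * planeWave z k / energy m k) * Complex.exp (-(τ * energy m k))

theorem gaussian_prefactor (ξ : ℝ) : (4 * Real.pi * Real.exp ξ) ^ (-(3 / 2) : ℝ) =
    (8 * (√Real.pi * Real.pi))⁻¹ * Real.exp (-(3 / 2 * ξ)) := by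
  have hπ := Real.pi_pos
  rw [Real.mul_rpow (by positivity) (Real.exp_pos _).le, ← Real.exp_mul,
    Real.rpow_neg (by positivity), show (3 / 2 : ℝ) = 1 + 1 / 2 by norm_num,
    Real.rpow_add (by positivity), Real.rpow_one, ← Real.sqrt_eq_rpow,
    Real.sqrt_mul (by norm_num), show √(4 : ℝ) = 2 by
      rw [show (4 : ℝ) = 2 ^ 2 by norm_num]; exact Real.sqrt_sq (by norm_num)]
  congr 1
  · congr 1; ring
  · congr 1; ring

theorem integral_planeWave_mul_gaussian_exp (z : Space3) (ξ : ℝ) :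
    ∫ k, planeWave z k * (Real.exp (-((2 * Real.pi * ‖k‖) ^ 2 * Real.exp ξ)) : ℝ) =
      (((8 * (√Real.pi * Real.pi))⁻¹ : ℝ) : ℂ) *
      (Real.exp (-(3 / 2 * ξ)) * Real.exp (-(‖z‖ ^ 2 / 4 * Real.exp (-ξ))) : ℝ) := by
  rw [(integral_planeWave_mul_gaussian (Real.exp_pos ξ) z).2, gaussian_prefactor, Real.exp_neg ξ,
    ← Complex.ofReal_mul, mul_assoc]

theorem integral_coord_mul_planeWave_mul_gaussian_exp (z : Space3) (j : Fin 3) (ξ : ℝ) :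
    ∫ k, (k j * planeWave z k) * (Real.exp (-((2 * Real.pi * ‖k‖) ^ 2 * Real.exp ξ)) : ℝ) =
      (Complex.I * ((z j / (4 * Real.pi) * (8 * (√Real.pi * Real.pi))⁻¹ : ℝ) : ℂ)) *
      (Real.exp (-(5 / 2 * ξ)) * Real.exp (-(‖z‖ ^ 2 / 4 * Real.exp (-ξ))) : ℝ) := by
  rw [integral_coord_mul_planeWave_mul_gaussian (Real.exp_pos ξ) z, gaussian_prefactor,
    Real.exp_neg ξ, mul_assoc Complex.I, mul_assoc Complex.I, ← Complex.ofReal_mul,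
    ← Complex.ofReal_mul]
  congr 2
  rw [show -(5 / 2 * ξ) = -(3 / 2 * ξ) + -ξ by ring, Real.exp_add, Real.exp_neg ξ]
  field_simp

/-- The kernel of `e^{-τω}` for real `τ`, expressed by the heat integral of order `2`. -/
theorem kernelCos_eq_of_pos {m τ : ℝ} (hτ : 0 < τ) (z : Space3) :
    kernelCos m z τ =
      (((16 * Real.pi ^ 2)⁻¹ : ℝ) : ℂ) * τ * heatIntegral m 2 (τ ^ 2 + ‖z‖ ^ 2) := by
  have hπ := Real.pi_pos
  have hv : ∀ᵐ k : Space3, ∫ ξ : ℝ, Real.exp (-1 / 2 * ξ) *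
      Real.exp (-(energy m k ^ 2 * Real.exp ξ + τ ^ 2 / 4 * Real.exp (-ξ))) =
      2 * √Real.pi / τ * Real.exp (-(τ * energy m k)) := by
    filter_upwards [energy_pos_ae m] with k hk
    exact (integral_exp_neg_half_mul_exp_heat hk hτ).2
  have key := integral_subordinate (P := planeWave z) (m := m) (τ := τ) (r := -1 / 2) (ρ := 3 / 2)
    (z := z) (by fun_prop)
    (by filter_upwards [energy_pos_ae m] with k hk
        exact (integral_exp_neg_half_mul_exp_heat hk hτ).1)
    (by refine ((integrable_exp_neg_energy m hτ).const_mul (2 * √Real.pi / τ)).congr ?_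
        filter_upwards [hv] with k hk
        rw [hk, norm_planeWave, one_mul])
    (integral_planeWave_mul_gaussian_exp z)
  have h1 : ∫ k, planeWave z k * ((∫ ξ : ℝ, Real.exp (-1 / 2 * ξ) *
      Real.exp (-(energy m k ^ 2 * Real.exp ξ + τ ^ 2 / 4 * Real.exp (-ξ))) : ℝ) : ℂ) =
      ((2 * √Real.pi / τ : ℝ) : ℂ) * kernelCos m z τ := by
    rw [kernelCos, ← integral_const_mul]
    refine integral_congr_ae ?_
    filter_upwards [hv] with k hk
    rw [hk]; push_cast; ring
  rw [h1, show (-1 / 2 - 3 / 2 : ℝ) = -(2 : ℕ) by norm_num] at key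
  change _ = _ * ((heatIntegral m 2 (τ ^ 2 + ‖z‖ ^ 2) : ℝ) : ℂ) at key
  have hc : ((2 * √Real.pi / τ : ℝ) : ℂ) ≠ 0 := by
    exact_mod_cast (by positivity : (2 * √Real.pi / τ : ℝ) ≠ 0)
  refine mul_left_cancel₀ hc ?_
  rw [key, ← mul_assoc, ← mul_assoc]
  congr 1
  rw [← Complex.ofReal_mul, ← Complex.ofReal_mul]
  congr 1
  field_simp
  rw [Real.sq_sqrt hπ.le]; ring

/-- Kernels with a factor `1 / ω`, for real `τ`: subordination and the Gaussian integrals of `P`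
express them by the heat integrals. -/
theorem integral_div_energy_eq_of_pos {m τ ρ : ℝ} (hτ : 0 < τ) {z : Space3} {P : Space3 → ℂ}
    {D : ℂ} {n : ℕ} (hρ : ρ = 1 / 2 + n) (hP : AEStronglyMeasurable P)
    (hPI : Integrable (fun k => ‖P k / energy m k‖ * Real.exp (-(τ * energy m k))))
    (hG : ∀ ξ : ℝ, ∫ k, P k * (Real.exp (-((2 * Real.pi * ‖k‖) ^ 2 * Real.exp ξ)) : ℝ) =
      D * (Real.exp (-(ρ * ξ)) * Real.exp (-(‖z‖ ^ 2 / 4 * Real.exp (-ξ))) : ℝ)) :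
    ∫ k, (P k / energy m k) * Complex.exp (-(τ * energy m k)) =
      (((√Real.pi)⁻¹ : ℝ) : ℂ) * D * heatIntegral m n (τ ^ 2 + ‖z‖ ^ 2) := by
  have hπ := Real.pi_pos
  have hv : ∀ᵐ k : Space3, ∫ ξ : ℝ, Real.exp (1 / 2 * ξ) *
      Real.exp (-(energy m k ^ 2 * Real.exp ξ + τ ^ 2 / 4 * Real.exp (-ξ))) =
      √Real.pi * (Real.exp (-(τ * energy m k)) / energy m k) := by
    filter_upwards [energy_pos_ae m] with k hk
    exact (integral_exp_half_mul_exp_heat hk hτ).2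
  have key := integral_subordinate (P := P) (m := m) (τ := τ) (r := 1 / 2) (ρ := ρ)
    (z := z) hP
    (by filter_upwards [energy_pos_ae m] with k hk
        exact (integral_exp_half_mul_exp_heat hk hτ).1)
    (by refine (hPI.const_mul (√Real.pi)).congr ?_
        filter_upwards [hv] with k hk
        rw [hk, norm_div, Complex.norm_real, Real.norm_of_nonneg (energy_nonneg m k)]; ring)
    hG
  have h1 : ∫ k, P k * ((∫ ξ : ℝ, Real.exp (1 / 2 * ξ) *
      Real.exp (-(energy m k ^ 2 * Real.exp ξ + τ ^ 2 / 4 * Real.exp (-ξ))) : ℝ) : ℂ) =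
      ((√Real.pi : ℝ) : ℂ) * ∫ k, (P k / energy m k) * Complex.exp (-(τ * energy m k)) := by
    rw [← integral_const_mul]
    refine integral_congr_ae ?_
    filter_upwards [hv] with k hk
    rw [hk]; push_cast; ring
  rw [h1, show (1 / 2 - ρ : ℝ) = -n by rw [hρ]; ring] at key
  change _ = _ * ((heatIntegral m n (τ ^ 2 + ‖z‖ ^ 2) : ℝ) : ℂ) at key
  have hc : ((√Real.pi : ℝ) : ℂ) ≠ 0 := by
    exact_mod_cast (by positivity : (√Real.pi : ℝ) ≠ 0)
  refine mul_left_cancel₀ hc ?_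
  rw [key, Complex.ofReal_inv]
  field_simp

theorem integrable_planeWave_div_energy {m : ℝ} (hm : m ≠ 0) (z : Space3) {a : ℝ} (ha : 0 < a) :
    Integrable (fun k => ‖planeWave z k / energy m k‖ * Real.exp (-(a * energy m k))) := by
  refine ((integrable_exp_neg_energy m ha).const_mul |m|⁻¹).mono' ?_
    (Eventually.of_forall fun k => ?_)
  · exact (Measurable.norm (by fun_prop)).mul (by fun_prop) |>.aestronglyMeasurable
  · have h := abs_mass_le_energy m k
    have hm' : 0 < |m| := abs_pos.2 hm
    rw [norm_mul, norm_norm, norm_div, norm_planeWave, Complex.norm_real,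
      Real.norm_of_nonneg (energy_nonneg m k), Real.norm_of_nonneg (Real.exp_pos _).le, one_div]
    gcongr

theorem norm_coord_div_energy_le (m : ℝ) (k : Space3) (j : Fin 3) :
    ‖k j‖ / energy m k ≤ (2 * Real.pi)⁻¹ := by
  have h1 := two_pi_norm_le_energy m k
  have h2 : ‖k j‖ ≤ ‖k‖ := PiLp.norm_apply_le k j
  have hπ := Real.pi_pos
  rcases (energy_nonneg m k).eq_or_lt with h | h
  · rw [← h, div_zero]; positivity
  · rw [div_le_iff₀ h, inv_mul_eq_div, le_div_iff₀ (by positivity)]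
    nlinarith

theorem integrable_coord_mul_planeWave_div_energy (m : ℝ) (j : Fin 3) (z : Space3) {a : ℝ}
    (ha : 0 < a) :
    Integrable (fun k : Space3 =>
      ‖k j * planeWave z k / energy m k‖ * Real.exp (-(a * energy m k))) := by
  refine ((integrable_exp_neg_energy m ha).const_mul (2 * Real.pi)⁻¹).mono' ?_
    (Eventually.of_forall fun k => ?_)
  · exact (Measurable.norm (by fun_prop)).mul (by fun_prop) |>.aestronglyMeasurable
  · rw [norm_mul, norm_norm, norm_div, norm_mul, norm_planeWave, Complex.norm_real, mul_one,
      Complex.norm_real,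
      Real.norm_of_nonneg (energy_nonneg m k), Real.norm_of_nonneg (Real.exp_pos _).le]
    exact mul_le_mul_of_nonneg_right (norm_coord_div_energy_le m k j) (Real.exp_pos _).le

theorem kernelSin_eq_of_pos {m τ : ℝ} (hm : m ≠ 0) (hτ : 0 < τ) (z : Space3) :
    kernelSin m z τ =
      ((√Real.pi)⁻¹ : ℝ) * ((8 * (√Real.pi * Real.pi))⁻¹ : ℝ) *
        heatIntegral m 1 (τ ^ 2 + ‖z‖ ^ 2) :=
  integral_div_energy_eq_of_pos hτ (n := 1) (by norm_num) (by fun_prop)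
    (integrable_planeWave_div_energy hm z hτ) (integral_planeWave_mul_gaussian_exp z)

theorem kernelGrad_eq_of_pos {m τ : ℝ} (hτ : 0 < τ) (j : Fin 3) (z : Space3) :
    kernelGrad m j z τ =
      ((√Real.pi)⁻¹ : ℝ) *
        (Complex.I * ((z j / (4 * Real.pi) * (8 * (√Real.pi * Real.pi))⁻¹ : ℝ) : ℂ)) *
        heatIntegral m 2 (τ ^ 2 + ‖z‖ ^ 2) :=
  integral_div_energy_eq_of_pos hτ (n := 2) (by norm_num) (by fun_prop)
    (integrable_coord_mul_planeWave_div_energy m j z hτ)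
    (integral_coord_mul_planeWave_mul_gaussian_exp z j)

theorem differentiableOn_continuation {H : ℂ → ℂ} (hH : DifferentiableOn ℂ H Complex.slitPlane)
    (z : Space3) :
    DifferentiableOn ℂ (fun τ : ℂ => H (τ ^ 2 + (‖z‖ ^ 2 : ℝ))) {τ : ℂ | 0 < τ.re} :=
  hH.comp ((differentiableOn_pow 2).add_const _)
    fun _ hτ => sq_add_ofReal_mem_slitPlane hτ (sq_nonneg _)

/-- Decay of the kernels strictly inside the light cone, that is for `c t² ≤ |τ² + |z|²|` with
`τ = ε ± it`. The lower bound on `|τ² + |z|²|` makes the estimate uniform as `ε → 0`. -/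
theorem exists_norm_kernel_le (m : ℝ) {c : ℝ} (hc : 0 < c) :
    ∃ C : ℝ, 0 ≤ C ∧ ∀ (t : ℝ) (z : Space3) (τ : ℂ), 1 ≤ t → 0 < τ.re → ‖τ‖ ≤ 2 * t → ‖z‖ ≤ t →
      c * t ^ 2 ≤ ‖τ ^ 2 + (‖z‖ ^ 2 : ℝ)‖ →
      ‖kernelCos m z τ‖ ≤ C * (t * √t)⁻¹ ∧
      (m ≠ 0 → ‖kernelSin m z τ‖ ≤ C * (t * √t)⁻¹) ∧
      ∀ j, ‖kernelGrad m j z τ‖ ≤ C * (t * √t)⁻¹ := by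
  have hπ := Real.pi_pos
  obtain ⟨H₂, hd₂, hv₂, C₂, hC₂, hb₂⟩ :=
    exists_heatIntegral_continuation (m := m) (n := 2) (Or.inr rfl) hc
  have hsin : ∃ C₁ : ℝ, 0 ≤ C₁ ∧ (m ≠ 0 → ∀ (t : ℝ) (z : Space3) (τ : ℂ), 1 ≤ t → 0 < τ.re →
      c * t ^ 2 ≤ ‖τ ^ 2 + (‖z‖ ^ 2 : ℝ)‖ → ‖kernelSin m z τ‖ ≤ C₁ * (t * √t)⁻¹) := by
    by_cases hm : m = 0
    · exact ⟨0, le_rfl, fun h => absurd hm h⟩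
    obtain ⟨H₁, hd₁, hv₁, C₁, hC₁, hb₁⟩ :=
      exists_heatIntegral_continuation (m := m) (n := 1) (Or.inl ⟨rfl, hm⟩) hc
    refine ⟨(√Real.pi)⁻¹ * (8 * (√Real.pi * Real.pi))⁻¹ * (C₁ * (√c * √√c)⁻¹), by positivity,
      fun _ t z τ ht hτ hw => ?_⟩
    have ht0 : 0 < t := by linarith
    have heq := eqOn_re_pos_of_eq_ofReal (f := kernelSin m z)
      (g := fun τ => ((√Real.pi)⁻¹ : ℝ) * ((8 * (√Real.pi * Real.pi))⁻¹ : ℝ) *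
        H₁ (τ ^ 2 + (‖z‖ ^ 2 : ℝ)))
      (differentiableOn_integral_mul_cexp_neg (energy_nonneg m) (by fun_prop)
        (Measurable.aestronglyMeasurable (by fun_prop))
        fun a ha => integrable_planeWave_div_energy hm z ha)
      ((differentiableOn_continuation hd₁ z).const_mul _)
      (fun τ hτ => by
        rw [kernelSin_eq_of_pos hm hτ, ← hv₁ _ (by positivity)]; push_cast; rfl) hτ
    have hmem := sq_add_ofReal_mem_slitPlane hτ (sq_nonneg ‖z‖)
    have hct : c ≤ ‖τ ^ 2 + (‖z‖ ^ 2 : ℝ)‖ :=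
      le_trans (le_mul_of_one_le_right hc.le (one_le_pow₀ ht)) hw
    have h1 := hb₁ _ hmem hct
    have h2 : √c * t ≤ √‖τ ^ 2 + ((‖z‖ ^ 2 : ℝ) : ℂ)‖ := by
      rw [← Real.sqrt_sq ht0.le, ← Real.sqrt_mul hc.le]; exact Real.sqrt_le_sqrt hw
    have h3 : √√c * √t ≤ √√‖τ ^ 2 + ((‖z‖ ^ 2 : ℝ) : ℂ)‖ := by
      rw [← Real.sqrt_mul (by positivity)]; exact Real.sqrt_le_sqrt h2
    rw [heq]
    simp only
    rw [norm_mul, norm_mul, Complex.norm_real, Complex.norm_real,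
      Real.norm_of_nonneg (by positivity), Real.norm_of_nonneg (by positivity), mul_assoc _ _ (t * √t)⁻¹]
    refine mul_le_mul_of_nonneg_left (h1.trans ?_) (by positivity)
    rw [mul_assoc, ← mul_inv, pow_one]
    refine mul_le_mul_of_nonneg_left (inv_anti₀ (by positivity) ?_) hC₁
    calc √c * √√c * (t * √t) = (√c * t) * (√√c * √t) := by ring
      _ ≤ _ := by gcongr
  obtain ⟨C₁, hC₁, hb₁⟩ := hsin
  have hkey : ∀ (t : ℝ) (z : Space3) (τ : ℂ), 1 ≤ t → 0 < τ.re →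
      c * t ^ 2 ≤ ‖τ ^ 2 + (‖z‖ ^ 2 : ℝ)‖ →
      t * ‖H₂ (τ ^ 2 + (‖z‖ ^ 2 : ℝ))‖ ≤ C₂ * (c * √√c)⁻¹ * (t * √t)⁻¹ := by
    intro t z τ ht hτ hw
    have ht0 : 0 < t := by linarith
    have hmem := sq_add_ofReal_mem_slitPlane hτ (sq_nonneg ‖z‖)
    have hct : c ≤ ‖τ ^ 2 + (‖z‖ ^ 2 : ℝ)‖ :=
      le_trans (le_mul_of_one_le_right hc.le (one_le_pow₀ ht)) hw
    have h1 := hb₂ _ hmem hct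
    have h2 : √c * t ≤ √‖τ ^ 2 + ((‖z‖ ^ 2 : ℝ) : ℂ)‖ := by
      rw [← Real.sqrt_sq ht0.le, ← Real.sqrt_mul hc.le]; exact Real.sqrt_le_sqrt hw
    have h3 : √√c * √t ≤ √√‖τ ^ 2 + ((‖z‖ ^ 2 : ℝ) : ℂ)‖ := by
      rw [← Real.sqrt_mul (by positivity)]; exact Real.sqrt_le_sqrt h2
    rw [Real.sq_sqrt (norm_nonneg _)] at h1
    calc t * ‖H₂ (τ ^ 2 + (‖z‖ ^ 2 : ℝ))‖
        ≤ t * (C₂ * ((c * t ^ 2) * (√√c * √t))⁻¹) := by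
          refine mul_le_mul_of_nonneg_left (h1.trans ?_) ht0.le
          exact mul_le_mul_of_nonneg_left (inv_anti₀ (by positivity) (by gcongr)) hC₂
      _ = _ := by field_simp
  set K : ℝ := C₂ * (c * √√c)⁻¹ with hK
  have hK0 : 0 ≤ K := by positivity
  -- the factor `2` is from `‖τ‖ ≤ 2 t`
  set A : ℝ := (16 * Real.pi ^ 2)⁻¹ * 2 with hA
  set B : ℝ := (√Real.pi)⁻¹ * ((4 * Real.pi)⁻¹ * (8 * (√Real.pi * Real.pi))⁻¹) with hB
  have hA0 : 0 ≤ A := by positivity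
  have hB0 : 0 ≤ B := by positivity
  refine ⟨A * K + C₁ + B * K, by positivity, fun t z τ ht hτ hτt hz hw => ?_⟩
  have ht0 : 0 < t := by linarith
  have hu : 0 ≤ (t * √t)⁻¹ := by positivity
  have hkt := hkey t z τ ht hτ hw
  have hAK : 0 ≤ A * K := by positivity
  have hBK : 0 ≤ B * K := by positivity
  refine ⟨?_, fun hm => ?_, fun j => ?_⟩
  · have heq := eqOn_re_pos_of_eq_ofReal (f := kernelCos m z)
      (g := fun τ => ((16 * Real.pi ^ 2)⁻¹ : ℝ) * τ * H₂ (τ ^ 2 + (‖z‖ ^ 2 : ℝ)))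
      (differentiableOn_integral_mul_cexp_neg (energy_nonneg m) (by fun_prop)
        (by fun_prop) fun a ha => by
          simpa only [norm_planeWave, one_mul] using integrable_exp_neg_energy m ha)
      ((differentiableOn_id.const_mul _).mul (differentiableOn_continuation hd₂ z))
      (fun τ hτ => by
        rw [kernelCos_eq_of_pos hτ, ← hv₂ _ (by positivity)]; push_cast; rfl) hτ
    rw [heq]
    simp only
    rw [norm_mul, norm_mul, Complex.norm_real, Real.norm_of_nonneg (by positivity)]
    calc (16 * Real.pi ^ 2)⁻¹ * ‖τ‖ * ‖H₂ (τ ^ 2 + (‖z‖ ^ 2 : ℝ))‖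
        ≤ (16 * Real.pi ^ 2)⁻¹ * (2 * t) * ‖H₂ (τ ^ 2 + (‖z‖ ^ 2 : ℝ))‖ := by gcongr
      _ = A * (t * ‖H₂ (τ ^ 2 + (‖z‖ ^ 2 : ℝ))‖) := by rw [hA]; ring
      _ ≤ A * (K * (t * √t)⁻¹) := mul_le_mul_of_nonneg_left hkt hA0
      _ = A * K * (t * √t)⁻¹ := by ring
      _ ≤ _ := mul_le_mul_of_nonneg_right (by linarith) hu
  · exact (hb₁ hm t z τ ht hτ hw).trans (mul_le_mul_of_nonneg_right (by linarith) hu)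
  · have heq := eqOn_re_pos_of_eq_ofReal (f := kernelGrad m j z)
      (g := fun τ => ((√Real.pi)⁻¹ : ℝ) *
        (Complex.I * ((z j / (4 * Real.pi) * (8 * (√Real.pi * Real.pi))⁻¹ : ℝ) : ℂ)) *
        H₂ (τ ^ 2 + (‖z‖ ^ 2 : ℝ)))
      (differentiableOn_integral_mul_cexp_neg (energy_nonneg m) (by fun_prop)
        (Measurable.aestronglyMeasurable (by fun_prop))
        fun a ha => integrable_coord_mul_planeWave_div_energy m j z ha)
      ((differentiableOn_continuation hd₂ z).const_mul _)
      (fun τ hτ => by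
        rw [kernelGrad_eq_of_pos hτ, ← hv₂ _ (by positivity)]; push_cast; rfl) hτ
    have hzj : |z j| ≤ t := (PiLp.norm_apply_le z j).trans hz
    rw [heq]
    simp only
    rw [norm_mul, norm_mul, norm_mul, Complex.norm_I, one_mul, Complex.norm_real,
      Complex.norm_real, Real.norm_of_nonneg (by positivity), Real.norm_eq_abs, abs_mul, abs_div,
      abs_of_pos (by positivity : 0 < 4 * Real.pi),
      abs_of_pos (by positivity : 0 < (8 * (√Real.pi * Real.pi))⁻¹)]
    calc _ ≤ (√Real.pi)⁻¹ * (t / (4 * Real.pi) * (8 * (√Real.pi * Real.pi))⁻¹) *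
          ‖H₂ (τ ^ 2 + (‖z‖ ^ 2 : ℝ))‖ := by gcongr
      _ = B * (t * ‖H₂ (τ ^ 2 + (‖z‖ ^ 2 : ℝ))‖) := by rw [hB]; ring
      _ ≤ B * (K * (t * √t)⁻¹) := mul_le_mul_of_nonneg_left hkt hB0
      _ = B * K * (t * √t)⁻¹ := by ring
      _ ≤ _ := mul_le_mul_of_nonneg_right (by linarith) hu

/-! ### The Dirac symbol -/

theorem conjTranspose_diracAlpha (j : Fin 3) : (diracAlpha j).conjTranspose = diracAlpha j := by
  fin_cases j <;> ext a b <;> fin_cases a <;> fin_cases b <;> simp [diracAlpha]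

theorem conjTranspose_diracBeta : diracBeta.conjTranspose = diracBeta := by
  ext a b; fin_cases a <;> fin_cases b <;> simp [diracBeta]

/-- A complex `4 × 4` matrix as an operator on spinors. -/
noncomputable abbrev matCLM (A : Matrix (Fin 4) (Fin 4) ℂ) : Spinor →L[ℂ] Spinor :=
  Matrix.toEuclideanCLM (n := Fin 4) (𝕜 := ℂ) A

theorem spinorAct_eq (A : Matrix (Fin 4) (Fin 4) ℂ) (s : Spinor) : spinorAct A s = matCLM A s := rfl

/-- The symbol `-2πi α·k - iβm` of the Dirac operator `-α·∇ - iβm`. -/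
noncomputable def diracSymbol (m : ℝ) (k : Space3) : Spinor →L[ℂ] Spinor :=
  -(∑ j, (2 * Real.pi * Complex.I * k j) • matCLM (diracAlpha j)) -
    (Complex.I * m) • matCLM diracBeta

theorem diracSymbol_eq (m : ℝ) (k : Space3) : diracSymbol m k = matCLM
    (-(∑ j, (2 * Real.pi * Complex.I * k j) • diracAlpha j) - (Complex.I * m) • diracBeta) := by
  simp [diracSymbol, matCLM, map_sum]

/-- The Clifford relations: the Dirac symbol is a square root of `-ω²`. -/
theorem diracSymbol_mul_self (m : ℝ) (k : Space3) :
    diracSymbol m k * diracSymbol m k = -((energy m k ^ 2 : ℝ) : ℂ) • (1 : Spinor →L[ℂ] Spinor) := by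
  have hn : ‖k‖ ^ 2 = k 0 ^ 2 + k 1 ^ 2 + k 2 ^ 2 := by
    rw [EuclideanSpace.real_norm_sq_eq, Fin.sum_univ_three]
  have : (-(∑ j, (2 * Real.pi * Complex.I * k j) • diracAlpha j) - (Complex.I * m) • diracBeta) *
      (-(∑ j, (2 * Real.pi * Complex.I * k j) • diracAlpha j) - (Complex.I * m) • diracBeta) =
      -((energy m k ^ 2 : ℝ) : ℂ) • (1 : Matrix (Fin 4) (Fin 4) ℂ) := by
    rw [energy_sq, mul_pow, hn]
    ext a b
    fin_cases a <;> fin_cases b <;>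
      simp [diracAlpha, diracBeta, Matrix.mul_apply, Fin.sum_univ_succ] <;>
      ring_nf <;> simp [Complex.I_sq] <;> ring
  rw [diracSymbol_eq, ← map_mul, this, map_smul, map_one]

theorem star_diracSymbol (m : ℝ) (k : Space3) : star (diracSymbol m k) = -diracSymbol m k := by
  rw [diracSymbol_eq, ← map_star, ← map_neg, Matrix.star_eq_conjTranspose]
  congr 1
  simp only [Matrix.conjTranspose_sub, Matrix.conjTranspose_neg, Matrix.conjTranspose_sum,
    Matrix.conjTranspose_smul, conjTranspose_diracAlpha, conjTranspose_diracBeta]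
  simp [Finset.sum_neg_distrib, sub_eq_add_neg, add_comm]

theorem inner_diracSymbol_left (m : ℝ) (k : Space3) (s s' : Spinor) :
    inner ℂ (diracSymbol m k s) s' = -inner ℂ s (diracSymbol m k s') := by
  rw [← ContinuousLinearMap.adjoint_inner_right, ← ContinuousLinearMap.star_eq_adjoint,
    star_diracSymbol, _root_.neg_apply, inner_neg_right]

theorem diracSymbol_apply_apply (m : ℝ) (k : Space3) (s : Spinor) :
    diracSymbol m k (diracSymbol m k s) = -((energy m k ^ 2 : ℝ) : ℂ) • s := by
  have := congrArg (fun T : Spinor →L[ℂ] Spinor => T s) (diracSymbol_mul_self m k)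
  simpa using this

theorem norm_diracSymbol_apply (m : ℝ) (k : Space3) (s : Spinor) :
    ‖diracSymbol m k s‖ = energy m k * ‖s‖ := by
  have h1 : inner ℂ (diracSymbol m k s) (diracSymbol m k s) =
      ((energy m k ^ 2 : ℝ) : ℂ) * inner ℂ s s := by
    rw [inner_diracSymbol_left, diracSymbol_apply_apply, inner_smul_right]; ring
  rw [inner_self_eq_norm_sq_to_K, inner_self_eq_norm_sq_to_K] at h1
  have h2 : ‖diracSymbol m k s‖ ^ 2 = (energy m k * ‖s‖) ^ 2 := by
    rw [mul_pow]; exact Complex.ofReal_injective (by push_cast; simpa using h1)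
  exact (sq_eq_sq₀ (norm_nonneg _) (mul_nonneg (energy_nonneg _ _) (norm_nonneg _))).1 h2

@[fun_prop]
theorem continuous_diracSymbol (m : ℝ) : Continuous (diracSymbol m) := by
  unfold diracSymbol; fun_prop

/-- The symbol `-2πi α·k - iβm + 2πi v·k` of the generator `-α·∇ - iβm + v·∇`. -/
noncomputable def generatorSymbol (m : ℝ) (v k : Space3) : Spinor →L[ℂ] Spinor :=
  diracSymbol m k + ((2 * Real.pi * inner ℝ k v : ℝ) * Complex.I) • 1

@[fun_prop]
theorem continuous_generatorSymbol (m : ℝ) (v : Space3) : Continuous (generatorSymbol m v) := by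
  unfold generatorSymbol; fun_prop

/-- The symbol of the generator is skew-adjoint, so the `L²` norm is conserved. -/
theorem re_inner_generatorSymbol (m : ℝ) (v k : Space3) (s : Spinor) :
    (inner ℂ s (generatorSymbol m v k s)).re = 0 := by
  have h1 : (inner ℂ s (diracSymbol m k s)).re = 0 := by
    have h := congrArg Complex.re (inner_diracSymbol_left m k s s)
    rw [← inner_conj_symm, Complex.conj_re, Complex.neg_re] at h
    linarith
  have h2 : (inner ℂ s s : ℂ) = ((‖s‖ ^ 2 : ℝ) : ℂ) := by
    rw [inner_self_eq_norm_sq_to_K]; push_cast; rfl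
  simp only [generatorSymbol, _root_.add_apply, _root_.smul_apply,
    one_apply_eq_self, inner_add_right, inner_smul_right, Complex.add_re, h1, h2]
  simp [-Complex.ofReal_pow, -Complex.ofReal_mul]

theorem norm_generatorSymbol_apply_le (m : ℝ) (v k : Space3) (s : Spinor) :
    ‖generatorSymbol m v k s‖ ≤ (|m| + 2 * Real.pi * (1 + ‖v‖) * ‖k‖) * ‖s‖ := by
  have hπ := Real.pi_pos
  have h1 : energy m k ≤ |m| + 2 * Real.pi * ‖k‖ := by
    refine Real.sqrt_le_iff.2 ⟨by positivity, ?_⟩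
    have : 0 ≤ |m| * (2 * Real.pi * ‖k‖) := by positivity
    have := sq_abs m
    nlinarith
  have h2 : |inner ℝ k v| ≤ ‖k‖ * ‖v‖ := abs_real_inner_le_norm k v
  simp only [generatorSymbol, _root_.add_apply, _root_.smul_apply,
    one_apply_eq_self]
  refine (norm_add_le _ _).trans ?_
  rw [norm_diracSymbol_apply, norm_smul, norm_mul, Complex.norm_I, Complex.norm_real, mul_one,
    Real.norm_eq_abs, abs_mul, abs_of_pos (by positivity : 0 < 2 * Real.pi), ← add_mul]
  refine mul_le_mul_of_nonneg_right ?_ (norm_nonneg _)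
  calc energy m k + 2 * Real.pi * |inner ℝ k v|
      ≤ (|m| + 2 * Real.pi * ‖k‖) + 2 * Real.pi * (‖k‖ * ‖v‖) := by gcongr
    _ = _ := by ring

/-- The symbol `e^{2πi t v·k} (cos(tω) + ω⁻¹ sin(tω) (-2πi α·k - iβm))` of the propagator, the
exponential of `t` times `generatorSymbol`. Where `ω = 0` the junk value of `ω⁻¹ sin(tω)` multiplies
a vanishing symbol. -/
noncomputable def propagatorSymbol (m : ℝ) (v : Space3) (t : ℝ) (k : Space3) :
    Spinor →L[ℂ] Spinor :=
  planeWave (t • v) k • (((Real.cos (t * energy m k) : ℝ) : ℂ) • 1 +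
    ((Real.sin (t * energy m k) / energy m k : ℝ) : ℂ) • diracSymbol m k)

theorem propagatorSymbol_zero (m : ℝ) (v k : Space3) : propagatorSymbol m v 0 k = 1 := by
  ext1 s
  simp [propagatorSymbol, planeWave]

theorem norm_propagatorSymbol_apply_le (m : ℝ) (v : Space3) (t : ℝ) (k : Space3) (s : Spinor) :
    ‖propagatorSymbol m v t k s‖ ≤ 2 * ‖s‖ := by
  simp only [propagatorSymbol, _root_.add_apply, _root_.smul_apply,
    one_apply_eq_self]
  rw [norm_smul, norm_planeWave, one_mul, two_mul]
  refine (norm_add_le _ _).trans (add_le_add ?_ ?_)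
  · rw [norm_smul, Complex.norm_real]
    exact mul_le_of_le_one_left (norm_nonneg _) (Real.abs_cos_le_one _)
  · rw [norm_smul, Complex.norm_real, norm_diracSymbol_apply, ← mul_assoc, norm_div,
      Real.norm_of_nonneg (energy_nonneg m k)]
    refine mul_le_of_le_one_left (norm_nonneg _) ?_
    rcases (energy_nonneg m k).eq_or_lt with h | h
    · rw [← h, mul_zero]; exact zero_le_one
    · rw [div_mul_cancel₀ _ h.ne']
      exact Real.abs_sin_le_one _

theorem norm_propagatorSymbol_le (m : ℝ) (v : Space3) (t : ℝ) (k : Space3) :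
    ‖propagatorSymbol m v t k‖ ≤ 2 :=
  ContinuousLinearMap.opNorm_le_bound _ zero_le_two (norm_propagatorSymbol_apply_le m v t k)

theorem hasDerivAt_propagatorSymbol_apply (m : ℝ) (v k : Space3) (s : Spinor) (t : ℝ) :
    HasDerivAt (fun t => propagatorSymbol m v t k s)
      (generatorSymbol m v k (propagatorSymbol m v t k s)) t := by
  set ω := energy m k with hω
  have hp : HasDerivAt (fun t : ℝ => planeWave (t • v) k)
      (planeWave (t • v) k * ((2 * Real.pi * inner ℝ k v : ℝ) * Complex.I)) t := by
    have e : (fun t : ℝ => planeWave (t • v) k) = fun t : ℝ =>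
        Complex.exp (((t * (2 * Real.pi * inner ℝ k v) : ℝ) : ℂ) * Complex.I) := by
      funext t; rw [planeWave, inner_smul_right]; congr 3; ring
    have e' := congrFun e t
    rw [e, e']
    exact (((hasDerivAt_mul_const _).ofReal_comp).mul_const Complex.I).cexp
  have hc : HasDerivAt (fun t : ℝ => ((Real.cos (t * ω) : ℝ) : ℂ))
      ((-Real.sin (t * ω) * ω : ℝ) : ℂ) t := ((hasDerivAt_mul_const ω).cos).ofReal_comp
  have hs : HasDerivAt (fun t : ℝ => ((Real.sin (t * ω) / ω : ℝ) : ℂ))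
      ((Real.cos (t * ω) * ω / ω : ℝ) : ℂ) t :=
    (((hasDerivAt_mul_const ω).sin).div_const ω).ofReal_comp
  have h := hp.smul ((hc.smul_const s).add (hs.smul_const (diracSymbol m k s)))
  refine h.congr_deriv ?_
  -- at `ω = 0` the symbol vanishes, so the junk value `sin 0 / 0 = 0` is harmless
  have hcs : ((Real.cos (t * ω) * ω / ω : ℝ) : ℂ) • diracSymbol m k s =
      ((Real.cos (t * ω) : ℝ) : ℂ) • diracSymbol m k s := by
    rcases eq_or_ne ω 0 with h0 | h0
    · have : diracSymbol m k s = 0 := by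
        rw [← norm_eq_zero, norm_diracSymbol_apply, ← hω, h0, zero_mul]
      rw [this, smul_zero, smul_zero]
    · rw [mul_div_cancel_right₀ _ h0]
  have hss : ((Real.sin (t * ω) / ω : ℝ) : ℂ) * (-((ω ^ 2 : ℝ) : ℂ)) =
      ((-Real.sin (t * ω) * ω : ℝ) : ℂ) := by
    rw [← Complex.ofReal_neg, ← Complex.ofReal_mul]
    congr 1
    rcases eq_or_ne ω 0 with h0 | h0
    · simp [h0]
    · field_simp
  simp only [generatorSymbol, propagatorSymbol, _root_.add_apply,
    _root_.smul_apply, one_apply_eq_self, map_smul, map_add,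
    diracSymbol_apply_apply, ← hω, hcs, Pi.add_apply, smul_add, smul_smul]
  rw [← hss]
  module

theorem measurable_propagatorSymbol (m : ℝ) (v : Space3) (t : ℝ) :
    Measurable (propagatorSymbol m v t) := by
  unfold propagatorSymbol
  have h1 : Measurable (fun k => ((Real.cos (t * energy m k) : ℝ) : ℂ)) := by fun_prop
  have h2 : Measurable (fun k => ((Real.sin (t * energy m k) / energy m k : ℝ) : ℂ)) := by fun_prop
  exact (continuous_planeWave _).measurable.smul
    ((h1.smul measurable_const).add (h2.smul (continuous_diracSymbol m).measurable))

open scoped FourierTransform SchwartzMap LineDeriv ComplexConjugate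

/-! ### Distributions on the Fourier side -/

/-- Parseval for the pairing of an `L²` spinor field with a test function. -/
theorem distPair_eq_fourier (Ψ : SpinorL2) (φ : SchwartzMap Space3 ℂ) :
    distPair Ψ φ = ∫ k, (𝓕⁻ φ) k • (𝓕 Ψ : SpinorL2) k := by
  have h := congrArg (fun T : 𝓢'(Space3, Spinor) => T (𝓕⁻ φ))
    (Lp.fourier_toTemperedDistribution_eq Ψ)
  simp only [TemperedDistribution.fourier_apply, FourierTransform.fourier_fourierInv_eq,
    Lp.toTemperedDistribution_apply] at h
  exact h

theorem integrable_schwartz_smul (g : SchwartzMap Space3 ℂ) (f : SpinorL2) :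
    Integrable (fun k => g k • f k) :=
  memLp_one_iff_integrable.1 ((Lp.memLp f).smul (g.memLp 2 volume))

theorem partialD_eq (j : Fin 3) (φ : SchwartzMap Space3 ℂ) (x : Space3) :
    partialD j φ x = (∂_{EuclideanSpace.single j (1 : ℝ)} φ : SchwartzMap Space3 ℂ) x := by
  rw [SchwartzMap.lineDerivOp_apply_eq_fderiv]; rfl

theorem fourierInv_partialD (j : Fin 3) (φ : SchwartzMap Space3 ℂ) (k : Space3) :
    (𝓕⁻ (∂_{EuclideanSpace.single j (1 : ℝ)} φ : SchwartzMap Space3 ℂ)) k =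
      -(2 * Real.pi * Complex.I * k j) * (𝓕⁻ φ) k := by
  have : (fun x : Space3 => inner ℝ x (EuclideanSpace.single j (1 : ℝ))).HasTemperateGrowth := by
    fun_prop
  rw [SchwartzMap.fourierInv_lineDerivOp_eq, _root_.smul_apply,
    SchwartzMap.smulLeftCLM_apply_apply this, EuclideanSpace.inner_single_right]
  simp [mul_assoc]

theorem integrable_coord_schwartz_smul (j : Fin 3) (φ : SchwartzMap Space3 ℂ) (f : SpinorL2) :
    Integrable (fun k : Space3 => (2 * Real.pi * Complex.I * k j) • ((𝓕⁻ φ) k • f k)) := by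
  refine (integrable_schwartz_smul
    (𝓕⁻ (∂_{EuclideanSpace.single j (1 : ℝ)} φ : SchwartzMap Space3 ℂ)) f).neg.congr
    (Eventually.of_forall fun k => ?_)
  simp only [Pi.neg_apply]
  rw [fourierInv_partialD, smul_smul, neg_mul, neg_smul, neg_neg]

theorem distDerivPair_eq_fourier (j : Fin 3) (Ψ : SpinorL2) (φ : SchwartzMap Space3 ℂ) :
    distDerivPair j Ψ φ =
      ∫ k : Space3, (2 * Real.pi * Complex.I * k j) • ((𝓕⁻ φ) k • (𝓕 Ψ : SpinorL2) k) := by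
  have h := distPair_eq_fourier Ψ (∂_{EuclideanSpace.single j (1 : ℝ)} φ)
  rw [distDerivPair, ← integral_neg]
  rw [distPair] at h
  simp only [partialD_eq]
  rw [integral_neg, h, ← integral_neg]
  refine integral_congr_ae (Eventually.of_forall fun k => ?_)
  simp only
  rw [fourierInv_partialD, smul_smul, neg_mul, neg_smul, neg_neg]

theorem generatorSymbol_apply_eq_sum (m : ℝ) (v k : Space3) (s : Spinor) :
    generatorSymbol m v k s =
      -(∑ j, matCLM (diracAlpha j) ((2 * Real.pi * Complex.I * k j) • s)) -
        (Complex.I * m) • matCLM diracBeta s +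
        ∑ j, (v j : ℂ) • ((2 * Real.pi * Complex.I * k j) • s) := by
  have h : ((2 * Real.pi * inner ℝ k v : ℝ) * Complex.I) • s =
      ∑ j, (v j : ℂ) • ((2 * Real.pi * Complex.I * k j) • s) := by
    simp only [smul_smul, ← Finset.sum_smul]
    congr 1
    rw [PiLp.inner_apply]
    push_cast
    rw [Finset.mul_sum, Finset.sum_mul]
    refine Finset.sum_congr rfl fun j _ => ?_
    simp; ring
  simp only [generatorSymbol, diracSymbol, _root_.add_apply, _root_.sub_apply, _root_.neg_apply,
    _root_.smul_apply, one_apply_eq_self, h, map_smul, _root_.sum_apply]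

/-- Linear algebra commutes with integration, in the shape of the Dirac operator. -/
theorem integral_sum_clm_add {X : Type*} [MeasurableSpace X] {μ : Measure X}
    (A : Fin 3 → Spinor →L[ℂ] Spinor) (B : Spinor →L[ℂ] Spinor) (c : ℂ) (b : Fin 3 → ℂ)
    {h : Fin 3 → X → Spinor} {h₀ : X → Spinor} (hh : ∀ j, Integrable (h j) μ)
    (hh₀ : Integrable h₀ μ) :
    Integrable (fun k => -(∑ j, A j (h j k)) - c • B (h₀ k) + ∑ j, b j • h j k) μ ∧
    ∫ k, -(∑ j, A j (h j k)) - c • B (h₀ k) + ∑ j, b j • h j k ∂μ =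
      -(∑ j, A j (∫ k, h j k ∂μ)) - c • B (∫ k, h₀ k ∂μ) + ∑ j, b j • ∫ k, h j k ∂μ := by
  have i1 : Integrable (fun k => ∑ j, A j (h j k)) μ :=
    integrable_finsetSum _ fun j _ => (A j).integrable_comp (hh j)
  have i2 : Integrable (fun k => c • B (h₀ k)) μ := (B.integrable_comp hh₀).smul c
  have i3 : Integrable (fun k => ∑ j, b j • h j k) μ :=
    integrable_finsetSum _ fun j _ => (hh j).smul (b j)
  have i3' : ∀ j ∈ Finset.univ, Integrable (fun k => b j • h j k) μ :=
    fun j _ => (hh j).smul (b j)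
  have i12 : Integrable (fun k => -(∑ j, A j (h j k)) - c • B (h₀ k)) μ := i1.neg.sub i2
  have i1' : Integrable (fun k => -(∑ j, A j (h j k))) μ := i1.neg
  refine ⟨i12.add i3, ?_⟩
  rw [integral_add i12 i3, integral_sub i1' i2, integral_neg, integral_smul,
    integral_finsetSum _ (fun j _ => (A j).integrable_comp (hh j)),
    integral_finsetSum _ i3', B.integral_comp_comm hh₀]
  simp only [(A _).integral_comp_comm (hh _), integral_smul]

/-- On the Fourier side the generator acts as multiplication by its symbol. -/
theorem movingDiracPair_eq_fourier (m : ℝ) (v : Space3) (Ψ : SpinorL2)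
    (φ : SchwartzMap Space3 ℂ) :
    Integrable (fun k => (𝓕⁻ φ) k • generatorSymbol m v k ((𝓕 Ψ : SpinorL2) k)) ∧
    movingDiracPair m v Ψ φ =
      ∫ k, (𝓕⁻ φ) k • generatorSymbol m v k ((𝓕 Ψ : SpinorL2) k) := by
  have e : ∀ k, (𝓕⁻ φ) k • generatorSymbol m v k ((𝓕 Ψ : SpinorL2) k) =
      -(∑ j, matCLM (diracAlpha j)
          ((2 * Real.pi * Complex.I * k j) • ((𝓕⁻ φ) k • (𝓕 Ψ : SpinorL2) k))) -
        (Complex.I * m) • matCLM diracBeta ((𝓕⁻ φ) k • (𝓕 Ψ : SpinorL2) k) +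
        ∑ j, (v j : ℂ) • ((2 * Real.pi * Complex.I * k j) • ((𝓕⁻ φ) k • (𝓕 Ψ : SpinorL2) k)) := by
    intro k
    rw [← map_smul, generatorSymbol_apply_eq_sum]
  obtain ⟨h1, h2⟩ := integral_sum_clm_add (fun j => matCLM (diracAlpha j)) (matCLM diracBeta)
    (Complex.I * m) (fun j => (v j : ℂ)) (fun j => integrable_coord_schwartz_smul j φ (𝓕 Ψ))
    (integrable_schwartz_smul (𝓕⁻ φ) (𝓕 Ψ))
  simp only [e]
  refine ⟨h1, ?_⟩
  rw [h2, movingDiracPair, distPair_eq_fourier]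
  simp only [spinorAct_eq, distDerivPair_eq_fourier]

/-! ### The propagator as a Fourier multiplier -/

/-- Multiplication by `propagatorSymbol m v t`, the propagator on the Fourier side. -/
noncomputable def propagatorMul (m : ℝ) (v : Space3) (t : ℝ) : SpinorL2 →L[ℂ] SpinorL2 :=
  (ContinuousLinearMap.id ℂ (Spinor →L[ℂ] Spinor)).holderL volume ∞ 2 2
    ((memLp_top_of_bound (measurable_propagatorSymbol m v t).aestronglyMeasurable 2
      (Eventually.of_forall (norm_propagatorSymbol_le m v t))).toLp _)

theorem coeFn_propagatorMul (m : ℝ) (v : Space3) (t : ℝ) (f : SpinorL2) :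
    propagatorMul m v t f =ᵐ[volume] fun k => propagatorSymbol m v t k (f k) := by
  have h := ContinuousLinearMap.coeFn_holder (r := 2) (μ := (volume : Measure Space3))
    (ContinuousLinearMap.id ℂ (Spinor →L[ℂ] Spinor))
    ((memLp_top_of_bound (measurable_propagatorSymbol m v t).aestronglyMeasurable 2
      (Eventually.of_forall (norm_propagatorSymbol_le m v t))).toLp _) f
  refine h.trans ?_
  filter_upwards [MemLp.coeFn_toLp (memLp_top_of_bound
    (measurable_propagatorSymbol m v t).aestronglyMeasurable 2
    (Eventually.of_forall (norm_propagatorSymbol_le m v t)))] with k hk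
  rw [hk]; rfl

theorem norm_propagatorMul_apply_le (m : ℝ) (v : Space3) (t : ℝ) (f : SpinorL2) :
    ‖propagatorMul m v t f‖ ≤ 2 * ‖f‖ := by
  refine Lp.norm_le_mul_norm_of_ae_le_mul ?_
  filter_upwards [coeFn_propagatorMul m v t f] with k hk
  rw [hk]; exact norm_propagatorSymbol_apply_le m v t k _

theorem norm_sq_eq_integral (f : SpinorL2) : ‖f‖ ^ 2 = ∫ k, ‖f k‖ ^ 2 := by
  have h := L2.inner_def (𝕜 := ℂ) f f
  simp only [inner_self_eq_norm_sq_to_K] at h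
  have h2 : ((‖f‖ ^ 2 : ℝ) : ℂ) = ((∫ k, ‖f k‖ ^ 2 : ℝ) : ℂ) := by
    rw [← integral_complex_ofReal]; push_cast; simpa using h
  exact Complex.ofReal_injective h2

theorem integrable_norm_sq (f : SpinorL2) : Integrable (fun k => ‖f k‖ ^ 2) :=
  (memLp_two_iff_integrable_sq_norm (Lp.memLp f).1).1 (Lp.memLp f)

/-- Strong continuity of the propagator on the Fourier side, by dominated convergence. -/
theorem continuous_propagatorMul_apply (m : ℝ) (v : Space3) (f : SpinorL2) :
    Continuous (fun t => propagatorMul m v t f) := by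
  refine continuous_iff_continuousAt.2 fun t₀ => ?_
  rw [ContinuousAt, tendsto_iff_norm_sub_tendsto_zero]
  have hsq : ∀ t, ‖propagatorMul m v t f - propagatorMul m v t₀ f‖ ^ 2 =
      ∫ k, ‖propagatorSymbol m v t k (f k) - propagatorSymbol m v t₀ k (f k)‖ ^ 2 := by
    intro t
    rw [norm_sq_eq_integral]
    refine integral_congr_ae ?_
    filter_upwards [Lp.coeFn_sub (propagatorMul m v t f) (propagatorMul m v t₀ f),
      coeFn_propagatorMul m v t f, coeFn_propagatorMul m v t₀ f] with k h1 h2 h3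
    rw [h1, Pi.sub_apply, h2, h3]
  have hmeas : ∀ t, AEStronglyMeasurable (fun k => propagatorSymbol m v t k (f k)) :=
    fun t => (Lp.aestronglyMeasurable (propagatorMul m v t f)).congr (coeFn_propagatorMul m v t f)
  have hlim : Tendsto (fun t => ‖propagatorMul m v t f - propagatorMul m v t₀ f‖ ^ 2)
      (𝓝 t₀) (𝓝 0) := by
    simp only [hsq]
    have := tendsto_integral_filter_of_dominated_convergence (μ := (volume : Measure Space3))
      (l := 𝓝 t₀) (F := fun t k =>
        ‖propagatorSymbol m v t k (f k) - propagatorSymbol m v t₀ k (f k)‖ ^ 2)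
      (f := fun _ => 0) (fun k => 16 * ‖f k‖ ^ 2) ?_ ?_ ((integrable_norm_sq f).const_mul 16) ?_
    · simpa using this
    · exact Eventually.of_forall fun t => (((hmeas t).sub (hmeas t₀)).norm.pow 2)
    · refine Eventually.of_forall fun t => Eventually.of_forall fun k => ?_
      have h1 := norm_propagatorSymbol_apply_le m v t k (f k)
      have h2 := norm_propagatorSymbol_apply_le m v t₀ k (f k)
      have h3 : ‖propagatorSymbol m v t k (f k) - propagatorSymbol m v t₀ k (f k)‖ ≤ 4 * ‖f k‖ :=
        (norm_sub_le _ _).trans (by linarith)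
      rw [Real.norm_of_nonneg (by positivity)]
      calc _ ≤ (4 * ‖f k‖) ^ 2 := by gcongr
        _ = _ := by ring
    · refine Eventually.of_forall fun k => ?_
      have hc := (hasDerivAt_propagatorSymbol_apply m v k (f k) t₀).continuousAt
      have h : Tendsto (fun t => ‖propagatorSymbol m v t k (f k) -
          propagatorSymbol m v t₀ k (f k)‖ ^ 2) (𝓝 t₀) _ :=
        ((hc.sub (continuousAt_const (y := propagatorSymbol m v t₀ k (f k)))).norm.pow 2).tendsto
      simpa using h
  have := hlim.sqrt
  simpa using this

/-- The propagator of `∂ₜΨ = [-α·∇ - iβm + v·∇] Ψ`, as the Fourier multiplier with symbol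
`propagatorSymbol m v t`. -/
noncomputable def diracPropagator (m : ℝ) (v : Space3) (t : ℝ) : SpinorL2 →L[ℂ] SpinorL2 :=
  (Lp.fourierTransformₗᵢ Space3 Spinor).symm.toContinuousLinearEquiv.toContinuousLinearMap ∘L
    propagatorMul m v t ∘L
    (Lp.fourierTransformₗᵢ Space3 Spinor).toContinuousLinearEquiv.toContinuousLinearMap

theorem diracPropagator_apply (m : ℝ) (v : Space3) (t : ℝ) (Φ : SpinorL2) :
    diracPropagator m v t Φ = 𝓕⁻ (propagatorMul m v t (𝓕 Φ)) := rfl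

theorem fourier_diracPropagator (m : ℝ) (v : Space3) (t : ℝ) (Φ : SpinorL2) :
    𝓕 (diracPropagator m v t Φ) = propagatorMul m v t (𝓕 Φ) := by
  rw [diracPropagator_apply, FourierTransform.fourier_fourierInv_eq]

theorem norm_diracPropagator_apply_le (m : ℝ) (v : Space3) (t : ℝ) (Φ : SpinorL2) :
    ‖diracPropagator m v t Φ‖ ≤ 2 * ‖Φ‖ := by
  rw [← Lp.norm_fourier_eq (diracPropagator m v t Φ), fourier_diracPropagator, ← Lp.norm_fourier_eq Φ]
  exact norm_propagatorMul_apply_le m v t _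

theorem diracPropagator_zero_apply (m : ℝ) (v : Space3) (Φ : SpinorL2) :
    diracPropagator m v 0 Φ = Φ := by
  have h : propagatorMul m v 0 (𝓕 Φ) = 𝓕 Φ := by
    refine Lp.ext ?_
    filter_upwards [coeFn_propagatorMul m v 0 (𝓕 Φ)] with k hk
    rw [hk, propagatorSymbol_zero]; rfl
  rw [diracPropagator_apply, h, FourierTransform.fourierInv_fourier_eq]

theorem isMovingDiracSolution_diracPropagator (m : ℝ) (v : Space3) (Φ : SpinorL2) :
    IsMovingDiracSolution m v (fun t => diracPropagator m v t Φ) where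
  continuous := (Lp.fourierTransformₗᵢ Space3 Spinor).symm.continuous.comp
    (continuous_propagatorMul_apply m v (𝓕 Φ))
  equation φ t₀ := by
    set f : SpinorL2 := 𝓕 Φ with hf
    set g := 𝓕⁻ φ with hg
    have e1 : ∀ t, distPair (diracPropagator m v t Φ) φ =
        ∫ k, g k • propagatorSymbol m v t k (f k) := by
      intro t
      rw [distPair_eq_fourier, fourier_diracPropagator]
      refine integral_congr_ae ?_
      filter_upwards [coeFn_propagatorMul m v t (𝓕 Φ)] with k hk
      rw [hk]
    have e2 : movingDiracPair m v (diracPropagator m v t₀ Φ) φ =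
        ∫ k, g k • generatorSymbol m v k (propagatorSymbol m v t₀ k (f k)) := by
      rw [(movingDiracPair_eq_fourier m v _ φ).2, fourier_diracPropagator]
      refine integral_congr_ae ?_
      filter_upwards [coeFn_propagatorMul m v t₀ (𝓕 Φ)] with k hk
      rw [hk]
    simp only [e1]
    rw [e2]
    have hmeas : ∀ t, AEStronglyMeasurable (fun k => propagatorSymbol m v t k (f k)) :=
      fun t => (Lp.aestronglyMeasurable (propagatorMul m v t f)).congr (coeFn_propagatorMul m v t f)
    have hgm : AEStronglyMeasurable (fun k => g k) := g.continuous.aestronglyMeasurable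
    have hgen : AEStronglyMeasurable (fun k => generatorSymbol m v k
        (propagatorSymbol m v t₀ k (f k))) :=
      (ContinuousLinearMap.id ℂ (Spinor →L[ℂ] Spinor)).aestronglyMeasurable_comp₂
        (continuous_generatorSymbol m v).aestronglyMeasurable (hmeas t₀)
    have hgf := integrable_schwartz_smul g f
    have hbd : Integrable (fun k : Space3 => (|m| * ‖g k • f k‖ + (1 + ‖v‖) * ∑ j : Fin 3,
        ‖(2 * Real.pi * Complex.I * k j) • (g k • f k)‖) * 2) :=
      ((hgf.norm.const_mul _).add ((integrable_finsetSum _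
        fun j _ => (integrable_coord_schwartz_smul j φ f).norm).const_mul _)).mul_const 2
    refine (hasDerivAt_integral_of_dominated_loc_of_deriv_le (𝕜 := ℝ)
      (F := fun t k => g k • propagatorSymbol m v t k (f k))
      (F' := fun t k => g k • generatorSymbol m v k (propagatorSymbol m v t k (f k)))
      (s := Set.univ) univ_mem (Eventually.of_forall fun t => hgm.smul (hmeas t))
      ?_ (hgm.smul hgen) (Eventually.of_forall fun k t _ => ?_) hbd
      (Eventually.of_forall fun k t _ =>
        (hasDerivAt_propagatorSymbol_apply m v k (f k) t).const_smul (g k))).2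
    · refine (hgf.norm.const_mul 2).mono' (hgm.smul (hmeas t₀)) (Eventually.of_forall fun k => ?_)
      rw [norm_smul, norm_smul, mul_left_comm]
      gcongr
      exact norm_propagatorSymbol_apply_le m v t₀ k (f k)
    · have h1 := norm_generatorSymbol_apply_le m v k (propagatorSymbol m v t k (f k))
      have h2 := norm_propagatorSymbol_apply_le m v t k (f k)
      have hk : ‖k‖ ≤ ∑ j : Fin 3, ‖k j‖ := by
        rw [EuclideanSpace.norm_eq, Real.sqrt_le_iff]
        refine ⟨Finset.sum_nonneg fun j _ => norm_nonneg _, ?_⟩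
        exact Finset.sum_sq_le_sq_sum_of_nonneg fun j _ => norm_nonneg _
      have hπ := Real.pi_pos
      simp only [norm_smul, norm_mul, Complex.norm_I, Complex.norm_real, mul_one, Complex.norm_ofNat,
        Real.norm_of_nonneg hπ.le, ← Finset.sum_mul, ← Finset.mul_sum]
      calc ‖g k‖ * ‖generatorSymbol m v k (propagatorSymbol m v t k (f k))‖
          ≤ ‖g k‖ * ((|m| + 2 * Real.pi * (1 + ‖v‖) * ∑ j : Fin 3, ‖k j‖) * (2 * ‖f k‖)) := by
            refine mul_le_mul_of_nonneg_left (h1.trans ?_) (norm_nonneg _)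
            gcongr
        _ = _ := by ring

/-! ### Uniqueness of solutions -/

/-- The pairing with a fixed test function as an operator on `L²`. -/
noncomputable def distPairCLM (φ : SchwartzMap Space3 ℂ) : SpinorL2 →L[ℂ] Spinor :=
  (ContinuousLinearMap.lsmul ℂ ℂ : ℂ →L[ℂ] Spinor →L[ℂ] Spinor).lpPairing volume 2 2 (φ.toLp 2)

theorem distPairCLM_apply (φ : SchwartzMap Space3 ℂ) (Ψ : SpinorL2) :
    distPairCLM φ Ψ = distPair Ψ φ := by
  rw [distPairCLM, ContinuousLinearMap.lpPairing_eq_integral, distPair]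
  refine integral_congr_ae ?_
  filter_upwards [φ.coeFn_toLp 2 volume] with x hx
  rw [hx]; rfl

theorem distDerivPair_eq_distPair (j : Fin 3) (Ψ : SpinorL2) (φ : SchwartzMap Space3 ℂ) :
    distDerivPair j Ψ φ = -distPair Ψ (∂_{EuclideanSpace.single j (1 : ℝ)} φ) := by
  simp only [distDerivPair, distPair, partialD_eq]

/-- The value of `[-α·∇ - iβm + v·∇] Ψ` on a fixed test function, as an operator on `L²` in `Ψ`. -/
noncomputable def movingDiracPairCLM (m : ℝ) (v : Space3) (φ : SchwartzMap Space3 ℂ) :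
    SpinorL2 →L[ℂ] Spinor :=
  -(∑ j, matCLM (diracAlpha j) ∘L (-distPairCLM (∂_{EuclideanSpace.single j (1 : ℝ)} φ))) -
    (Complex.I * (m : ℂ)) • (matCLM diracBeta ∘L distPairCLM φ) +
    ∑ j, (v j : ℂ) • (-distPairCLM (∂_{EuclideanSpace.single j (1 : ℝ)} φ))

theorem movingDiracPairCLM_apply (m : ℝ) (v : Space3) (φ : SchwartzMap Space3 ℂ) (Ψ : SpinorL2) :
    movingDiracPairCLM m v φ Ψ = movingDiracPair m v Ψ φ := by
  simp only [movingDiracPairCLM, movingDiracPair, spinorAct_eq, distDerivPair_eq_distPair,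
    ← distPairCLM_apply, _root_.add_apply, _root_.sub_apply, _root_.neg_apply, _root_.smul_apply,
    _root_.sum_apply, ContinuousLinearMap.comp_apply]

theorem IsMovingDiracSolution.sub {m : ℝ} {v : Space3} {Ψ₁ Ψ₂ : ℝ → SpinorL2}
    (h₁ : IsMovingDiracSolution m v Ψ₁) (h₂ : IsMovingDiracSolution m v Ψ₂) :
    IsMovingDiracSolution m v (fun t => Ψ₁ t - Ψ₂ t) where
  continuous := h₁.continuous.sub h₂.continuous
  equation φ t := by
    have h := (h₁.equation φ t).sub (h₂.equation φ t)
    simp only [← distPairCLM_apply, ← movingDiracPairCLM_apply, map_sub] at h ⊢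
    exact h

theorem locallyIntegrable_generatorSymbol_apply (m : ℝ) (v : Space3) (f : SpinorL2) :
    LocallyIntegrable (fun k => generatorSymbol m v k (f k)) := by
  have hf : LocallyIntegrable (fun k => f k) (volume : Measure Space3) :=
    (Lp.memLp f).locallyIntegrable one_le_two
  rw [locallyIntegrable_iff] at hf ⊢
  intro K hK
  obtain ⟨C, hC⟩ := hK.exists_bound_of_continuousOn (continuous_generatorSymbol m v).continuousOn
  refine ((hf K hK).norm.const_mul C).mono' ?_ ?_
  · exact (ContinuousLinearMap.id ℂ (Spinor →L[ℂ] Spinor)).aestronglyMeasurable_comp₂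
      (continuous_generatorSymbol m v).aestronglyMeasurable (Lp.aestronglyMeasurable f).restrict
  · filter_upwards [ae_restrict_mem hK.measurableSet] with k hk
    exact (ContinuousLinearMap.le_opNorm _ _).trans (by gcongr; exact hC k hk)

/-- If `D = [-α·∇ - iβm + v·∇] E` as distributions, with `D, E ∈ L²`, then on the Fourier side
the equation holds almost everywhere. -/
theorem fourier_ae_eq_generatorSymbol {m : ℝ} {v : Space3} {D E : SpinorL2}
    (h : ∀ φ : SchwartzMap Space3 ℂ, distPair D φ = movingDiracPair m v E φ) :
    ∀ᵐ k, (𝓕 D : SpinorL2) k = generatorSymbol m v k ((𝓕 E : SpinorL2) k) := by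
  have hD : LocallyIntegrable (fun k => (𝓕 D : SpinorL2) k) (volume : Measure Space3) :=
    (Lp.memLp _).locallyIntegrable one_le_two
  have hE := locallyIntegrable_generatorSymbol_apply m v (𝓕 E)
  refine ae_eq_of_integral_contDiff_smul_eq hD hE fun g hg hgc => ?_
  have hg₁ : HasCompactSupport (Complex.ofRealCLM ∘ g) := hgc.comp_left rfl
  have hg₂ : ContDiff ℝ ((⊤ : ℕ∞) : WithTop ℕ∞) (Complex.ofRealCLM ∘ g) := by fun_prop
  set G : SchwartzMap Space3 ℂ := hg₁.toSchwartzMap hg₂ with hG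
  have h1 := h (𝓕 G)
  rw [distPair_eq_fourier, (movingDiracPair_eq_fourier m v E _).2,
    FourierTransform.fourierInv_fourier_eq] at h1
  simpa [hG] using h1

/-- Uniqueness: the energy identity for the time integral `E` of the solution `D`, for which
`E' = D = M E` holds in `L²` and not only in the sense of distributions. -/
theorem IsMovingDiracSolution.eq_zero {m : ℝ} {v : Space3} {D : ℝ → SpinorL2}
    (h : IsMovingDiracSolution m v D) (h0 : D 0 = 0) (t : ℝ) : D t = 0 := by
  set E : ℝ → SpinorL2 := fun t => ∫ s in (0 : ℝ)..t, D s with hE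
  have hE0 : E 0 = 0 := by simp [hE]
  have hEd : ∀ t, HasDerivAt E (D t) t := fun t =>
    (h.continuous.integral_hasStrictDerivAt 0 t).hasDerivAt
  -- the equation, integrated in time, reads `D = [-α·∇ - iβm + v·∇] E`
  have heq : ∀ t (φ : SchwartzMap Space3 ℂ), distPair (D t) φ = movingDiracPair m v (E t) φ := by
    intro t φ
    have hd : ∀ s, HasDerivAt (fun s => distPair (D s) φ - movingDiracPairCLM m v φ (E s)) 0 s := by
      intro s
      have h1 := (movingDiracPairCLM m v φ).restrictScalars ℝ |>.hasFDerivAt.comp_hasDerivAt s (hEd s)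
      have h2 := (h.equation φ s).sub h1
      rw [← movingDiracPairCLM_apply] at h2
      refine h2.congr_deriv (sub_self _)
    have hconst := is_const_of_deriv_eq_zero (fun s => (hd s).differentiableAt)
      (fun s => (hd s).deriv) t 0
    rw [h0, hE0, map_zero, sub_zero, ← distPairCLM_apply φ 0, map_zero,
      movingDiracPairCLM_apply] at hconst
    exact sub_eq_zero.1 hconst
  -- the energy identity `2 Re ⟪E, E'⟫ = 0`, by skew-adjointness of the symbol
  have hskew : ∀ t, inner ℂ (E t) (D t) + inner ℂ (D t) (E t) = 0 := by
    intro t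
    have hre : (inner ℂ (E t) (D t)).re = 0 := by
      rw [← Lp.inner_fourier_eq, L2.inner_def]
      have e : (∫ k, inner ℂ ((𝓕 (E t) : SpinorL2) k) ((𝓕 (D t) : SpinorL2) k)).re =
          ∫ k, (inner ℂ ((𝓕 (E t) : SpinorL2) k) ((𝓕 (D t) : SpinorL2) k)).re :=
        (integral_re (L2.integrable_inner (𝕜 := ℂ) (𝓕 (E t)) (𝓕 (D t)))).symm
      rw [e]
      refine integral_eq_zero_of_ae ?_
      filter_upwards [fourier_ae_eq_generatorSymbol (heq t)] with k hk
      rw [hk]; exact re_inner_generatorSymbol m v k _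
    rw [← inner_conj_symm (D t) (E t), Complex.add_conj, hre]; simp
  have hEz : ∀ t, E t = 0 := by
    intro t
    have hd : ∀ s, HasDerivAt (fun s => inner ℂ (E s) (E s)) 0 s := fun s =>
      ((hEd s).inner ℂ (hEd s)).congr_deriv (hskew s)
    have hconst := is_const_of_deriv_eq_zero (fun s => (hd s).differentiableAt)
      (fun s => (hd s).deriv) t 0
    rw [hE0, inner_zero_left] at hconst
    exact inner_self_eq_zero.1 hconst
  have : E = fun _ => 0 := funext hEz
  have hd := hEd t
  rw [this] at hd
  exact hd.unique (hasDerivAt_const t 0)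

theorem isMovingDiracPropagator_diracPropagator (m : ℝ) (v : Space3) :
    IsMovingDiracPropagator m v (diracPropagator m v) := by
  refine fun Φ => ⟨⟨isMovingDiracSolution_diracPropagator m v Φ, diracPropagator_zero_apply m v Φ⟩,
    fun Ψ hΨ h0 t => ?_⟩
  refine sub_eq_zero.1 ((hΨ.sub (isMovingDiracSolution_diracPropagator m v Φ)).eq_zero ?_ t)
  rw [h0, diracPropagator_zero_apply, sub_self]

theorem IsMovingDiracPropagator.apply_eq {m : ℝ} {v : Space3} {W : ℝ → SpinorL2 →L[ℂ] SpinorL2}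
    (hW : IsMovingDiracPropagator m v W) (t : ℝ) (Φ : SpinorL2) :
    W t Φ = diracPropagator m v t Φ :=
  (isMovingDiracPropagator_diracPropagator m v Φ).2 _ (hW Φ).1.1 (hW Φ).1.2 t

/-! ### Pairings inside the light cone -/

theorem planeWave_add (z z' k : Space3) :
    planeWave (z + z') k = planeWave z k * planeWave z' k := by
  rw [planeWave, planeWave, planeWave, ← Complex.exp_add, inner_add_right]
  congr 1; push_cast; ring

theorem conj_planeWave (z k : Space3) : conj (planeWave z k) = planeWave (-z) k := by
  rw [planeWave, planeWave, ← Complex.exp_conj, inner_neg_right]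
  congr 1
  rw [map_mul, Complex.conj_I, Complex.conj_ofReal]
  push_cast; ring

theorem integrable_mul_cexp_energy {m : ℝ} {g : Space3 → ℂ} (hg : Measurable g) {τ : ℂ}
    (h : Integrable (fun k => ‖g k‖ * Real.exp (-(τ.re * energy m k)))) :
    Integrable (fun k => g k * Complex.exp (-(τ * energy m k))) := by
  refine h.mono' (Measurable.aestronglyMeasurable (by fun_prop)) (Eventually.of_forall fun k => ?_)
  rw [norm_mul, Complex.norm_exp]; simp

theorem exp_mul_cos_eq (ε t ω : ℝ) :
    ((Real.exp (-(ε * ω)) * Real.cos (t * ω) : ℝ) : ℂ) =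
      (Complex.exp (-((ε - t * Complex.I) * ω)) + Complex.exp (-((ε + t * Complex.I) * ω))) / 2 := by
  push_cast
  rw [Complex.cos, mul_div_assoc', mul_add, ← Complex.exp_add, ← Complex.exp_add]
  ring_nf

theorem exp_mul_sin_eq (ε t ω : ℝ) :
    ((Real.exp (-(ε * ω)) * Real.sin (t * ω) : ℝ) : ℂ) =
      (Complex.exp (-((ε + t * Complex.I) * ω)) - Complex.exp (-((ε - t * Complex.I) * ω))) *
        (Complex.I / 2) := by
  push_cast
  rw [Complex.sin, mul_div_assoc', mul_div_assoc', ← mul_assoc, mul_sub, ← Complex.exp_add,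
    ← Complex.exp_add]
  ring_nf

/-- The damped kernel of the propagator between `a` and `b` is a combination of the scalar kernels
at `τ = ε ± it`, evaluated at `x + t v`. If `m = 0` the kernel of `ω⁻¹ sin(tω)` has the factor `0`, so no
bound for it is required. -/
theorem norm_integral_planeWave_mul_propagatorSymbol_le {m ε t : ℝ} (hε : 0 < ε) {K : ℝ}
    {v x : Space3} (a b : Spinor)
    (hcos : ∀ τ : ℂ, τ = ε - t * Complex.I ∨ τ = ε + t * Complex.I →
      ‖kernelCos m (x + t • v) τ‖ ≤ K)
    (hsin : ∀ τ : ℂ, τ = ε - t * Complex.I ∨ τ = ε + t * Complex.I → m ≠ 0 →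
      ‖kernelSin m (x + t • v) τ‖ ≤ K)
    (hgrad : ∀ τ : ℂ, τ = ε - t * Complex.I ∨ τ = ε + t * Complex.I →
      ∀ j, ‖kernelGrad m j (x + t • v) τ‖ ≤ K) :
    ‖∫ k, (Real.exp (-(ε * energy m k)) : ℂ) *
        (planeWave x k * inner ℂ a (propagatorSymbol m v t k b))‖ ≤
      K * (1 + 2 * Real.pi * ∑ j, ‖matCLM (diracAlpha j)‖ + |m| * ‖matCLM diracBeta‖) *
        (‖a‖ * ‖b‖) := by
  have hπ := Real.pi_pos
  set z := x + t • v with hz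
  set τ₁ : ℂ := ε - t * Complex.I with hτ₁
  set τ₂ : ℂ := ε + t * Complex.I with hτ₂
  have hr₁ : τ₁.re = ε := by simp [hτ₁]
  have hr₂ : τ₂.re = ε := by simp [hτ₂]
  have hC : ∀ τ : ℂ, τ.re = ε →
      Integrable (fun k => planeWave z k * Complex.exp (-(τ * energy m k))) := fun τ hτ =>
    integrable_mul_cexp_energy (by fun_prop) (by
      simpa only [norm_planeWave, one_mul, hτ] using integrable_exp_neg_energy m hε)
  have hG : ∀ (τ : ℂ) (j : Fin 3), τ.re = ε → Integrable (fun k : Space3 =>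
      (k j * planeWave z k / energy m k) * Complex.exp (-(τ * energy m k))) := fun τ j hτ =>
    integrable_mul_cexp_energy (by fun_prop) (by
      simpa only [hτ] using integrable_coord_mul_planeWave_div_energy m j z hε)
  have hS : ∀ τ : ℂ, τ.re = ε → Integrable (fun k =>
      (m : ℂ) * ((planeWave z k / energy m k) * Complex.exp (-(τ * energy m k)))) := fun τ hτ => by
    by_cases hm : m = 0
    · simp [hm]
    · exact (integrable_mul_cexp_energy (by fun_prop) (by
        simpa only [hτ] using integrable_planeWave_div_energy hm z hε)).const_mul _
  -- the pairing is a combination of the scalar kernels at `τ₁` and `τ₂`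
  set A : Fin 3 → ℂ := fun j => inner ℂ a (matCLM (diracAlpha j) b) with hA
  set B : ℂ := inner ℂ a (matCLM diracBeta b) with hB
  have e : ∀ k, (Real.exp (-(ε * energy m k)) : ℂ) *
        (planeWave x k * inner ℂ a (propagatorSymbol m v t k b)) =
      inner ℂ a b / 2 * (planeWave z k * Complex.exp (-(τ₁ * energy m k)) +
        planeWave z k * Complex.exp (-(τ₂ * energy m k))) +
      ((∑ j, Real.pi * A j * ((k j * planeWave z k / energy m k) * Complex.exp (-(τ₂ * energy m k)) -
        (k j * planeWave z k / energy m k) * Complex.exp (-(τ₁ * energy m k)))) +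
      B / 2 * ((m : ℂ) * ((planeWave z k / energy m k) * Complex.exp (-(τ₂ * energy m k))) -
        (m : ℂ) * ((planeWave z k / energy m k) * Complex.exp (-(τ₁ * energy m k))))) := by
    intro k
    have h1 := exp_mul_cos_eq ε t (energy m k)
    have h2 := exp_mul_sin_eq ε t (energy m k)
    rw [← hτ₁, ← hτ₂] at h1 h2
    have hD : inner ℂ a (diracSymbol m k b) =
        -(∑ j, 2 * Real.pi * Complex.I * k j * A j) - Complex.I * m * B := by
      simp only [diracSymbol, _root_.sub_apply, _root_.neg_apply, _root_.sum_apply,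
        _root_.smul_apply, inner_sub_right, inner_neg_right, inner_sum, inner_smul_right, hA, hB]
    have hU : planeWave x k * inner ℂ a (propagatorSymbol m v t k b) = planeWave z k *
        ((Real.cos (t * energy m k) : ℝ) * inner ℂ a b + (Real.sin (t * energy m k) : ℝ) *
          (inner ℂ a (diracSymbol m k b) / energy m k)) := by
      simp only [propagatorSymbol, _root_.smul_apply, _root_.add_apply, one_apply_eq_self,
        inner_smul_right, inner_add_right, hz, planeWave_add]
      push_cast; ring
    rw [hU, hD]
    have h3 : (Real.exp (-(ε * energy m k)) : ℂ) * (planeWave z k *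
        ((Real.cos (t * energy m k) : ℝ) * inner ℂ a b + (Real.sin (t * energy m k) : ℝ) *
          ((-(∑ j, 2 * Real.pi * Complex.I * k j * A j) - Complex.I * m * B) / energy m k))) =
        ((Real.exp (-(ε * energy m k)) * Real.cos (t * energy m k) : ℝ) : ℂ) *
          (planeWave z k * inner ℂ a b) +
        ((Real.exp (-(ε * energy m k)) * Real.sin (t * energy m k) : ℝ) : ℂ) *
          (planeWave z k * ((-(∑ j, 2 * Real.pi * Complex.I * k j * A j) - Complex.I * m * B) /
            energy m k)) := by
      push_cast; ring
    rw [h3, h1, h2]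
    simp only [Fin.sum_univ_three]
    ring_nf
    simp only [Complex.I_sq]
    ring
  simp only [e]
  have hGj : ∀ j, Integrable (fun k : Space3 => Real.pi * A j *
      ((k j * planeWave z k / energy m k) * Complex.exp (-(τ₂ * energy m k)) -
        (k j * planeWave z k / energy m k) * Complex.exp (-(τ₁ * energy m k)))) := fun j =>
    ((hG τ₂ j hr₂).sub (hG τ₁ j hr₁)).const_mul _
  have i1 : Integrable (fun k => inner ℂ a b / 2 *
      (planeWave z k * Complex.exp (-(τ₁ * energy m k)) +
        planeWave z k * Complex.exp (-(τ₂ * energy m k)))) :=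
    ((hC τ₁ hr₁).add (hC τ₂ hr₂)).const_mul _
  have i2 : Integrable (fun k : Space3 => ∑ j, Real.pi * A j *
      ((k j * planeWave z k / energy m k) * Complex.exp (-(τ₂ * energy m k)) -
        (k j * planeWave z k / energy m k) * Complex.exp (-(τ₁ * energy m k)))) :=
    integrable_finsetSum _ fun j _ => hGj j
  have i3 : Integrable (fun k => B / 2 *
      ((m : ℂ) * ((planeWave z k / energy m k) * Complex.exp (-(τ₂ * energy m k))) -
        (m : ℂ) * ((planeWave z k / energy m k) * Complex.exp (-(τ₁ * energy m k))))) :=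
    ((hS τ₂ hr₂).sub (hS τ₁ hr₁)).const_mul _
  have i23 : Integrable (fun k : Space3 => (∑ j, Real.pi * A j *
      ((k j * planeWave z k / energy m k) * Complex.exp (-(τ₂ * energy m k)) -
        (k j * planeWave z k / energy m k) * Complex.exp (-(τ₁ * energy m k)))) + B / 2 *
      ((m : ℂ) * ((planeWave z k / energy m k) * Complex.exp (-(τ₂ * energy m k))) -
        (m : ℂ) * ((planeWave z k / energy m k) * Complex.exp (-(τ₁ * energy m k))))) := i2.add i3
  rw [integral_add i1 i23, integral_add i2 i3, integral_finsetSum _ (fun j _ => hGj j),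
    integral_const_mul, integral_const_mul, integral_add (hC τ₁ hr₁) (hC τ₂ hr₂),
    integral_sub (hS τ₂ hr₂) (hS τ₁ hr₁), integral_const_mul, integral_const_mul]
  simp only [integral_const_mul, integral_sub (hG τ₂ _ hr₂) (hG τ₁ _ hr₁)]
  change ‖inner ℂ a b / 2 * (kernelCos m z τ₁ + kernelCos m z τ₂) +
    ((∑ j, Real.pi * A j * (kernelGrad m j z τ₂ - kernelGrad m j z τ₁)) +
    B / 2 * (m * kernelSin m z τ₂ - m * kernelSin m z τ₁))‖ ≤ _
  have hab : ‖(inner ℂ a b : ℂ)‖ ≤ ‖a‖ * ‖b‖ := norm_inner_le_norm a b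
  have hK : 0 ≤ K := (norm_nonneg _).trans (hcos τ₁ (Or.inl rfl))
  have hAj : ∀ j, ‖A j‖ ≤ ‖matCLM (diracAlpha j)‖ * (‖a‖ * ‖b‖) := fun j => by
    refine (norm_inner_le_norm _ _).trans ?_
    calc ‖a‖ * ‖matCLM (diracAlpha j) b‖ ≤ ‖a‖ * (‖matCLM (diracAlpha j)‖ * ‖b‖) := by
          gcongr; exact ContinuousLinearMap.le_opNorm _ _
      _ = _ := by ring
  have hBb : ‖B‖ ≤ ‖matCLM diracBeta‖ * (‖a‖ * ‖b‖) := by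
    refine (norm_inner_le_norm _ _).trans ?_
    calc ‖a‖ * ‖matCLM diracBeta b‖ ≤ ‖a‖ * (‖matCLM diracBeta‖ * ‖b‖) := by
          gcongr; exact ContinuousLinearMap.le_opNorm _ _
      _ = _ := by ring
  have b1 : ‖inner ℂ a b / 2 * (kernelCos m z τ₁ + kernelCos m z τ₂)‖ ≤ K * (‖a‖ * ‖b‖) := by
    rw [norm_mul, norm_div, Complex.norm_ofNat]
    have := (norm_add_le (kernelCos m z τ₁) (kernelCos m z τ₂)).trans
      (add_le_add (hcos τ₁ (Or.inl rfl)) (hcos τ₂ (Or.inr rfl)))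
    calc _ ≤ (‖a‖ * ‖b‖) / 2 * (K + K) := by gcongr
      _ = _ := by ring
  have b2 : ‖∑ j, Real.pi * A j * (kernelGrad m j z τ₂ - kernelGrad m j z τ₁)‖ ≤
      K * (2 * Real.pi * ∑ j, ‖matCLM (diracAlpha j)‖) * (‖a‖ * ‖b‖) := by
    refine (norm_sum_le _ _).trans ?_
    rw [Finset.mul_sum, Finset.mul_sum, Finset.sum_mul]
    refine Finset.sum_le_sum fun j _ => ?_
    rw [norm_mul, norm_mul, Complex.norm_real, Real.norm_of_nonneg hπ.le]
    have := (norm_sub_le (kernelGrad m j z τ₂) (kernelGrad m j z τ₁)).trans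
      (add_le_add (hgrad τ₂ (Or.inr rfl) j) (hgrad τ₁ (Or.inl rfl) j))
    calc _ ≤ Real.pi * (‖matCLM (diracAlpha j)‖ * (‖a‖ * ‖b‖)) * (K + K) := by
          gcongr; exact hAj j
      _ = _ := by ring
  have hmS : ∀ τ : ℂ, τ = τ₁ ∨ τ = τ₂ → ‖m * kernelSin m z τ‖ ≤ |m| * K := fun τ hτ => by
    rw [norm_mul, Complex.norm_real, Real.norm_eq_abs]
    rcases eq_or_ne m 0 with h | h
    · simp [h]
    · exact mul_le_mul_of_nonneg_left (hsin τ hτ h) (abs_nonneg _)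
  have b3 : ‖B / 2 * (m * kernelSin m z τ₂ - m * kernelSin m z τ₁)‖ ≤
      K * (|m| * ‖matCLM diracBeta‖) * (‖a‖ * ‖b‖) := by
    rw [norm_mul, norm_div, Complex.norm_ofNat]
    have := (norm_sub_le (m * kernelSin m z τ₂) (m * kernelSin m z τ₁)).trans
      (add_le_add (hmS τ₂ (Or.inr rfl)) (hmS τ₁ (Or.inl rfl)))
    calc _ ≤ (‖matCLM diracBeta‖ * (‖a‖ * ‖b‖)) / 2 * (|m| * K + |m| * K) := by gcongr
      _ = _ := by ring
  calc _ ≤ K * (‖a‖ * ‖b‖) + (K * (2 * Real.pi * ∑ j, ‖matCLM (diracAlpha j)‖) * (‖a‖ * ‖b‖) +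
        K * (|m| * ‖matCLM diracBeta‖) * (‖a‖ * ‖b‖)) :=
        norm_add_le_of_le b1 (norm_add_le_of_le b2 b3)
    _ = _ := by ring

/-- On `L¹ ∩ L²` the Fourier transform of `L²` is given by the Fourier integral. -/
theorem coeFn_fourier_of_integrable {f : SpinorL2} (hf : Integrable f) :
    (𝓕 f : SpinorL2) =ᵐ[volume] fun k => ∫ x, planeWave (-x) k • f x := by
  have e : ∀ k, (𝓕 (f : Space3 → Spinor)) k = ∫ x, planeWave (-x) k • f x := by
    intro k
    rw [Real.fourier_eq]
    refine integral_congr_ae (Eventually.of_forall fun x => ?_)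
    simp only [planeWave, Circle.smul_def, Real.fourierChar_apply, inner_neg_right,
      real_inner_comm]
  have hc : Continuous (𝓕 (f : Space3 → Spinor)) :=
    VectorFourier.fourierIntegral_continuous Real.continuous_fourierChar
      (by exact continuous_inner) hf
  have h1 : (𝓕 f : SpinorL2) =ᵐ[volume] 𝓕 (f : Space3 → Spinor) := by
    refine ae_eq_of_integral_contDiff_smul_eq ((Lp.memLp _).locallyIntegrable one_le_two)
      hc.locallyIntegrable fun g hg hgc => ?_
    have hg₁ : HasCompactSupport (Complex.ofRealCLM ∘ g) := hgc.comp_left rfl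
    have hg₂ : ContDiff ℝ ((⊤ : ℕ∞) : WithTop ℕ∞) (Complex.ofRealCLM ∘ g) := by fun_prop
    set G : SchwartzMap Space3 ℂ := hg₁.toSchwartzMap hg₂ with hG
    have h2 := distPair_eq_fourier f (𝓕 G)
    rw [FourierTransform.fourierInv_fourier_eq, distPair] at h2
    have h3 : ∫ k, 𝓕 (G : Space3 → ℂ) k • f k = ∫ x, G x • 𝓕 (f : Space3 → Spinor) x := by
      simpa using! VectorFourier.integral_fourierIntegral_smul_eq_flip (L := innerₗ Space3)
        Real.continuous_fourierChar continuous_inner G.integrable hf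
    rw [SchwartzMap.fourier_coe, h3] at h2
    simpa [hG] using h2.symm
  filter_upwards [h1] with k hk
  rw [hk, e]

/-- The sesquilinear pairing of two Fourier integrals as an integral over the product space. -/
theorem integral_planeWave_mul_inner_eq {f g : SpinorL2} (hf : Integrable f) (hg : Integrable g)
    (U : Spinor →L[ℂ] Spinor) (k : Space3) :
    inner ℂ (∫ x, planeWave (-x) k • g x) (U (∫ y, planeWave (-y) k • f y)) =
      ∫ p : Space3 × Space3, planeWave (p.1 - p.2) k * inner ℂ (g p.1) (U (f p.2)) := by
  have hpw : Continuous fun x => planeWave (-x) k := by unfold planeWave; fun_prop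
  have hpf : Integrable fun y => planeWave (-y) k • f y :=
    hf.bdd_smul 1 hpw.aestronglyMeasurable (Eventually.of_forall fun x => (norm_planeWave _ _).le)
  have hpg : Integrable fun y => planeWave (-y) k • g y :=
    hg.bdd_smul 1 hpw.aestronglyMeasurable (Eventually.of_forall fun x => (norm_planeWave _ _).le)
  have e : ∀ x y : Space3, planeWave (x - y) k * inner ℂ (g x) (U (f y)) =
      inner ℂ (planeWave (-x) k • g x) (U (planeWave (-y) k • f y)) := fun x y => by
    rw [inner_smul_left, conj_planeWave, neg_neg, map_smul, inner_smul_right, sub_eq_add_neg,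
      planeWave_add]
    ring
  simp only [e]
  have hint : Integrable (fun p : Space3 × Space3 =>
      inner ℂ (planeWave (-p.1) k • g p.1) (U (planeWave (-p.2) k • f p.2)))
      ((volume : Measure Space3).prod volume) := by
    refine (hpg.norm.mul_prod ((U.integrable_comp hpf).norm)).mono'
      (hpg.aestronglyMeasurable.comp_fst.inner
        (U.integrable_comp hpf).aestronglyMeasurable.comp_snd)
      (Eventually.of_forall fun p => norm_inner_le_norm _ _)
  rw [Measure.volume_eq_prod, integral_prod _ hint]
  simp only [integral_inner (U.integrable_comp hpf)]
  rw [ContinuousLinearMap.integral_comp_comm U hpf, ← inner_conj_symm, ← integral_inner hpg,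
    ← integral_conj]
  simp only [inner_conj_symm]

/-- Fubini: after damping the frequencies, a pairing of the propagator is controlled by the
`L¹` norms of the two states and a bound of the damped kernel on their supports. -/
theorem norm_integral_exp_mul_inner_propagatorSymbol_le {m ε t : ℝ} (hε : 0 < ε) {v : Space3}
    {f g : SpinorL2} (hf : Integrable f) (hg : Integrable g) {B : Set Space3}
    (hfB : ∀ᵐ x : Space3, x ∉ B → f x = 0) (hgB : ∀ᵐ x : Space3, x ∉ B → g x = 0) {M : ℝ}
    (hM : ∀ x ∈ B, ∀ y ∈ B, ∀ a b : Spinor, ‖∫ k, (Real.exp (-(ε * energy m k)) : ℂ) *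
        (planeWave (x - y) k * inner ℂ a (propagatorSymbol m v t k b))‖ ≤ M * (‖a‖ * ‖b‖)) :
    ‖∫ k, (Real.exp (-(ε * energy m k)) : ℂ) *
        inner ℂ ((𝓕 g : SpinorL2) k) (propagatorSymbol m v t k ((𝓕 f : SpinorL2) k))‖ ≤
      M * ((∫ x, ‖g x‖) * ∫ x, ‖f x‖) := by
  have e1 : ∫ k, (Real.exp (-(ε * energy m k)) : ℂ) *
        inner ℂ ((𝓕 g : SpinorL2) k) (propagatorSymbol m v t k ((𝓕 f : SpinorL2) k)) =
      ∫ k, ∫ p : Space3 × Space3, (Real.exp (-(ε * energy m k)) : ℂ) * (planeWave (p.1 - p.2) k *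
        inner ℂ (g p.1) (propagatorSymbol m v t k (f p.2))) := by
    refine integral_congr_ae ?_
    filter_upwards [coeFn_fourier_of_integrable hf, coeFn_fourier_of_integrable hg] with k h1 h2
    rw [h1, h2, integral_planeWave_mul_inner_eq hf hg, integral_const_mul]
  have hm : StronglyMeasurable (fun q : Space3 × (Space3 × Space3) =>
      (Real.exp (-(ε * energy m q.1)) : ℂ) * (planeWave (q.2.1 - q.2.2) q.1 *
        inner ℂ (g q.2.1) (propagatorSymbol m v t q.1 (f q.2.2)))) := by
    have h1 : StronglyMeasurable (fun q : Space3 × (Space3 × Space3) =>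
        propagatorSymbol m v t q.1 (f q.2.2)) :=
      isBoundedBilinearMap_apply.continuous.comp_stronglyMeasurable
        (((measurable_propagatorSymbol m v t).stronglyMeasurable.comp_measurable
          measurable_fst).prodMk
          ((Lp.stronglyMeasurable f).comp_measurable (measurable_snd.comp measurable_snd)))
    have h2 : Continuous (fun q : Space3 × (Space3 × Space3) => planeWave (q.2.1 - q.2.2) q.1) := by
      unfold planeWave; fun_prop
    have h3 : Continuous (fun q : Space3 × (Space3 × Space3) =>
        (Real.exp (-(ε * energy m q.1)) : ℂ)) := by
      have := continuous_energy m
      fun_prop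
    exact h3.stronglyMeasurable.mul (h2.stronglyMeasurable.mul
      (((Lp.stronglyMeasurable g).comp_measurable
        (measurable_fst.comp measurable_snd)).inner h1))
  have hi : Integrable (fun q : Space3 × (Space3 × Space3) =>
      (Real.exp (-(ε * energy m q.1)) : ℂ) * (planeWave (q.2.1 - q.2.2) q.1 *
        inner ℂ (g q.2.1) (propagatorSymbol m v t q.1 (f q.2.2))))
      ((volume : Measure Space3).prod ((volume : Measure Space3).prod volume)) := by
    refine ((integrable_exp_neg_energy m hε).mul_prod
      (hg.norm.mul_prod (hf.norm.const_mul 2))).mono' hm.aestronglyMeasurable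
      (Eventually.of_forall fun q => ?_)
    rw [norm_mul, norm_mul, norm_planeWave, one_mul, Complex.norm_real,
      Real.norm_of_nonneg (Real.exp_pos _).le]
    refine mul_le_mul_of_nonneg_left ((norm_inner_le_norm _ _).trans ?_) (Real.exp_pos _).le
    exact mul_le_mul_of_nonneg_left (norm_propagatorSymbol_apply_le m v t _ _) (norm_nonneg _)
  rw [e1, Measure.volume_eq_prod, integral_integral_swap hi, ← integral_prod_mul,
    ← integral_const_mul]
  refine norm_integral_le_of_norm_le ((hg.norm.mul_prod hf.norm).const_mul M) ?_
  filter_upwards [Measure.quasiMeasurePreserving_fst.ae hgB,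
    Measure.quasiMeasurePreserving_snd.ae hfB] with p h1 h2
  by_cases hx : p.1 ∈ B
  · by_cases hy : p.2 ∈ B
    · exact hM _ hx _ hy _ _
    · simp [h2 hy]
  · simp [h1 hx]

/-- Removal of the frequency damping `e^{-εω}`. -/
theorem norm_inner_diracPropagator_le_of_damped {m t : ℝ} {v : Space3} (f g : SpinorL2) {M : ℝ}
    {ε₀ : ℝ} (hε₀ : 0 < ε₀)
    (h : ∀ ε, 0 < ε → ε ≤ ε₀ → ‖∫ k, (Real.exp (-(ε * energy m k)) : ℂ) *
        inner ℂ ((𝓕 g : SpinorL2) k) (propagatorSymbol m v t k ((𝓕 f : SpinorL2) k))‖ ≤ M) :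
    ‖(inner ℂ g (diracPropagator m v t f) : ℂ)‖ ≤ M := by
  have e1 : (inner ℂ g (diracPropagator m v t f) : ℂ) =
      ∫ k, inner ℂ ((𝓕 g : SpinorL2) k) (propagatorSymbol m v t k ((𝓕 f : SpinorL2) k)) := by
    rw [← Lp.inner_fourier_eq, fourier_diracPropagator, L2.inner_def]
    refine integral_congr_ae ?_
    filter_upwards [coeFn_propagatorMul m v t (𝓕 f)] with k hk
    rw [hk]
  have hI : Integrable (fun k =>
      inner ℂ ((𝓕 g : SpinorL2) k) (propagatorSymbol m v t k ((𝓕 f : SpinorL2) k))) := by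
    refine (L2.integrable_inner (𝕜 := ℂ) (𝓕 g : SpinorL2) (propagatorMul m v t (𝓕 f))).congr ?_
    filter_upwards [coeFn_propagatorMul m v t (𝓕 f)] with k hk
    rw [hk]
  have hlim : Tendsto (fun ε : ℝ => ∫ k, (Real.exp (-(ε * energy m k)) : ℂ) *
      inner ℂ ((𝓕 g : SpinorL2) k) (propagatorSymbol m v t k ((𝓕 f : SpinorL2) k))) (𝓝[>] 0)
      (𝓝 (inner ℂ g (diracPropagator m v t f))) := by
    rw [e1]
    have hω := continuous_energy m
    refine tendsto_integral_filter_of_dominated_convergence _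
      (Eventually.of_forall fun ε => ?_) ?_ hI.norm (Eventually.of_forall fun k => ?_)
    · exact (Continuous.aestronglyMeasurable (by fun_prop)).mul hI.aestronglyMeasurable
    · filter_upwards [self_mem_nhdsWithin] with ε (hε : 0 < ε)
      refine Eventually.of_forall fun k => ?_
      rw [norm_mul, Complex.norm_real, Real.norm_of_nonneg (Real.exp_pos _).le]
      refine mul_le_of_le_one_left (norm_nonneg _) (Real.exp_le_one_iff.2 ?_)
      exact neg_nonpos.2 (mul_nonneg hε.le (energy_nonneg m k))
    · have hc : Continuous (fun ε : ℝ => (Real.exp (-(ε * energy m k)) : ℂ) *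
          inner ℂ ((𝓕 g : SpinorL2) k) (propagatorSymbol m v t k ((𝓕 f : SpinorL2) k))) := by
        fun_prop
      simpa using (hc.tendsto 0).mono_left (nhdsWithin_le_nhds (s := Set.Ioi 0))
  refine le_of_tendsto hlim.norm ?_
  filter_upwards [Ioc_mem_nhdsGT hε₀] with ε hε
  exact h ε hε.1 hε.2

/-- Dispersive estimate inside the light cone. In the moving frame the kernel sees the
points `x - y + t v`, which stay in `|z| ≤ (1 - δ / 2) t`, `δ = 1 - |v|`, as long as `x` and `y`
stay in the ball of radius `δ t / 4`. -/
theorem exists_norm_inner_diracPropagator_le (m : ℝ) {v : Space3} (hv : ‖v‖ < 1) :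
    ∃ C, 0 ≤ C ∧ ∀ (t : ℝ) (f g : SpinorL2), 1 ≤ t → Integrable f → Integrable g →
      (∀ᵐ x : Space3, x ∉ Metric.closedBall (0 : Space3) ((1 - ‖v‖) / 4 * t) → f x = 0) →
      (∀ᵐ x : Space3, x ∉ Metric.closedBall (0 : Space3) ((1 - ‖v‖) / 4 * t) → g x = 0) →
      ‖(inner ℂ g (diracPropagator m v t f) : ℂ)‖ ≤
        C * (t * √t)⁻¹ * ((∫ x, ‖g x‖) * ∫ x, ‖f x‖) := by
  set δ := 1 - ‖v‖ with hδ
  have hδ0 : 0 < δ := sub_pos.2 hv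
  have hδ1 : δ ≤ 1 := sub_le_self _ (norm_nonneg _)
  obtain ⟨C, hC, H⟩ := exists_norm_kernel_le m (c := δ / 2) (by positivity)
  refine ⟨C * (1 + 2 * Real.pi * ∑ j, ‖matCLM (diracAlpha j)‖ + |m| * ‖matCLM diracBeta‖),
    by positivity, fun t f g ht hf hg hfB hgB => ?_⟩
  have ht0 : 0 < t := by linarith
  refine norm_inner_diracPropagator_le_of_damped f g (ε₀ := δ / 4) (by positivity)
    fun ε hε hεδ => norm_integral_exp_mul_inner_propagatorSymbol_le hε hf hg hfB hgB
      fun x hx y hy a b => ?_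
  rw [mem_closedBall_zero_iff] at hx hy
  have hz : ‖x - y + t • v‖ ≤ (1 - δ / 2) * t := by
    have h1 : ‖t • v‖ = t * (1 - δ) := by rw [norm_smul, Real.norm_of_nonneg ht0.le, hδ]; ring
    have := norm_add_le (x - y) (t • v)
    have := norm_sub_le x y
    linarith
  have hz1 : ‖x - y + t • v‖ ≤ t := hz.trans (by nlinarith)
  have key : ∀ τ : ℂ, τ = ε - t * Complex.I ∨ τ = ε + t * Complex.I →
      0 < τ.re ∧ ‖τ‖ ≤ 2 * t ∧ δ / 2 * t ^ 2 ≤ ‖τ ^ 2 + (‖x - y + t • v‖ ^ 2 : ℝ)‖ := by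
    have hz2 : ‖x - y + t • v‖ ^ 2 ≤ ((1 - δ / 2) * t) ^ 2 := by gcongr
    -- `t² - ε² - (1 - δ/2)² t² ≥ (δ - δ²/4 - δ/4) t² ≥ (δ/2) t²`, as `ε ≤ δ/4` and `t ≥ 1`
    have hlow : δ / 2 * t ^ 2 ≤ t ^ 2 - ε ^ 2 - ‖x - y + t • v‖ ^ 2 := by
      have h1 : ε ^ 2 ≤ δ / 4 * t ^ 2 := by
        calc ε ^ 2 ≤ (δ / 4) ^ 2 := by gcongr
          _ ≤ δ / 4 * 1 := by nlinarith
          _ ≤ δ / 4 * t ^ 2 := by gcongr; nlinarith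
      nlinarith [mul_nonneg hδ0.le (sq_nonneg t), mul_nonneg (mul_nonneg hδ0.le
        (sub_nonneg.2 hδ1)) (sq_nonneg t)]
    have hre : ∀ τ : ℂ, (τ ^ 2 + (‖x - y + t • v‖ ^ 2 : ℝ)).re =
        τ.re ^ 2 - τ.im ^ 2 + ‖x - y + t • v‖ ^ 2 := fun τ => by
      rw [Complex.add_re, Complex.ofReal_re, pow_two τ, Complex.mul_re]; ring
    intro τ hτ
    have hr : τ.re = ε := by rcases hτ with rfl | rfl <;> simp
    have hi : |τ.im| = t := by
      rcases hτ with rfl | rfl <;> simp [abs_of_pos ht0]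
    refine ⟨hr ▸ hε, ?_, ?_⟩
    · refine (Complex.norm_le_abs_re_add_abs_im τ).trans ?_
      rw [hr, hi, abs_of_pos hε]; linarith
    · refine le_trans ?_ (Complex.abs_re_le_norm _)
      rw [hre, hr, ← sq_abs τ.im, hi, abs_of_nonpos (by nlinarith [sq_nonneg t])]
      linarith
  have hK : ∀ τ : ℂ, (h : τ = ε - t * Complex.I ∨ τ = ε + t * Complex.I) → _ := fun τ h =>
    H t (x - y + t • v) τ ht (key τ h).1 (key τ h).2.1 hz1 (key τ h).2.2
  refine (norm_integral_planeWave_mul_propagatorSymbol_le hε a b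
    (fun τ h => (hK τ h).1) (fun τ h => (hK τ h).2.1) fun τ h => (hK τ h).2.2).trans (le_of_eq ?_)
  ring

/-! ### Weighted norms -/

theorem aestronglyMeasurable_weight_smul (σ : ℝ) {f : Space3 → Spinor}
    (hf : AEStronglyMeasurable f) : AEStronglyMeasurable (fun x => (1 + ‖x‖) ^ σ • f x) :=
  have h : Measurable fun x : Space3 => (1 + ‖x‖) ^ σ := by fun_prop
  h.aestronglyMeasurable.smul hf

theorem agmonNorm_congr_ae (σ : ℝ) {f g : Space3 → Spinor} (h : f =ᵐ[volume] g) :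
    agmonNorm σ f = agmonNorm σ g :=
  eLpNorm_congr_ae (by filter_upwards [h] with x hx; rw [hx])

theorem agmonNorm_zero_weight (f : SpinorL2) : agmonNorm 0 f = ENNReal.ofReal ‖f‖ := by
  rw [ofReal_norm, Lp.enorm_def]
  simp [agmonNorm]

theorem agmonNorm_mono {σ σ' : ℝ} (h : σ ≤ σ') (f : Space3 → Spinor) :
    agmonNorm σ f ≤ agmonNorm σ' f := by
  refine eLpNorm_mono fun x => ?_
  have h1 : (1 : ℝ) ≤ 1 + ‖x‖ := by linarith [norm_nonneg x]
  rw [norm_smul, norm_smul, Real.norm_of_nonneg (by positivity), Real.norm_of_nonneg (by positivity)]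
  gcongr

theorem agmonNorm_add_le (σ : ℝ) (f g : SpinorL2) :
    agmonNorm σ (f + g : SpinorL2) ≤ agmonNorm σ f + agmonNorm σ g := by
  rw [agmonNorm_congr_ae σ (Lp.coeFn_add f g)]
  refine le_trans (le_of_eq ?_) (eLpNorm_add_le
    (aestronglyMeasurable_weight_smul σ (Lp.aestronglyMeasurable f))
    (aestronglyMeasurable_weight_smul σ (Lp.aestronglyMeasurable g)) one_le_two)
  simp only [agmonNorm, Pi.add_apply, smul_add]
  rfl

/-- Away from the ball of radius `r` a weight `σ` may be lowered to `σ'` with a gain. -/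
theorem agmonNorm_indicator_compl_closedBall_le {σ σ' r : ℝ} (h : σ ≤ σ') (hr : 0 ≤ r)
    (f : Space3 → Spinor) :
    agmonNorm σ ((Metric.closedBall (0 : Space3) r)ᶜ.indicator f) ≤
      ENNReal.ofReal ((1 + r) ^ (σ - σ')) * agmonNorm σ' f := by
  have h0 : 0 ≤ (1 + r) ^ (σ - σ') := by positivity
  rw [agmonNorm, agmonNorm]
  refine eLpNorm_le_mul_eLpNorm_of_ae_le_mul (Eventually.of_forall fun x => ?_) 2
  have hp : 0 < 1 + ‖x‖ := by positivity
  by_cases hx : x ∈ (Metric.closedBall (0 : Space3) r)ᶜ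
  · have hx' : r < ‖x‖ := by simpa using hx
    rw [Set.indicator_of_mem hx, norm_smul, norm_smul, Real.norm_of_nonneg (by positivity),
      Real.norm_of_nonneg (by positivity), ← mul_assoc]
    gcongr
    calc (1 + ‖x‖) ^ σ = (1 + ‖x‖) ^ (σ - σ') * (1 + ‖x‖) ^ σ' := by
          rw [← Real.rpow_add hp, sub_add_cancel]
      _ ≤ (1 + r) ^ (σ - σ') * (1 + ‖x‖) ^ σ' := by
          refine mul_le_mul_of_nonneg_right ?_ (by positivity)
          exact Real.rpow_le_rpow_of_nonpos (by positivity) (by linarith) (by linarith)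
  · rw [Set.indicator_of_notMem hx, smul_zero, norm_zero]
    positivity

theorem agmonNorm_indicator_le (σ : ℝ) (s : Set Space3) (f : Space3 → Spinor) :
    agmonNorm σ (s.indicator f) ≤ agmonNorm σ f := by
  refine eLpNorm_mono fun x => ?_
  rw [norm_smul, norm_smul]
  gcongr
  exact norm_indicator_le_norm_self f x

theorem memLp_weight {ν : ℝ} (hν : 3 / 2 < ν) :
    MemLp (fun x : Space3 => (1 + ‖x‖) ^ (-ν)) 2 volume := by
  rw [memLp_two_iff_integrable_sq (Measurable.aestronglyMeasurable (by fun_prop))]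
  have h := integrable_one_add_norm (E := Space3) (μ := volume) (r := 2 * ν)
    (by rw [finrank_euclideanSpace_fin]; push_cast; linarith)
  refine h.congr (Eventually.of_forall fun x => ?_)
  have hp : 0 ≤ 1 + ‖x‖ := by positivity
  simp only
  rw [← Real.rpow_natCast, ← Real.rpow_mul hp]
  congr 1; push_cast; ring

/-- For `ν > 3/2` the weighted space is contained in `L¹`, by the Cauchy–Schwarz inequality. -/
theorem exists_integral_norm_le_agmonNorm {ν : ℝ} (hν : 3 / 2 < ν) :
    ∃ A : ℝ, 0 ≤ A ∧ ∀ (f : SpinorL2) (N : ℝ), 0 ≤ N → agmonNorm ν f ≤ ENNReal.ofReal N →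
      Integrable f ∧ ∫ x, ‖f x‖ ≤ A * N := by
  have hw := memLp_weight hν
  refine ⟨(eLpNorm (fun x : Space3 => (1 + ‖x‖) ^ (-ν)) 2 volume).toReal, ENNReal.toReal_nonneg,
    fun f N hN h => ?_⟩
  have hfm := Lp.aestronglyMeasurable f
  have e : (f : Space3 → Spinor) = (fun x : Space3 => (1 + ‖x‖) ^ (-ν)) •
      fun x => (1 + ‖x‖) ^ ν • f x := by
    ext1 x
    have hp : 0 < 1 + ‖x‖ := by positivity
    simp only [Pi.smul_apply', smul_smul]
    rw [← Real.rpow_add hp, neg_add_cancel, Real.rpow_zero, one_smul]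
  have h1 : eLpNorm f 1 volume ≤ ENNReal.ofReal
      ((eLpNorm (fun x : Space3 => (1 + ‖x‖) ^ (-ν)) 2 volume).toReal * N) := by
    rw [ENNReal.ofReal_mul ENNReal.toReal_nonneg, ENNReal.ofReal_toReal hw.eLpNorm_ne_top]
    nth_rw 1 [e]
    exact (eLpNorm_smul_le_mul_eLpNorm (p := 2) (q := 2) (r := 1)
      (aestronglyMeasurable_weight_smul ν hfm) hw.aestronglyMeasurable).trans
      (mul_le_mul_right h _)
  have h2 : Integrable f := memLp_one_iff_integrable.1 ⟨hfm, h1.trans_lt ENNReal.ofReal_lt_top⟩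
  refine ⟨h2, ?_⟩
  rw [integral_norm_eq_lintegral_enorm hfm, ← eLpNorm_one_eq_lintegral_enorm]
  exact ENNReal.toReal_le_of_le_ofReal (by positivity) h1

/-- Inside the ball, the weighted norm is obtained by testing against `(1 + |x|)^{-2ν} h`, cut
off to the ball. -/
theorem exists_test_state {ν : ℝ} (hν : 0 ≤ ν) (r : ℝ) (h : SpinorL2) :
    ∃ (g : SpinorL2) (X : ℝ), 0 ≤ X ∧
      (∀ᵐ x : Space3, x ∉ Metric.closedBall (0 : Space3) r → g x = 0) ∧
      agmonNorm (-ν) ((Metric.closedBall (0 : Space3) r).indicator h) = ENNReal.ofReal X ∧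
      agmonNorm ν g = ENNReal.ofReal X ∧ X ^ 2 ≤ ‖(inner ℂ g h : ℂ)‖ := by
  set B := Metric.closedBall (0 : Space3) r with hB
  have hBm : MeasurableSet B := measurableSet_closedBall
  set p : Space3 → Spinor := fun x => (1 + ‖x‖) ^ (-ν) • B.indicator h x with hp
  have hle : ∀ x : Space3, (1 + ‖x‖) ^ (-ν) ≤ 1 := fun x =>
    Real.rpow_le_one_of_one_le_of_nonpos (by linarith [norm_nonneg x]) (by linarith)
  have hbd : ∀ {q : Space3 → Spinor}, MemLp q 2 volume →
      MemLp (fun x => (1 + ‖x‖) ^ (-ν) • q x) 2 volume := fun {q} hq => by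
    refine hq.mono (aestronglyMeasurable_weight_smul _ hq.1) (Eventually.of_forall fun x => ?_)
    rw [norm_smul, Real.norm_of_nonneg (by positivity)]
    exact mul_le_of_le_one_left (norm_nonneg _) (hle x)
  have hpL : MemLp p 2 volume := hbd ((Lp.memLp h).indicator hBm)
  have hgL : MemLp (fun x => (1 + ‖x‖) ^ (-ν) • p x) 2 volume := hbd hpL
  have hX : eLpNorm p 2 volume = ENNReal.ofReal ‖hpL.toLp p‖ := by
    rw [Lp.norm_toLp, ENNReal.ofReal_toReal hpL.eLpNorm_ne_top]
  refine ⟨hgL.toLp _, ‖hpL.toLp p‖, norm_nonneg _, ?_, hX, ?_, ?_⟩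
  · filter_upwards [hgL.coeFn_toLp] with x hx hxB
    rw [hx, hp]
    simp only [Set.indicator_of_notMem hxB, smul_zero]
  · rw [agmonNorm_congr_ae ν hgL.coeFn_toLp, ← hX, agmonNorm]
    congr 1
    ext1 x
    have hp : 0 < 1 + ‖x‖ := by positivity
    rw [smul_smul, ← Real.rpow_add hp, add_neg_cancel, Real.rpow_zero, one_smul]
  · have e : (inner ℂ (hgL.toLp _) h : ℂ) = inner ℂ (hpL.toLp p) (hpL.toLp p) := by
      rw [L2.inner_def, L2.inner_def]
      refine integral_congr_ae ?_
      filter_upwards [hgL.coeFn_toLp, hpL.coeFn_toLp] with x h1 h2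
      rw [h1, h2, hp]
      by_cases hx : x ∈ B
      · simp only [Set.indicator_of_mem hx, inner_smul_left_eq_smul, inner_smul_right_eq_smul]
      · simp only [Set.indicator_of_notMem hx, smul_zero, inner_zero_left]
    rw [e, inner_self_eq_norm_sq_to_K, norm_pow]
    simp

/-! ### The dispersive estimate -/

/-- For `t ≥ 1`: the parts of the initial state and of the solution outside the ball of radius
`(1 - |v|) t / 4` are small because of the weights, the rest is a pairing inside the light cone. -/
theorem exists_agmonNorm_diracPropagator_le (m : ℝ) {v : Space3} (hv : ‖v‖ < 1) {ν : ℝ}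
    (hν : 3 / 2 < ν) :
    ∃ C, 0 ≤ C ∧ ∀ (t N : ℝ) (Φ : SpinorL2), 1 ≤ t → 0 ≤ N →
      agmonNorm ν Φ ≤ ENNReal.ofReal N →
      agmonNorm (-ν) (diracPropagator m v t Φ) ≤ ENNReal.ofReal (C * (t * √t)⁻¹ * N) := by
  obtain ⟨C, hC, hpair⟩ := exists_norm_inner_diracPropagator_le m hv
  obtain ⟨A, hA, hL1⟩ := exists_integral_norm_le_agmonNorm hν
  set δ := (1 - ‖v‖) / 4 with hδ
  have hδ0 : 0 < δ := by have := sub_pos.2 hv; positivity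
  have hν0 : 0 ≤ ν := by linarith
  refine ⟨C * A ^ 2 + 4 * δ ^ (-ν), by positivity, fun t N Φ ht hN hΦ => ?_⟩
  have ht0 : 0 < t := by linarith
  set a := (t * √t)⁻¹ with ha
  have ha0 : 0 ≤ a := by positivity
  set B := Metric.closedBall (0 : Space3) (δ * t) with hB
  have hBm : MeasurableSet B := measurableSet_closedBall
  have hgain : (1 + δ * t) ^ (-ν) ≤ δ ^ (-ν) * a := by
    calc (1 + δ * t) ^ (-ν) ≤ (δ * t) ^ (-ν) :=
          Real.rpow_le_rpow_of_nonpos (by positivity) (by linarith) (by linarith)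
      _ = δ ^ (-ν) * t ^ (-ν) := Real.mul_rpow hδ0.le ht0.le
      _ ≤ δ ^ (-ν) * t ^ (-(3 / 2) : ℝ) := by gcongr
      _ = δ ^ (-ν) * a := by
          rw [ha, Real.rpow_neg ht0.le, Real.sqrt_eq_rpow]
          congr 2
          nth_rw 2 [← Real.rpow_one t]
          rw [← Real.rpow_add ht0]; norm_num
  have hnorm : ∀ {f : SpinorL2} {c : ℝ}, 0 ≤ c → agmonNorm 0 f ≤ ENNReal.ofReal c → ‖f‖ ≤ c :=
    fun {f c} hc h => by rwa [agmonNorm_zero_weight, ENNReal.ofReal_le_ofReal_iff hc] at h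
  -- splitting of the initial state
  set Φ₁ : SpinorL2 := ((Lp.memLp Φ).indicator hBm).toLp _ with hΦ₁
  set Φ₂ : SpinorL2 := ((Lp.memLp Φ).indicator hBm.compl).toLp _ with hΦ₂
  have h₁ : Φ₁ =ᵐ[volume] B.indicator Φ := MemLp.coeFn_toLp _
  have h₂ : Φ₂ =ᵐ[volume] Bᶜ.indicator Φ := MemLp.coeFn_toLp _
  have hsum : Φ = Φ₁ + Φ₂ := by
    refine Lp.ext ?_
    filter_upwards [h₁, h₂, Lp.coeFn_add Φ₁ Φ₂] with x e1 e2 e3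
    rw [e3, Pi.add_apply, e1, e2, ← Pi.add_apply, Set.indicator_self_add_compl]
  have hN₁ : agmonNorm ν Φ₁ ≤ ENNReal.ofReal N := by
    rw [agmonNorm_congr_ae ν h₁]; exact (agmonNorm_indicator_le ν B Φ).trans hΦ
  have hn₁ : ‖Φ₁‖ ≤ N := hnorm hN ((agmonNorm_mono hν0 _).trans hN₁)
  have hn₂ : ‖Φ₂‖ ≤ δ ^ (-ν) * a * N := by
    refine hnorm (by positivity) ?_
    rw [agmonNorm_congr_ae 0 h₂]
    refine (agmonNorm_indicator_compl_closedBall_le hν0 (by positivity) _).trans ?_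
    rw [zero_sub, ENNReal.ofReal_mul (by positivity)]
    gcongr
  obtain ⟨hi₁, hI₁⟩ := hL1 Φ₁ N hN hN₁
  -- the solution with data `Φ₁`, inside the ball
  set h := diracPropagator m v t Φ₁ with hh
  obtain ⟨g, X, hX0, hgB, hXn, hgX, hX⟩ := exists_test_state hν0 (δ * t) h
  obtain ⟨hgi, hgI⟩ := hL1 g X hX0 hgX.le
  have hXle : X ≤ C * A ^ 2 * a * N := by
    rcases hX0.eq_or_lt with h0 | h0
    · rw [← h0]; positivity
    · have hfB : ∀ᵐ x : Space3, x ∉ B → Φ₁ x = 0 := by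
        filter_upwards [h₁] with x hx hxB
        rw [hx, Set.indicator_of_notMem hxB]
      have h1 := hX.trans (hpair t Φ₁ g ht hi₁ hgi hfB hgB)
      have h2 : C * a * ((∫ x, ‖g x‖) * ∫ x, ‖Φ₁ x‖) ≤ C * a * ((A * X) * (A * N)) := by
        have : 0 ≤ ∫ x, ‖Φ₁ x‖ := integral_nonneg fun x => norm_nonneg _
        gcongr
      -- both sides of `X² ≤ C t^{-3/2} ‖g‖₁ ‖Φ₁‖₁ ≤ C t^{-3/2} (A X) (A N)` contain `X`
      have h3 : X * X ≤ (C * A ^ 2 * a * N) * X := by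
        calc X * X = X ^ 2 := by ring
          _ ≤ _ := h1.trans h2
          _ = _ := by ring
      exact le_of_mul_le_mul_right h3 h0
  have hin : agmonNorm (-ν) (B.indicator h) ≤ ENNReal.ofReal (C * A ^ 2 * a * N) :=
    hXn.trans_le (ENNReal.ofReal_le_ofReal hXle)
  -- the solution with data `Φ₁`, outside the ball
  have hout : agmonNorm (-ν) (Bᶜ.indicator h) ≤ ENNReal.ofReal (δ ^ (-ν) * a * (2 * N)) := by
    refine (agmonNorm_indicator_compl_closedBall_le (σ' := 0) (by linarith) (by positivity)
      _).trans ?_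
    rw [sub_zero, agmonNorm_zero_weight, ENNReal.ofReal_mul (p := δ ^ (-ν) * a) (by positivity)]
    gcongr
    exact (norm_diracPropagator_apply_le m v t Φ₁).trans (by linarith)
  have hh1 : agmonNorm (-ν) h ≤
      ENNReal.ofReal (C * A ^ 2 * a * N) + ENNReal.ofReal (δ ^ (-ν) * a * (2 * N)) := by
    refine le_trans ?_ (add_le_add hin hout)
    have hm := Lp.aestronglyMeasurable h
    refine le_trans (le_of_eq ?_) (eLpNorm_add_le
      (aestronglyMeasurable_weight_smul (-ν) (hm.indicator hBm))
      (aestronglyMeasurable_weight_smul (-ν) (hm.indicator hBm.compl)) one_le_two)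
    rw [agmonNorm]
    congr 1
    ext1 x
    rw [Pi.add_apply, ← smul_add, ← Pi.add_apply, Set.indicator_self_add_compl]
  have hh2 : agmonNorm (-ν) (diracPropagator m v t Φ₂) ≤
      ENNReal.ofReal (2 * (δ ^ (-ν) * a * N)) := by
    refine (agmonNorm_mono (by linarith : -ν ≤ 0) _).trans ?_
    rw [agmonNorm_zero_weight]
    exact ENNReal.ofReal_le_ofReal ((norm_diracPropagator_apply_le m v t Φ₂).trans (by linarith))
  rw [hsum, map_add]
  refine (agmonNorm_add_le _ _ _).trans ((add_le_add hh1 hh2).trans (le_of_eq ?_))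
  rw [← ENNReal.ofReal_add (by positivity) (by positivity),
    ← ENNReal.ofReal_add (by positivity) (by positivity)]
  congr 1; ring

theorem lemma17p1 (m : ℝ) (v : Space3) (hv : ‖v‖ < 1) :
    (∃ W : ℝ → SpinorL2 →L[ℂ] SpinorL2, IsMovingDiracPropagator m v W) ∧
    ∀ W : ℝ → SpinorL2 →L[ℂ] SpinorL2, IsMovingDiracPropagator m v W →
      ∀ ν : ℝ, 3 / 2 < ν →
        ∃ C : ℝ, 0 < C ∧ ∀ Φ : SpinorL2, agmonNorm ν Φ < ∞ → ∀ t : ℝ, 0 ≤ t →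
          agmonNorm (-ν) (W t Φ) ≤
            ENNReal.ofReal (C / (1 + |t|) ^ (3 / 2 : ℝ)) * agmonNorm ν Φ := by
  refine ⟨⟨_, isMovingDiracPropagator_diracPropagator m v⟩, fun W hW ν hν => ?_⟩
  obtain ⟨C, hC, H⟩ := exists_agmonNorm_diracPropagator_le m hv hν
  refine ⟨2 ^ (3 / 2 : ℝ) * (C + 2), by positivity, fun Φ hΦ t ht => ?_⟩
  rw [hW.apply_eq, abs_of_nonneg ht]
  have hN : agmonNorm ν Φ = ENNReal.ofReal (agmonNorm ν Φ).toReal :=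
    (ENNReal.ofReal_toReal hΦ.ne).symm
  set N := (agmonNorm ν Φ).toReal
  have hN0 : 0 ≤ N := ENNReal.toReal_nonneg
  rw [hN, ← ENNReal.ofReal_mul (by positivity)]
  rcases le_total t 1 with h1 | h1
  · -- for bounded times the `L²` bound suffices
    have hb : ‖Φ‖ ≤ N := by
      have := agmonNorm_mono (by linarith : (0 : ℝ) ≤ ν) (Φ : Space3 → Spinor)
      rwa [agmonNorm_zero_weight, hN, ENNReal.ofReal_le_ofReal_iff hN0] at this
    refine (agmonNorm_mono (by linarith : -ν ≤ 0) _).trans ?_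
    rw [agmonNorm_zero_weight]
    refine ENNReal.ofReal_le_ofReal ((norm_diracPropagator_apply_le m v t Φ).trans ?_)
    have h2 : 2 ≤ 2 ^ (3 / 2 : ℝ) * (C + 2) / (1 + t) ^ (3 / 2 : ℝ) := by
      rw [le_div_iff₀ (by positivity)]
      calc 2 * (1 + t) ^ (3 / 2 : ℝ) ≤ 2 * 2 ^ (3 / 2 : ℝ) := by gcongr; linarith
        _ ≤ 2 ^ (3 / 2 : ℝ) * (C + 2) := by
          rw [mul_comm]; gcongr; linarith
    gcongr
  · refine (H t N Φ h1 hN0 hN.le).trans (ENNReal.ofReal_le_ofReal ?_)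
    have ht0 : 0 < t := by linarith
    refine mul_le_mul_of_nonneg_right ?_ hN0
    have h3 : t * √t = t ^ (3 / 2 : ℝ) := by
      rw [Real.sqrt_eq_rpow]
      nth_rw 1 [← Real.rpow_one t]
      rw [← Real.rpow_add ht0]; norm_num
    rw [h3, ← div_eq_mul_inv, div_le_div_iff₀ (by positivity) (by positivity)]
    calc C * (1 + t) ^ (3 / 2 : ℝ) ≤ (C + 2) * (2 * t) ^ (3 / 2 : ℝ) := by
          gcongr <;> linarith
      _ = 2 ^ (3 / 2 : ℝ) * (C + 2) * t ^ (3 / 2 : ℝ) := by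
          rw [Real.mul_rpow zero_le_two ht0.le]; ring
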